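/- Smoothness is understood in the Michal–Bastiani sense. Let $M$ be a smooth (Hausdorff) Fréchet manifold modelled on a Fréchet space $F$. Let $\mathcal B$ be a bornology on $F$: a family of bounded sets that covers $F$, is directed upwards by inclusion, and such that for all $B\in\mathcal B$ and $r\in\mathbb R$ the set $rB$ is contained in a member of $\mathcal B$. Assume that $\mathcal B$ contains all compact sets and that $T(B)\in\mathcal B$ for every $B\in\mathcal B$ and every continuous linear endomorphism $T$ of $F$. Let $F'_{\mathcal B}$ be the dual of $F$ with the topology of uniform convergence on the members of $\mathcal B$, let $TM'_{\mathcal B}=\bigcup_x (T_xM)'_{\mathcal B}$ be the $\mathcal B$-cotangent bundle, and let $\mathbb TM=TM\oplus TM'_{\mathcal B}$, with typical fibre $F\times F'_{\mathcal B}$. A *vector bundle* over $M$ is meant in the category of locally convex spaces: it has a Hausdorff locally convex typical fibre $E$, local trivializations over open sets covering $M$ that are linear homeomorphisms on fibres, and transition functions that are smooth maps $x\mapsto g(x)$ into $L(E,E)$, the space of continuous linear maps with the topology of uniform convergence on bounded sets. Bundle maps are given in local trivializations by smooth maps into spaces $L(E,E')$. Write $\Gamma$ for smooth global sections, $df$ for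 the differential of a function, $d\alpha$ for the de Rham derivative of a 1-form, and $\mathcal L_X=d\circ\iota_X+\iota_X\circ d$. **(1)** $\mathbb TM$ is a vector bundle. With the anchor $\lambda(X,\alpha)=X$, the pairing $$\Theta\big((X,\alpha),(Y,\beta)\big)=\alpha(Y)+\beta(X)$$ and the bracket $$[(X,\alpha),(Y,\beta)]_{\mathbb TM}=\big([X,Y],\ \mathcal L_X\beta-\iota_Y d\alpha\big)$$ it is a Courant algebroid. That is, $\lambda$ is a smooth bundle map to $TM$; $\Theta$ is symmetric and (on each fibre, weakly) nondegenerate and takes pairs of smooth sections to smooth functions; the bracket is an $\mathbb R$-bilinear map $\Gamma(\mathbb TM)\times\Gamma(\mathbb TM)\to\Gamma(\mathbb TM)$; and for all $s_1,s_2,s_3\in\Gamma(\mathbb TM)$: - $[s_1,[s_2,s_3]]=[[s_1,s_2],s_3]+[s_2,[s_1,s_3]]$; - $\lambda(s_1)\Theta(s_2,s_3)=\Theta([s_1,s_2],s_3)+\Theta(s_2,[s_1,s_3])$; - $[s_1,s_2]+[s_2,s_1]=\Delta(\Theta(s_1,s_2))$, where $\Delta:C^\infty(M)\to\Gamma(\mathbb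 TM)$ is characterized by $\Theta_x(\Delta(f)(x),v)=df_x(\lambda(v))$ for all $f\in C^\infty(M)$, $x\in M$ and $v\in\mathbb T_xM$. Moreover $\lambda([s_1,s_2])=[\lambda(s_1),\lambda(s_2)]$ and $[s_1,fs_2]=f[s_1,s_2]+(\lambda(s_1)f)\,s_2$ for all $f\in C^\infty(M)$. **(2)** The Courant bracket $$[\![(X,\alpha),(Y,\beta)]\!]=\Big([X,Y],\ \mathcal L_X\beta-\mathcal L_Y\alpha+\tfrac12 d\big(\alpha(Y)-\beta(X)\big)\Big)$$ maps $\Gamma(\mathbb TM)\times\Gamma(\mathbb TM)$ to $\Gamma(\mathbb TM)$. **(3)** Let $D\subset\mathbb TM$ be a Dirac structure: a vector subbundle (locally, in compatible trivializations of $\mathbb TM$, given by a fixed closed subspace $E_D$ of $F\times F'_{\mathcal B}$) with $D=D^\perp$, where $D^\perp_x=\{v\in\mathbb T_xM:\Theta_x(v,w)=0\ \ \forall w\in D_x\}$, whose smooth sections are closed under $[\cdot,\cdot]_{\mathbb TM}$. Then the smooth sections of the bundle $D$ are exactly the smooth sections of $\mathbb TM$ with values in $D$, the bracket $[\![\cdot,\cdot]\!]$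 restricts to a Lie bracket $[\![\cdot,\cdot]\!]_D$ on $\Gamma(D)$, and with the restriction $\mathrm{Pr}:D\to TM$ of the projection, $(D,[\![\cdot,\cdot]\!]_D,\mathrm{Pr})$ is a Lie algebroid over the Fréchet manifold $M$. That is, $D$ is a vector bundle with typical fibre $E_D$, $\mathrm{Pr}$ is a smooth bundle map that induces a Lie algebra homomorphism $\Gamma(D)\to\mathfrak X(M)$, and $$[\![s_1,fs_2]\!]=f[\![s_1,s_2]\!]+(\mathrm{Pr}(s_1)f)\,s_2\qquad\text{for } s_1,s_2\in\Gamma(D),\ f\in C^\infty(M).$$ If, moreover, $E_D$ is a Fréchet space, then $D$ is a Fréchet Lie algebroid in the strict sense: the transition maps $(x,v)\mapsto g(x)v$ of $D$ and the anchor are also jointly smooth in local trivializations. -/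

import Mathlib

open Set Filter Topology

noncomputable section

/-! ## Fréchet spaces and Michal–Bastiani calculus -/

/-- A real Fréchet space: a locally convex, metrizable and complete topological vector space. -/
class FrechetSpace (E : Type*) [AddCommGroup E] [Module ℝ E] [TopologicalSpace E] : Prop
    extends IsTopologicalAddGroup E, ContinuousSMul ℝ E, LocallyConvexSpace ℝ E,
      TopologicalSpace.MetrizableSpace E where
  complete : @CompleteSpace E (IsTopologicalAddGroup.rightUniformSpace E)

section Calculus

/-- `v` is the derivative of `f` at `x` in the direction `h`. -/
def HasDirDeriv {E W : Type*} [AddCommGroup E] [Module ℝ E]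
    [AddCommGroup W] [Module ℝ W] [TopologicalSpace W] (f : E → W) (x h : E) (v : W) : Prop :=
  Tendsto (fun t : ℝ => t⁻¹ • (f (x + t • h) - f x)) (𝓝[≠] 0) (𝓝 v)

/-- `f` is of class `C^k` in the Michal–Bastiani sense on the (open) set `U`: for `k + 1`, `f` is
continuous, all directional derivatives `df(x)(h)` exist for `x ∈ U`, and
`df : U × E → W` is of class `C^k`. -/
def CkOn {W : Type*} [AddCommGroup W] [Module ℝ W] [TopologicalSpace W] :
    ℕ → ∀ {E : Type*} [AddCommGroup E] [Module ℝ E] [TopologicalSpace E],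
      (E → W) → Set E → Prop
  | 0, _, _, _, _, f, U => ContinuousOn f U
  | k + 1, E, _, _, _, f, U =>
      ContinuousOn f U ∧ ∃ df : E × E → W,
        (∀ x ∈ U, ∀ h, HasDirDeriv f x h (df (x, h))) ∧ CkOn k df (U ×ˢ (univ : Set E))

/-- `f` is smooth on the (open) set `U` in the Michal–Bastiani sense. -/
def SmoothOn {E W : Type*} [AddCommGroup E] [Module ℝ E] [TopologicalSpace E]
    [AddCommGroup W] [Module ℝ W] [TopologicalSpace W] (f : E → W) (U : Set E) : Prop :=
  ∀ k : ℕ, CkOn k f U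

open Classical in
/-- The derivative `df(x) : E → W` as a continuous linear map. (It exists at every point of an open
set on which `f` is `C^1`; where there is none, the value is `0`.) -/
def mbDeriv {E W : Type*} [AddCommGroup E] [Module ℝ E] [TopologicalSpace E]
    [AddCommGroup W] [Module ℝ W] [TopologicalSpace W] (f : E → W) (x : E) : E →L[ℝ] W :=
  if h : ∃ L : E →L[ℝ] W, ∀ v, HasDirDeriv f x v (L v) then h.choose else 0

variable {E E' W : Type*} [AddCommGroup E] [Module ℝ E] [TopologicalSpace E]
  [AddCommGroup E'] [Module ℝ E'] [TopologicalSpace E']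
  [AddCommGroup W] [Module ℝ W] [TopologicalSpace W]

theorem CkOn.continuousOn {k : ℕ} {f : E → W} {U : Set E} (h : CkOn k f U) :
    ContinuousOn f U := by
  cases k with
  | zero => exact h
  | succ k => exact h.1

theorem CkOn.of_succ {k : ℕ} {f : E → W} {U : Set E} (h : CkOn (k + 1) f U) : CkOn k f U := by
  induction k generalizing E with
  | zero => exact h.1
  | succ k ih =>
    obtain ⟨hc, df, hd, hk⟩ := h
    exact ⟨hc, df, hd, ih hk⟩

theorem CkOn.mono {k : ℕ} {f : E → W} {U U' : Set E} (h : CkOn k f U) (hU : U' ⊆ U) :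
    CkOn k f U' := by
  induction k generalizing E with
  | zero => exact ContinuousOn.mono h hU
  | succ k ih =>
    obtain ⟨hc, df, hd, hk⟩ := h
    exact ⟨hc.mono hU, df, fun x hx => hd x (hU hx), ih hk (prod_mono hU le_rfl)⟩

theorem CkOn.comp_clm {k : ℕ} {f : E → W} {U : Set E} (h : CkOn k f U) (L : E' →L[ℝ] E) :
    CkOn k (f ∘ L) (L ⁻¹' U) := by
  induction k generalizing E E' with
  | zero => exact ContinuousOn.comp h L.continuous.continuousOn (fun _ hx => hx)
  | succ k ih =>
    obtain ⟨hc, df, hd, hk⟩ := h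
    refine ⟨hc.comp L.continuous.continuousOn (fun _ hx => hx), df ∘ (L.prodMap L), ?_, ?_⟩
    · intro x hx v
      have := hd (L x) hx (L v)
      simpa [HasDirDeriv] using this
    · have := ih hk (L.prodMap L)
      have e : (L.prodMap L) ⁻¹' (U ×ˢ (univ : Set E)) = (L ⁻¹' U) ×ˢ (univ : Set E') := by
        ext p; simp
      rwa [e] at this

theorem CkOn.zero (k : ℕ) (U : Set E) : CkOn k (fun _ => (0 : W)) U := by
  induction k generalizing E with
  | zero => exact continuousOn_const
  | succ k ih =>
    refine ⟨continuousOn_const, fun _ => 0, ?_, ih _⟩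
    intro x _ h
    simpa [HasDirDeriv] using tendsto_const_nhds

theorem CkOn.add [IsTopologicalAddGroup W] {k : ℕ} {f g : E → W} {U : Set E}
    (hf : CkOn k f U) (hg : CkOn k g U) : CkOn k (fun x => f x + g x) U := by
  induction k generalizing E with
  | zero => exact ContinuousOn.add hf hg
  | succ k ih =>
    obtain ⟨hc, df, hd, hk⟩ := hf
    obtain ⟨hc', dg, hd', hk'⟩ := hg
    refine ⟨hc.add hc', fun p => df p + dg p, ?_, ih hk hk'⟩
    intro x hx h
    refine ((hd x hx h).add (hd' x hx h)).congr fun t => ?_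
    rw [← smul_add, add_sub_add_comm]

theorem HasDirDeriv.tendsto {E W : Type*} [AddCommGroup E] [Module ℝ E] [AddCommGroup W]
    [Module ℝ W] [TopologicalSpace W] [IsTopologicalAddGroup W] [ContinuousSMul ℝ W]
    {f : E → W} {x h : E} {v : W} (hf : HasDirDeriv f x h v) :
    Tendsto (fun t : ℝ => f (x + t • h)) (𝓝[≠] 0) (𝓝 (f x)) := by
  have h1 : Tendsto (fun t : ℝ => t) (𝓝[≠] 0) (𝓝 0) := tendsto_nhdsWithin_of_tendsto_nhds tendsto_id
  have h2 := (h1.smul hf).add_const (f x)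
  rw [zero_smul, zero_add] at h2
  refine h2.congr' ?_
  filter_upwards [self_mem_nhdsWithin] with t ht
  rw [smul_smul, mul_inv_cancel₀ ht, one_smul, sub_add_cancel]

/-- The product of a real valued `C^k` map with a vector valued one is `C^k`. -/
theorem CkOn.smul [IsTopologicalAddGroup W] [ContinuousSMul ℝ W] {k : ℕ} {f : E → ℝ} {g : E → W}
    {U : Set E} (hf : CkOn k f U) (hg : CkOn k g U) : CkOn k (fun x => f x • g x) U := by
  induction k generalizing E with
  | zero => exact ContinuousOn.smul hf hg
  | succ k ih =>
    have e : ((ContinuousLinearMap.fst ℝ E E) ⁻¹' U) = U ×ˢ (univ : Set E) := by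
      ext p; simp
    have hf1 := hf.of_succ.comp_clm (ContinuousLinearMap.fst ℝ E E)
    have hg1 := hg.of_succ.comp_clm (ContinuousLinearMap.fst ℝ E E)
    rw [e] at hf1 hg1
    obtain ⟨hc, df, hd, hk⟩ := hf
    obtain ⟨hc', dg, hd', hk'⟩ := hg
    refine ⟨hc.smul hc', fun p => df p • g p.1 + f p.1 • dg p, ?_, (ih hk hg1).add (ih hf1 hk')⟩
    intro x hx h
    refine (((hd x hx h).smul (hd' x hx h).tendsto).add
      ((hd' x hx h).const_smul (f x))).congr fun t => ?_
    module

end Calculus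

/-! ## Bornologies and the dual of a Fréchet space -/

/-- A bornology on `F` (a family of bounded sets that covers `F`, is directed upwards and absorbs
scalar multiples) that contains all compact sets and is stable under all continuous linear
endomorphisms of `F`. -/
structure FrechetBornology (F : Type*) [AddCommGroup F] [Module ℝ F] [TopologicalSpace F] where
  sets : Set (Set F)
  bounded : ∀ B ∈ sets, Bornology.IsVonNBounded ℝ B
  covers : ⋃₀ sets = univ
  directed : DirectedOn (· ⊆ ·) sets
  scaling : ∀ B ∈ sets, ∀ r : ℝ, ∃ C ∈ sets, (fun v => r • v) '' B ⊆ C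
  compact_mem : ∀ K : Set F, IsCompact K → K ∈ sets
  image_mem : ∀ T : F →L[ℝ] F, ∀ B ∈ sets, T '' B ∈ sets

/-- The dual `F'_𝓑`: continuous linear functionals with the topology of uniform convergence on the
members of the bornology `𝓑`. -/
abbrev BDual {F : Type*} [AddCommGroup F] [Module ℝ F] [TopologicalSpace F]
    (𝓑 : FrechetBornology F) : Type _ :=
  UniformConvergenceCLM (RingHom.id ℝ) ℝ 𝓑.sets

section BDual

variable {F : Type*} [AddCommGroup F] [Module ℝ F] [TopologicalSpace F] (𝓑 : FrechetBornology F)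

/-- A continuous linear functional as an element of `F'_𝓑`. -/
def toBDual (α : F →L[ℝ] ℝ) : BDual 𝓑 := UniformConvergenceCLM.ofFun (RingHom.id ℝ) ℝ 𝓑.sets α

/-- An element of `F'_𝓑` as a continuous linear functional. -/
def ofBDual (α : BDual 𝓑) : F →L[ℝ] ℝ :=
  (UniformConvergenceCLM.ofFun (RingHom.id ℝ) ℝ 𝓑.sets).symm α

instance instT2BDual : T2Space (BDual 𝓑) := UniformConvergenceCLM.t2Space _ _ _ 𝓑.covers

instance instContinuousSMulBDual : ContinuousSMul ℝ (BDual 𝓑) :=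
  UniformConvergenceCLM.continuousSMul _ _ _ 𝓑.bounded

instance instLocallyConvexBDual : LocallyConvexSpace ℝ (BDual 𝓑) :=
  UniformConvergenceCLM.locallyConvexSpace ℝ _ ⟨∅, 𝓑.compact_mem _ isCompact_empty⟩ 𝓑.directed

/-- Evaluation `α ↦ α v`, a continuous linear functional on `F'_𝓑`. -/
def evalBDual (v : F) : BDual 𝓑 →L[ℝ] ℝ where
  toFun α := α v
  map_add' _ _ := rfl
  map_smul' _ _ := rfl
  cont := (UniformConvergenceCLM.continuousEvalConst (RingHom.id ℝ) ℝ 𝓑.sets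
    𝓑.covers).continuous_eval_const v

/-- The transpose `α ↦ α ∘ L` of a continuous linear map. -/
def transposeBDual (L : F →L[ℝ] F) : BDual 𝓑 →ₗ[ℝ] BDual 𝓑 where
  toFun α := toBDual 𝓑 ((ofBDual 𝓑 α).comp L)
  map_add' _ _ := rfl
  map_smul' _ _ := rfl

end BDual

/-! ## Fréchet manifolds and locally convex vector bundles over them -/

/-- `M`, with its atlas of charts in the Fréchet space `F`, is a (Hausdorff, smooth) Fréchet
manifold: all changes of charts are smooth. -/
class FrechetManifold (F M : Type*) [AddCommGroup F] [Module ℝ F] [TopologicalSpace F]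
    [FrechetSpace F] [TopologicalSpace M] [ChartedSpace F M] : Prop where
  hausdorff : T2Space M
  smooth_transition : ∀ e ∈ atlas F M, ∀ e' ∈ atlas F M,
    SmoothOn (e' ∘ e.symm) (e.target ∩ e.symm ⁻¹' e'.source)

section Manifold

variable (F : Type*) {M : Type*} [AddCommGroup F] [Module ℝ F] [TopologicalSpace F]
  [TopologicalSpace M] [ChartedSpace F M]

/-- A map from an open subset `U` of the manifold to a locally convex space is smooth if it is so
in all charts. -/
def MSmoothOn {W : Type*} [AddCommGroup W] [Module ℝ W] [TopologicalSpace W]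
    (f : M → W) (U : Set M) : Prop :=
  ∀ e ∈ atlas F M, SmoothOn (f ∘ e.symm) (e.target ∩ e.symm ⁻¹' U)

/-- The algebra `C^∞(M)`, as a type. -/
def SmoothFunction (M : Type*) [TopologicalSpace M] [ChartedSpace F M] : Type _ :=
  {f : M → ℝ // MSmoothOn F f univ}

end Manifold

/-- A (candidate) local trivialization, over the set `base`, of the family of vector spaces `V`:
linear maps from the fibres to the typical fibre `E`. The values outside `base` are irrelevant. -/
structure LocTriv {M : Type*} (V : M → Type*) (E : Type*)
    [∀ x, AddCommGroup (V x)] [∀ x, Module ℝ (V x)] [AddCommGroup E] [Module ℝ E] where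
  base : Set M
  toLin : ∀ x, V x →ₗ[ℝ] E

section Bundle

variable (F : Type*) {M : Type*} [AddCommGroup F] [Module ℝ F] [TopologicalSpace F]
  [TopologicalSpace M] [ChartedSpace F M]
variable {V V' : M → Type*} {E E' : Type*}
  [∀ x, AddCommGroup (V x)] [∀ x, Module ℝ (V x)]
  [∀ x, AddCommGroup (V' x)] [∀ x, Module ℝ (V' x)]
  [AddCommGroup E] [Module ℝ E] [TopologicalSpace E]
  [AddCommGroup E'] [Module ℝ E'] [TopologicalSpace E']

/-- The family `φ` of linear maps between the fibres is represented, from the trivialization `t` to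
the trivialization `t'`, by a smooth map from `t.base ∩ t'.base` to the locally convex space
`L(E, E')` of continuous linear maps (topology of uniform convergence on bounded sets). -/
def IsSmoothRep [IsTopologicalAddGroup E'] [ContinuousSMul ℝ E']
    (t : LocTriv V E) (t' : LocTriv V' E') (φ : ∀ x, V x →ₗ[ℝ] V' x) : Prop :=
  ∃ G : M → (E →L[ℝ] E'), MSmoothOn F G (t.base ∩ t'.base) ∧
    ∀ x ∈ t.base ∩ t'.base, ∀ v : V x, t'.toLin x (φ x v) = G x (t.toLin x v)

/-- The family `φ` of linear maps between the fibres is represented, from `t` to `t'`, by a jointly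
smooth map `(t.base ∩ t'.base) × E → E'`, in every chart of the base. -/
def IsJointlySmoothRep (t : LocTriv V E) (t' : LocTriv V' E') (φ : ∀ x, V x →ₗ[ℝ] V' x) : Prop :=
  ∀ e ∈ atlas F M, ∃ G : F × E → E',
    SmoothOn G ((e.target ∩ e.symm ⁻¹' (t.base ∩ t'.base)) ×ˢ (univ : Set E)) ∧
    ∀ y ∈ e.target ∩ e.symm ⁻¹' (t.base ∩ t'.base), ∀ v : V (e.symm y),
      t'.toLin (e.symm y) (φ (e.symm y) v) = G (y, t.toLin (e.symm y) v)

/-- `A` is a vector bundle atlas (in the category of locally convex spaces) with typical fibre `E`: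
open base sets that cover `M`, fibrewise linear homeomorphisms onto `E`, and transition functions
that are smooth maps into `L(E, E)`. -/
structure IsVectorBundle [∀ x, TopologicalSpace (V x)] [IsTopologicalAddGroup E]
    [ContinuousSMul ℝ E] (A : Set (LocTriv V E)) : Prop where
  locallyConvex : LocallyConvexSpace ℝ E
  hausdorff : T2Space E
  isOpen_base : ∀ t ∈ A, IsOpen t.base
  cover : ∀ x, ∃ t ∈ A, x ∈ t.base
  equiv : ∀ t ∈ A, ∀ x ∈ t.base, ∃ L : V x ≃L[ℝ] E, ∀ v, L v = t.toLin x v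
  transition : ∀ t ∈ A, ∀ t' ∈ A, IsSmoothRep F t t' (fun _ => LinearMap.id)

/-- A family of linear maps between the fibres of two bundles is a smooth bundle map. -/
def IsBundleMap [IsTopologicalAddGroup E'] [ContinuousSMul ℝ E'] (A : Set (LocTriv V E))
    (A' : Set (LocTriv V' E')) (φ : ∀ x, V x →ₗ[ℝ] V' x) : Prop :=
  ∀ t ∈ A, ∀ t' ∈ A', IsSmoothRep F t t' φ

/-- The space `Γ` of smooth sections of the bundle with atlas `A`. -/
def Sections [IsTopologicalAddGroup E] [ContinuousSMul ℝ E] (A : Set (LocTriv V E)) :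
    Submodule ℝ (∀ x, V x) where
  carrier := {s | ∀ t ∈ A, MSmoothOn F (fun x => t.toLin x (s x)) t.base}
  zero_mem' := by
    intro t _ e _ k
    simp [Function.comp_def, CkOn.zero]
  add_mem' := by
    intro a b ha hb t ht e he k
    simpa [Function.comp_def] using (ha t ht e he k).add (hb t ht e he k)
  smul_mem' := by
    intro c a ha t ht e he k
    have h : CkOn k (fun _ : F => c) (e.target ∩ e.symm ⁻¹' t.base) := by
      cases k with
      | zero => exact continuousOn_const
      | succ k =>
        refine ⟨continuousOn_const, fun _ => 0, ?_, CkOn.zero _ _⟩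
        intro x _ h
        simpa [HasDirDeriv] using tendsto_const_nhds
    simpa [Function.comp_def] using h.smul (ha t ht e he k)

/-- The product `f s` of a smooth function and a smooth section. -/
def smulSection [IsTopologicalAddGroup E] [ContinuousSMul ℝ E] {A : Set (LocTriv V E)}
    (f : SmoothFunction F M) (s : Sections F A) : Sections F A :=
  ⟨fun x => f.1 x • s.1 x, by
    intro t ht e he k
    have h1 := f.2 e he k
    have h2 := s.2 t ht e he k
    have h3 : CkOn k (f.1 ∘ e.symm) (e.target ∩ e.symm ⁻¹' t.base) := by
      have := h1
      rw [preimage_univ, inter_univ] at this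
      exact this.mono inter_subset_left
    simpa [Function.comp_def] using h3.smul h2⟩

end Bundle

/-! ## Tangent bundle, `𝓑`-cotangent bundle and generalized tangent bundle -/

section Tangent

variable (F : Type*) {M : Type*} [AddCommGroup F] [Module ℝ F] [TopologicalSpace F]
  [TopologicalSpace M] [ChartedSpace F M]

/-- The tangent space `T_x M`, identified with `F` through the preferred chart at `x`. -/
abbrev TangentAt (_ : M) : Type _ := F

/-- The trivialization of `TM` induced by a chart `e`: the preferred chart at `x` is changed to
`e` by the derivative of the change of charts. -/
def tangentTriv (e : OpenPartialHomeomorph M F) : LocTriv (fun x : M => TangentAt F x) F where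
  base := e.source
  toLin x := (mbDeriv (e ∘ (chartAt F x).symm) (chartAt F x x) : F →L[ℝ] F)

/-- The vector bundle atlas of `TM`. -/
def tangentAtlas (M : Type*) [TopologicalSpace M] [ChartedSpace F M] :
    Set (LocTriv (fun x : M => TangentAt F x) F) :=
  tangentTriv F '' atlas F M

variable {F}
variable (𝓑 : FrechetBornology F)

/-- The space `(T_x M)'_𝓑`. -/
abbrev CotangentAt (_ : M) : Type _ := BDual 𝓑

/-- The generalized tangent space `T_x M ⊕ (T_x M)'_𝓑`. -/
abbrev GenTangentAt (x : M) : Type _ := TangentAt F x × CotangentAt 𝓑 x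

/-- The trivialization of `TM'_𝓑` induced by a chart `e`: a covector is composed with the derivative
of the change of charts from `e` to the preferred chart. -/
def cotangentTriv (e : OpenPartialHomeomorph M F) :
    LocTriv (fun x : M => CotangentAt 𝓑 x) (BDual 𝓑) where
  base := e.source
  toLin x := transposeBDual 𝓑 (mbDeriv (chartAt F x ∘ e.symm) (e x))

/-- The trivialization of `TM ⊕ TM'_𝓑` induced by a chart. -/
def genTriv (e : OpenPartialHomeomorph M F) :
    LocTriv (fun x : M => GenTangentAt 𝓑 x) (F × BDual 𝓑) where
  base := e.source
  toLin x := ((tangentTriv F e).toLin x).prodMap ((cotangentTriv 𝓑 e).toLin x)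

/-- The vector bundle atlas of the generalized tangent bundle `TM ⊕ TM'_𝓑`. -/
def genAtlas (M : Type*) [TopologicalSpace M] [ChartedSpace F M] :
    Set (LocTriv (fun x : M => GenTangentAt 𝓑 x) (F × BDual 𝓑)) :=
  genTriv 𝓑 '' atlas F M

/-! ### Cartan calculus for vector fields and 1-forms -/

variable (F) in
/-- The derivative `df_x : T_x M → ℝ` of a function on `M`. -/
def dFun (f : M → ℝ) (x : M) : TangentAt F x →L[ℝ] ℝ :=
  mbDeriv (f ∘ (chartAt F x).symm) (chartAt F x x)

/-- The local representative in the chart `e` of a vector field. -/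
def localField (e : OpenPartialHomeomorph M F) (X : ∀ x : M, TangentAt F x) : F → F :=
  fun y => (tangentTriv F e).toLin (e.symm y) (X (e.symm y))

/-- The local representative in the chart `e` of a 1-form. -/
def localForm (e : OpenPartialHomeomorph M F) (α : ∀ x : M, CotangentAt 𝓑 x) : F → BDual 𝓑 :=
  fun y => (cotangentTriv 𝓑 e).toLin (e.symm y) (α (e.symm y))

/-- The Lie bracket of vector fields, in a chart `[X, Y] = dY(X) - dX(Y)`. -/
def lieBracketField (X Y : ∀ x : M, TangentAt F x) (x : M) : TangentAt F x :=
  mbDeriv (localField (chartAt F x) Y) (chartAt F x x) (X x) -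
    mbDeriv (localField (chartAt F x) X) (chartAt F x x) (Y x)

/-- `ι_v (dα)` at `x`, for a 1-form `α` with de Rham derivative `dα` and `v ∈ T_x M`. In a chart,
`dα(v, w) = (Dα(v))(w) - (Dα(w))(v)`, where `Dα` is the derivative of the local representative. -/
def contractExtDeriv (α : ∀ x : M, CotangentAt 𝓑 x) (x : M) (v : TangentAt F x) :
    CotangentAt 𝓑 x :=
  mbDeriv (localForm 𝓑 (chartAt F x) α) (chartAt F x x) v -
    toBDual 𝓑 ((evalBDual 𝓑 v).comp (mbDeriv (localForm 𝓑 (chartAt F x) α) (chartAt F x x)))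

/-- The de Rham derivative `df` of a function as a 1-form. -/
def dForm (f : M → ℝ) (x : M) : CotangentAt 𝓑 x := toBDual 𝓑 (dFun F f x)

/-- The Lie derivative of a 1-form by the Cartan formula `L_X = d ∘ ι_X + ι_X ∘ d`. -/
def lieDerivForm (X : ∀ x : M, TangentAt F x) (α : ∀ x : M, CotangentAt 𝓑 x) (x : M) :
    CotangentAt 𝓑 x :=
  dForm 𝓑 (fun y => α y (X y)) x + contractExtDeriv 𝓑 α x (X x)

/-- The bracket `([X, Y], L_X β - ι_Y dα)` of `(X, α)` and `(Y, β)`. -/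
def dorfmanBracket (s s' : ∀ x : M, GenTangentAt 𝓑 x) (x : M) : GenTangentAt 𝓑 x :=
  (lieBracketField (fun y => (s y).1) (fun y => (s' y).1) x,
    lieDerivForm 𝓑 (fun y => (s y).1) (fun y => (s' y).2) x -
      contractExtDeriv 𝓑 (fun y => (s y).2) x (s' x).1)

/-- The Courant bracket `([X, Y], L_X β - L_Y α + ½ d(α(Y) - β(X)))` of `(X, α)` and `(Y, β)`. -/
def courantBracket (s s' : ∀ x : M, GenTangentAt 𝓑 x) (x : M) : GenTangentAt 𝓑 x :=
  (lieBracketField (fun y => (s y).1) (fun y => (s' y).1) x,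
    lieDerivForm 𝓑 (fun y => (s y).1) (fun y => (s' y).2) x -
      lieDerivForm 𝓑 (fun y => (s' y).1) (fun y => (s y).2) x +
      (1 / 2 : ℝ) • dForm 𝓑 (fun y => (s y).2 (s' y).1 - (s' y).2 (s y).1) x)

/-- The projection `TM ⊕ TM'_𝓑 → TM`. -/
def genAnchor (x : M) : GenTangentAt 𝓑 x →ₗ[ℝ] TangentAt F x :=
  LinearMap.fst ℝ F (BDual 𝓑)

/-- The pairing `⟨(X, α), (Y, β)⟩ = α(Y) + β(X)`. -/
def genPairing (x : M) : GenTangentAt 𝓑 x →ₗ[ℝ] GenTangentAt 𝓑 x →ₗ[ℝ] ℝ :=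
  LinearMap.mk₂ ℝ (fun p q : F × BDual 𝓑 => p.2 q.1 + q.2 p.1)
    (by intro a b c
        change (ofBDual 𝓑 a.2 + ofBDual 𝓑 b.2) c.1 + ofBDual 𝓑 c.2 (a.1 + b.1) =
          (ofBDual 𝓑 a.2 c.1 + ofBDual 𝓑 c.2 a.1) + (ofBDual 𝓑 b.2 c.1 + ofBDual 𝓑 c.2 b.1)
        simp only [add_apply, map_add]; ring)
    (by intro r a c
        change (r • ofBDual 𝓑 a.2) c.1 + ofBDual 𝓑 c.2 (r • a.1) =
          r • (ofBDual 𝓑 a.2 c.1 + ofBDual 𝓑 c.2 a.1)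
        simp [mul_add])
    (by intro a b c
        change ofBDual 𝓑 a.2 (b.1 + c.1) + (ofBDual 𝓑 b.2 + ofBDual 𝓑 c.2) a.1 =
          (ofBDual 𝓑 a.2 b.1 + ofBDual 𝓑 b.2 a.1) + (ofBDual 𝓑 a.2 c.1 + ofBDual 𝓑 c.2 a.1)
        simp only [add_apply, map_add]; ring)
    (by intro r a c
        change ofBDual 𝓑 a.2 (r • c.1) + (r • ofBDual 𝓑 c.2) a.1 =
          r • (ofBDual 𝓑 a.2 c.1 + ofBDual 𝓑 c.2 a.1)
        simp [mul_add])

end Tangent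

/-! ## Lie and Courant algebroids -/

section Algebroids

variable (F : Type*) {M : Type*} [AddCommGroup F] [Module ℝ F] [TopologicalSpace F]
  [FrechetSpace F] [TopologicalSpace M] [ChartedSpace F M]
variable {V : M → Type*} {E : Type*}
  [∀ x, AddCommGroup (V x)] [∀ x, Module ℝ (V x)] [∀ x, TopologicalSpace (V x)]
  [AddCommGroup E] [Module ℝ E] [TopologicalSpace E] [IsTopologicalAddGroup E] [ContinuousSMul ℝ E]

/-- A Lie algebroid over the Fréchet manifold `M`: a vector bundle (in the category of locally
convex spaces) with a Lie bracket on its smooth sections and a smooth bundle map `ρ` to `TM` that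
induces a Lie algebra homomorphism to the vector fields and satisfies the Leibniz rule. -/
structure IsLieAlgebroid (A : Set (LocTriv V E)) (ρ : ∀ x : M, V x →ₗ[ℝ] TangentAt F x)
    (br : Sections F A →ₗ[ℝ] Sections F A →ₗ[ℝ] Sections F A) : Prop where
  isVectorBundle : IsVectorBundle F A
  anchor_smooth : IsBundleMap F A (tangentAtlas F M) ρ
  alternating : ∀ s, br s s = 0
  jacobi : ∀ s₁ s₂ s₃, br s₁ (br s₂ s₃) + br s₂ (br s₃ s₁) + br s₃ (br s₁ s₂) = 0
  anchor_bracket : ∀ s₁ s₂ x, ρ x ((br s₁ s₂).1 x) =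
    lieBracketField (fun y => ρ y (s₁.1 y)) (fun y => ρ y (s₂.1 y)) x
  leibniz : ∀ s₁ s₂ (f : SmoothFunction F M) x, (br s₁ (smulSection F f s₂)).1 x =
    f.1 x • (br s₁ s₂).1 x + dFun F f.1 x (ρ x (s₁.1 x)) • s₂.1 x

/-- A Lie algebroid is a Fréchet Lie algebroid in the strict sense if its underlying bundle is a
Fréchet vector bundle: the typical fibre is a Fréchet space, and the transition maps
`(x, v) ↦ g(x) v`, as well as the anchor, are jointly smooth in local trivializations. -/
structure IsFrechetLieAlgebroid (A : Set (LocTriv V E)) (ρ : ∀ x : M, V x →ₗ[ℝ] TangentAt F x)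
    (br : Sections F A →ₗ[ℝ] Sections F A →ₗ[ℝ] Sections F A) : Prop
    extends IsLieAlgebroid F A ρ br where
  frechet_fibre : FrechetSpace E
  transition_smooth : ∀ t ∈ A, ∀ t' ∈ A, IsJointlySmoothRep F t t' (fun _ => LinearMap.id)
  anchor_jointly_smooth : ∀ t ∈ A, ∀ t' ∈ tangentAtlas F M, IsJointlySmoothRep F t t' ρ

/-- A Courant algebroid over `M` with anchor `ρ`, form `Θ` and bracket `br`. -/
structure IsCourantAlgebroid (A : Set (LocTriv V E)) (ρ : ∀ x : M, V x →ₗ[ℝ] TangentAt F x)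
    (Θ : ∀ x : M, V x →ₗ[ℝ] V x →ₗ[ℝ] ℝ)
    (br : Sections F A →ₗ[ℝ] Sections F A →ₗ[ℝ] Sections F A) : Prop where
  isVectorBundle : IsVectorBundle F A
  anchor_smooth : IsBundleMap F A (tangentAtlas F M) ρ
  symmetric : ∀ x v w, Θ x v w = Θ x w v
  nondegenerate : ∀ x v, (∀ w, Θ x v w = 0) → v = 0
  form_smooth : ∀ s₁ s₂ : Sections F A, MSmoothOn F (fun x => Θ x (s₁.1 x) (s₂.1 x)) univ
  leibniz_identity : ∀ s₁ s₂ s₃, br s₁ (br s₂ s₃) = br (br s₁ s₂) s₃ + br s₂ (br s₁ s₃)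
  invariance : ∀ s₁ s₂ s₃ : Sections F A, ∀ x,
    dFun F (fun y => Θ y (s₂.1 y) (s₃.1 y)) x (ρ x (s₁.1 x)) =
      Θ x ((br s₁ s₂).1 x) (s₃.1 x) + Θ x (s₂.1 x) ((br s₁ s₃).1 x)
  symmetric_part : ∃ Δ : SmoothFunction F M → Sections F A,
    (∀ f x v, Θ x ((Δ f).1 x) v = dFun F f.1 x (ρ x v)) ∧
    ∀ s₁ s₂, br s₁ s₂ + br s₂ s₁ = Δ ⟨fun x => Θ x (s₁.1 x) (s₂.1 x), form_smooth s₁ s₂⟩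

end Algebroids

/-! ## Subbundles and Dirac structures -/

section Subbundle

variable (F : Type*) {M : Type*} [AddCommGroup F] [Module ℝ F] [TopologicalSpace F]
  [TopologicalSpace M] [ChartedSpace F M]
variable {V : M → Type*} {E : Type*}
  [∀ x, AddCommGroup (V x)] [∀ x, Module ℝ (V x)] [∀ x, TopologicalSpace (V x)]
  [AddCommGroup E] [Module ℝ E] [TopologicalSpace E] [IsTopologicalAddGroup E] [ContinuousSMul ℝ E]

/-- A vector subbundle of the bundle with atlas `A`: linear subspaces of the fibres that, in a
covering family `trivs` of local trivializations compatible with `A` and with each other, are given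
by a fixed closed subspace of the typical fibre. -/
structure Subbundle (A : Set (LocTriv V E)) where
  fibre : ∀ x, Submodule ℝ (V x)
  model : Submodule ℝ E
  isClosed_model : IsClosed (model : Set E)
  trivs : Set (LocTriv V E)
  compatible : IsVectorBundle F (A ∪ trivs)
  cover : ∀ x, ∃ t ∈ trivs, x ∈ t.base
  adapted : ∀ t ∈ trivs, ∀ x ∈ t.base, ∀ v, v ∈ fibre x ↔ t.toLin x v ∈ model

variable {F}
variable {A : Set (LocTriv V E)}

open Classical in
/-- The trivialization of a subbundle induced by an adapted trivialization. -/
def Subbundle.restrictTriv (D : Subbundle F A) (t : LocTriv V E) :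
    LocTriv (fun x => D.fibre x) D.model where
  base := t.base
  toLin x :=
    if h : ∀ v : D.fibre x, ((t.toLin x).comp (D.fibre x).subtype) v ∈ D.model then
      LinearMap.codRestrict D.model ((t.toLin x).comp (D.fibre x).subtype) h
    else 0

/-- The vector bundle atlas of a subbundle, with typical fibre `D.model`. -/
def Subbundle.atlas (D : Subbundle F A) : Set (LocTriv (fun x => D.fibre x) D.model) :=
  D.restrictTriv '' D.trivs

/-- A section of a subbundle as a section of the ambient bundle. -/
def Subbundle.incl (D : Subbundle F A) (s : ∀ x, D.fibre x) : ∀ x, V x := fun x => (s x : V x)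

end Subbundle

section Dirac

variable {F M : Type*} [AddCommGroup F] [Module ℝ F] [TopologicalSpace F] [FrechetSpace F]
  [TopologicalSpace M] [ChartedSpace F M] (𝓑 : FrechetBornology F)

/-- The subbundle `D` of `TM ⊕ TM'_𝓑` is a Dirac structure: it coincides with its orthogonal
complement, and its smooth sections are closed under the bracket `([X, Y], L_X β - ι_Y dα)`. -/
structure IsDiracStructure (D : Subbundle F (genAtlas 𝓑 M)) : Prop where
  maximal_isotropic : ∀ (x : M) (v : GenTangentAt 𝓑 x),
    v ∈ D.fibre x ↔ ∀ w ∈ D.fibre x, genPairing 𝓑 x v w = 0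
  closed_bracket : ∀ s ∈ Sections F (genAtlas 𝓑 M), ∀ s' ∈ Sections F (genAtlas 𝓑 M),
    (∀ x, s x ∈ D.fibre x) → (∀ x, s' x ∈ D.fibre x) →
      ∀ x, dorfmanBracket 𝓑 s s' x ∈ D.fibre x

/-- The restriction to `D` of the projection `TM ⊕ TM'_𝓑 → TM`. -/
def Subbundle.proj (D : Subbundle F (genAtlas 𝓑 M)) (x : M) :
    D.fibre x →ₗ[ℝ] TangentAt F x :=
  (genAnchor 𝓑 x).comp (D.fibre x).subtype

end Dirac

end

/-! All structures are local, so in a chart everything concerns smooth maps `(X, α)` from an open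
set of `F` to `F × F'_𝓑`. The product rule turns the bracket into `locBracket`, with components
`DY(X) - DX(Y)` and `Dβ(X) + β ∘ DX - Dα(Y) + Dα(·)(Y)`. The Courant identities and the independence
of the chart are then formal consequences of the product rule, the chain rule and the symmetry of
second derivatives (`locBracket_leibniz`, `mbDeriv_locPairing_eq`, `locBracket_add_swap`,
`IsPushforwardOn.locBracket`).

The analytic difficulty is that evaluation `F'_𝓑 × F → ℝ` is in general not continuous. Since `𝓑`
contains the compact sets, it is sequentially continuous, and over a first countable domain this
suffices for the product rule and for the smoothness of `y ↦ α(y)(X(y))` (`CkOn.bilin`). Conversely,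
a smooth map `(y, v) ↦ f(y, v)` that is linear in `v` is smooth as a map into a space of linear maps
with uniform convergence on bounded sets (`CkOn.curry`). Together, these two facts let smoothness of
1-forms be tested on values, which gives smoothness of the bracket; the second one also makes `y ↦
Dφ(y)` smooth into `L(F, F)`. The transition functions on covectors are transposes: each is
continuous because `𝓑` is stable under endomorphisms, and transposition is continuous from `L(F, F)`
to `L(F'_𝓑, F'_𝓑)` because bounded subsets of `F'_𝓑` are equicontinuous by Banach–Steinhaus
(`transposeL`).

The calculus itself rests on the Hahn–Banach form of the mean value theorem, which makes the
difference quotients of a `C^1` map converge locally uniformly (`tendsto_slope`).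

On a Dirac structure the pairing vanishes. The two brackets differ by half the differential of the
pairing, so they agree there; the same differential is the symmetric part of the first bracket,
which is therefore skew, and its Leibniz identity becomes the Jacobi identity. No complement of the
model of `D` is needed: limits of difference quotients stay in a closed subspace, so smooth maps
with values in it are smooth into it (`CkOn.of_isClosedEmbedding`). This applies to sections, and to
transition functions in `L(D.model, D.model)`, which is closed in `L(D.model, E)`. -/

noncomputable section

set_option linter.unusedSectionVars false

/-! ### Michal–Bastiani calculus: mean value theorem, linearity of the derivative, chain rule. -/

section MichalBastiani

variable {E E' W W' : Type*}
  [AddCommGroup E] [Module ℝ E] [TopologicalSpace E]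
  [AddCommGroup E'] [Module ℝ E'] [TopologicalSpace E']
  [AddCommGroup W] [Module ℝ W] [TopologicalSpace W]
  [AddCommGroup W'] [Module ℝ W'] [TopologicalSpace W']

theorem HasDirDeriv.unique [T2Space W] {f : E → W} {x h : E} {v w : W}
    (hv : HasDirDeriv f x h v) (hw : HasDirDeriv f x h w) : v = w :=
  tendsto_nhds_unique hv hw

theorem HasDirDeriv.clm_comp {f : E → W} {x h : E} {v : W} (hf : HasDirDeriv f x h v)
    (L : W →L[ℝ] W') : HasDirDeriv (fun y => L (f y)) x h (L v) := by
  have := (L.continuous.tendsto v).comp hf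
  simpa [HasDirDeriv, Function.comp_def] using this

theorem HasDirDeriv.smul_dir [IsTopologicalAddGroup W] [ContinuousSMul ℝ W] {f : E → W} {x h : E}
    {v : W} (hf : HasDirDeriv f x h v) (c : ℝ) : HasDirDeriv f x (c • h) (c • v) := by
  rcases eq_or_ne c 0 with rfl | hc
  · simpa [HasDirDeriv] using tendsto_const_nhds
  · have h1 : Tendsto (fun t : ℝ => t * c) (𝓝[≠] 0) (𝓝[≠] 0) := by
      refine tendsto_nhdsWithin_iff.2 ⟨?_, ?_⟩
      · have : Tendsto (fun t : ℝ => t * c) (𝓝 0) (𝓝 (0 * c)) := (continuous_mul_const c).tendsto 0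
        rw [zero_mul] at this
        exact this.mono_left nhdsWithin_le_nhds
      · filter_upwards [self_mem_nhdsWithin] with t ht
        exact mul_ne_zero ht hc
    refine ((hf.comp h1).const_smul c).congr fun t => ?_
    simp only [Function.comp_apply, smul_smul, mul_inv]
    congr 1
    field_simp

theorem HasDirDeriv.add [IsTopologicalAddGroup W] {f g : E → W} {x h : E} {v w : W}
    (hf : HasDirDeriv f x h v) (hg : HasDirDeriv g x h w) :
    HasDirDeriv (fun y => f y + g y) x h (v + w) :=
  (Tendsto.add hf hg).congr fun t => by rw [← smul_add, add_sub_add_comm]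

theorem HasDirDeriv.sub [IsTopologicalAddGroup W] {f g : E → W} {x h : E} {v w : W}
    (hf : HasDirDeriv f x h v) (hg : HasDirDeriv g x h w) :
    HasDirDeriv (fun y => f y - g y) x h (v - w) :=
  (Tendsto.sub hf hg).congr fun t => by module

theorem HasDirDeriv.prodMk {f : E → W} {g : E → W'} {x h : E} {v : W} {w : W'}
    (hf : HasDirDeriv f x h v) (hg : HasDirDeriv g x h w) :
    HasDirDeriv (fun y => (f y, g y)) x h (v, w) :=
  Tendsto.prodMk_nhds hf hg

theorem tendsto_add_smul [IsTopologicalAddGroup E] [ContinuousSMul ℝ E] (x h : E) :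
    Tendsto (fun t : ℝ => x + t • h) (𝓝[≠] 0) (𝓝 x) := by
  have : Tendsto (fun t : ℝ => x + t • h) (𝓝 0) (𝓝 (x + (0 : ℝ) • h)) :=
    Continuous.tendsto (by fun_prop) 0
  rw [zero_smul, add_zero] at this
  exact this.mono_left nhdsWithin_le_nhds

theorem HasDirDeriv.congr_of_eventuallyEq [IsTopologicalAddGroup E] [ContinuousSMul ℝ E]
    {f g : E → W} {x h : E} {v : W}
    (hf : HasDirDeriv f x h v) (hfg : f =ᶠ[𝓝 x] g) : HasDirDeriv g x h v := by
  refine Tendsto.congr' ?_ hf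
  filter_upwards [(tendsto_add_smul x h).eventually hfg] with t ht
  rw [ht, hfg.eq_of_nhds]

/-- `mbDeriv` is a choice, but maps that agree near `x` define the same predicate and hence the same
choice. Uniqueness of derivatives plays no role, so `W` need not be Hausdorff. -/
theorem mbDeriv_congr [IsTopologicalAddGroup E] [ContinuousSMul ℝ E]
    {f g : E → W} {x : E} (hfg : f =ᶠ[𝓝 x] g) : mbDeriv f x = mbDeriv g x := by
  have : ∀ L : E →L[ℝ] W, (∀ v, HasDirDeriv f x v (L v)) ↔ (∀ v, HasDirDeriv g x v (L v)) :=
    fun L => ⟨fun h v => (h v).congr_of_eventuallyEq hfg,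
      fun h v => (h v).congr_of_eventuallyEq hfg.symm⟩
  have key : ∀ P Q : (E →L[ℝ] W) → Prop, P = Q →
      (open Classical in if h : ∃ L, P L then h.choose else 0) =
        (open Classical in if h : ∃ L, Q L then h.choose else 0) := by
    rintro P _ rfl
    rfl
  exact key _ _ (funext fun L => propext (this L))

/-- Mean value theorem: the increment of a curve lies in every closed convex set that contains its
velocities. -/
theorem Convex.sub_mem_of_hasDirDeriv [IsTopologicalAddGroup W] [ContinuousSMul ℝ W]
    [LocallyConvexSpace ℝ W] {V : Set W} (hV : Convex ℝ V) (hc : IsClosed V) {c c' : ℝ → W}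
    (h : ∀ s ∈ Icc (0 : ℝ) 1, HasDirDeriv c s 1 (c' s)) (hm : ∀ s ∈ Icc (0 : ℝ) 1, c' s ∈ V) :
    c 1 - c 0 ∈ V := by
  by_contra hn
  -- A functional `f` separates the increment from `V`; the real mean value theorem for `f ∘ c` then
  -- yields a velocity on the wrong side.
  obtain ⟨f, u, hu, hx⟩ := geometric_hahn_banach_closed_point hV hc hn
  have hd : ∀ s ∈ Icc (0 : ℝ) 1, HasDerivAt (fun s => f (c s)) (f (c' s)) s := by
    intro s hs
    rw [hasDerivAt_iff_tendsto_slope_zero]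
    simpa [HasDirDeriv] using (h s hs).clm_comp f
  obtain ⟨s, hs, he⟩ := exists_hasDerivAt_eq_slope (fun s => f (c s)) (fun s => f (c' s))
    zero_lt_one (fun s hs => (hd s hs).continuousAt.continuousWithinAt)
    (fun s hs => hd s (Ioo_subset_Icc_self hs))
  have := hu _ (hm s (Ioo_subset_Icc_self hs))
  rw [he] at this
  simp only [sub_zero, div_one] at this
  rw [map_sub] at hx
  linarith

theorem HasDirDeriv.along_line {f : E → W} {x h : E} {s : ℝ} {v : W}
    (hf : HasDirDeriv f (x + s • h) h v) : HasDirDeriv (fun s : ℝ => f (x + s • h)) s 1 v := by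
  refine Tendsto.congr (fun t => ?_) hf
  simp [add_smul, add_assoc]

theorem exists_closed_convex_nhds [IsTopologicalAddGroup W] [ContinuousSMul ℝ W]
    [LocallyConvexSpace ℝ W] {w : W} {V : Set W} (hV : V ∈ 𝓝 w) :
    ∃ C ∈ 𝓝 w, IsClosed C ∧ Convex ℝ C ∧ C ⊆ V := by
  obtain ⟨V', hV', hc, hs⟩ := exists_mem_nhds_isClosed_subset hV
  obtain ⟨C, ⟨hC, hcv⟩, hCs⟩ := (LocallyConvexSpace.convex_basis (𝕜 := ℝ) w).mem_iff.1 hV'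
  exact ⟨closure C, mem_of_superset hC subset_closure, isClosed_closure, hcv.closure,
    (closure_minimal hCs hc).trans hs⟩

section C1

variable [IsTopologicalAddGroup E] [ContinuousSMul ℝ E]
  [IsTopologicalAddGroup W] [ContinuousSMul ℝ W] [LocallyConvexSpace ℝ W]

/-- For a `C^1` map the difference quotients converge locally uniformly. -/
theorem tendsto_slope {f : E → W} {df : E × E → W} {U : Set E} (hU : IsOpen U)
    (hd : ∀ x ∈ U, ∀ h, HasDirDeriv f x h (df (x, h)))
    (hdf : ContinuousOn df (U ×ˢ (univ : Set E))) {x : E} (hx : x ∈ U) (h : E) :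
    Tendsto (fun p : ℝ × E × E => p.1⁻¹ • (f (p.2.1 + p.1 • p.2.2) - f p.2.1))
      (𝓝[≠] 0 ×ˢ 𝓝 (x, h)) (𝓝 (df (x, h))) := by
  intro V hV
  obtain ⟨C, hC, hCc, hCv, hCs⟩ := exists_closed_convex_nhds hV
  have hUo : IsOpen (U ×ˢ (univ : Set E)) := hU.prod isOpen_univ
  -- Compactness of `[0, 1]`: for nearby data the whole segment stays in `U`, and the derivatives
  -- along it stay in `C`.
  have key : ∀ᶠ p : ℝ × E × E in 𝓝 (0, x, h), ∀ s ∈ Icc (0 : ℝ) 1,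
      p.2.1 + (s * p.1) • p.2.2 ∈ U ∧ df (p.2.1 + (s * p.1) • p.2.2, p.2.2) ∈ C := by
    refine isCompact_Icc.eventually_forall_of_forall_eventually fun s _ => ?_
    have hcont : Continuous fun z : (ℝ × E × E) × ℝ =>
        (z.1.2.1 + (z.2 * z.1.1) • z.1.2.2, z.1.2.2) := by fun_prop
    have ht : Tendsto (fun z : (ℝ × E × E) × ℝ =>
        (z.1.2.1 + (z.2 * z.1.1) • z.1.2.2, z.1.2.2)) (𝓝 ((0, x, h), s)) (𝓝 (x, h)) := by
      simpa using hcont.tendsto ((0, x, h), s)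
    have hm : (x, h) ∈ U ×ˢ (univ : Set E) := ⟨hx, mem_univ _⟩
    filter_upwards [ht.eventually (hUo.mem_nhds hm),
      ht.eventually ((hdf.continuousAt (hUo.mem_nhds hm)).eventually hC)] with z h1 h2
    exact ⟨h1.1, h2⟩
  have hle : 𝓝[≠] (0 : ℝ) ×ˢ 𝓝 (x, h) ≤ 𝓝 (0, x, h) := by
    rw [nhds_prod_eq (x := (0 : ℝ))]
    exact Filter.prod_mono_left _ nhdsWithin_le_nhds
  have hne : ∀ᶠ p : ℝ × E × E in 𝓝[≠] (0 : ℝ) ×ˢ 𝓝 (x, h), p.1 ≠ 0 :=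
    tendsto_fst.eventually self_mem_nhdsWithin
  change ∀ᶠ p : ℝ × E × E in 𝓝[≠] (0 : ℝ) ×ˢ 𝓝 (x, h), _ ∈ V
  filter_upwards [hle key, hne] with p hp hp0
  apply hCs
  -- The increment of this curve over `[0, 1]` is the difference quotient, and its velocities are
  -- values of `df` along the segment.
  have hder : ∀ s ∈ Icc (0 : ℝ) 1, HasDirDeriv (fun s : ℝ => p.1⁻¹ • f (p.2.1 + s • (p.1 • p.2.2)))
      s 1 (df (p.2.1 + (s * p.1) • p.2.2, p.2.2)) := by
    intro s hs
    have h1 := (hd _ (hp s hs).1 p.2.2).smul_dir p.1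
    rw [← smul_smul] at h1
    have h2 := h1.along_line.clm_comp (p.1⁻¹ • ContinuousLinearMap.id ℝ W)
    simpa [smul_smul, mul_inv_cancel₀ hp0] using h2
  have := hCv.sub_mem_of_hasDirDeriv hCc hder (fun s hs => (hp s hs).2)
  simpa [smul_sub] using this

/-- The increment of `f ∘ g` is one of `f` along the moving direction `t⁻¹ (g(y + tk) - g(y))`,
which tends to `v`; `tendsto_slope` allows the direction to move. -/
theorem HasDirDeriv.comp_of_c1 {g : E' → E} {y k : E'} {v : E}
    {f : E → W} {df : E × E → W} {U : Set E} (hU : IsOpen U)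
    (hd : ∀ x ∈ U, ∀ h, HasDirDeriv f x h (df (x, h)))
    (hdf : ContinuousOn df (U ×ˢ (univ : Set E))) (hg : HasDirDeriv g y k v) (hy : g y ∈ U) :
    HasDirDeriv (fun z => f (g z)) y k (df (g y, v)) := by
  have h1 : Tendsto (fun t : ℝ => (t, g y, t⁻¹ • (g (y + t • k) - g y))) (𝓝[≠] 0)
      (𝓝[≠] 0 ×ˢ 𝓝 (g y, v)) := by
    rw [nhds_prod_eq]
    exact tendsto_id.prodMk (tendsto_const_nhds.prodMk hg)
  refine ((tendsto_slope hU hd hdf hy v).comp h1).congr' ?_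
  filter_upwards [self_mem_nhdsWithin] with t ht
  simp only [Function.comp_apply, smul_smul, mul_inv_cancel₀ (show t ≠ 0 from ht), one_smul,
    add_sub_cancel]

variable [T2Space W]

/-- The step along `h + k` is a step along `h` followed by a step along `k` from the moving point `x
+ th`, which `tendsto_slope` controls. -/
theorem dirDeriv_add_of_c1 {f : E → W} {df : E × E → W} {U : Set E} (hU : IsOpen U)
    (hd : ∀ x ∈ U, ∀ h, HasDirDeriv f x h (df (x, h)))
    (hdf : ContinuousOn df (U ×ˢ (univ : Set E))) {x : E} (hx : x ∈ U) (h k : E) :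
    df (x, h + k) = df (x, h) + df (x, k) := by
  have h1 : Tendsto (fun t : ℝ => (t, x + t • h, k)) (𝓝[≠] 0) (𝓝[≠] 0 ×ˢ 𝓝 (x, k)) := by
    rw [nhds_prod_eq]
    exact tendsto_id.prodMk ((tendsto_add_smul x h).prodMk tendsto_const_nhds)
  have h2 := Tendsto.add (hd x hx h) ((tendsto_slope hU hd hdf hx k).comp h1)
  refine tendsto_nhds_unique (hd x hx (h + k)) (h2.congr fun t => ?_)
  simp only [Function.comp_apply, smul_add, add_assoc]
  module

theorem exists_clm_of_c1 {f : E → W} {df : E × E → W} {U : Set E} (hU : IsOpen U)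
    (hd : ∀ x ∈ U, ∀ h, HasDirDeriv f x h (df (x, h)))
    (hdf : ContinuousOn df (U ×ˢ (univ : Set E))) {x : E} (hx : x ∈ U) :
    ∃ L : E →L[ℝ] W, ∀ v, HasDirDeriv f x v (L v) := by
  refine ⟨⟨⟨⟨fun h => df (x, h), dirDeriv_add_of_c1 hU hd hdf hx⟩, fun c h => ?_⟩, ?_⟩, hd x hx⟩
  · exact (hd x hx (c • h)).unique ((hd x hx h).smul_dir c)
  · have : Continuous fun h : E => (x, h) := by fun_prop
    exact continuousOn_univ.1 (hdf.comp this.continuousOn fun h _ => ⟨hx, mem_univ _⟩)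

end C1

section Ck

variable [IsTopologicalAddGroup E] [ContinuousSMul ℝ E]
  [IsTopologicalAddGroup W] [ContinuousSMul ℝ W] [LocallyConvexSpace ℝ W] [T2Space W]
variable {f g : E → W} {U : Set E} {k : ℕ}

theorem CkOn.hasDirDeriv (hf : CkOn (k + 1) f U) (hU : IsOpen U) {x : E} (hx : x ∈ U) (h : E) :
    HasDirDeriv f x h (mbDeriv f x h) := by
  obtain ⟨_, df, hd, hk⟩ := hf
  have := exists_clm_of_c1 hU hd hk.continuousOn hx
  rw [mbDeriv, dif_pos this]
  exact this.choose_spec h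

theorem HasDirDeriv.mbDeriv_eq {x h : E} {v : W} (h1 : HasDirDeriv f x h v)
    (hf : CkOn (k + 1) f U) (hU : IsOpen U) (hx : x ∈ U) : mbDeriv f x h = v :=
  (hf.hasDirDeriv hU hx h).unique h1

theorem CkOn.congr {W : Type*} [AddCommGroup W] [Module ℝ W] [TopologicalSpace W]
    {f g : E → W} (hf : CkOn k f U) (hU : IsOpen U) (hfg : EqOn g f U) : CkOn k g U := by
  cases k with
  | zero => exact ContinuousOn.congr hf hfg
  | succ k =>
    obtain ⟨hc, df, hd, hk⟩ := hf
    refine ⟨hc.congr hfg, df, fun x hx h => (hd x hx h).congr_of_eventuallyEq ?_, hk⟩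
    filter_upwards [hU.mem_nhds hx] with y hy using (hfg hy).symm

/-- Uniqueness of limits forces the derivative hidden in `CkOn` to coincide with `mbDeriv`, which
can then replace it everywhere. -/
theorem CkOn.ckOn_mbDeriv (hf : CkOn (k + 1) f U) (hU : IsOpen U) :
    CkOn k (fun p : E × E => mbDeriv f p.1 p.2) (U ×ˢ univ) := by
  obtain ⟨hc, df, hd, hk⟩ := id hf
  exact hk.congr (hU.prod isOpen_univ) fun p hp => (hd p.1 hp.1 p.2).mbDeriv_eq hf hU hp.1

theorem CkOn.clm_comp {W : Type*} [AddCommGroup W] [Module ℝ W] [TopologicalSpace W] {f : E → W}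
    (hf : CkOn k f U) (L : W →L[ℝ] W') : CkOn k (fun x => L (f x)) U := by
  induction k generalizing E with
  | zero => exact L.continuous.comp_continuousOn hf
  | succ k ih =>
    obtain ⟨hc, df, hd, hk⟩ := hf
    exact ⟨L.continuous.comp_continuousOn hc, fun p => L (df p),
      fun x hx h => (hd x hx h).clm_comp L, ih hk⟩

theorem ContinuousLinearMap.ckOn {W : Type*} [AddCommGroup W] [Module ℝ W] [TopologicalSpace W]
    (L : E →L[ℝ] W) (U : Set E) : CkOn k L U := by
  induction k generalizing E with
  | zero => exact L.continuous.continuousOn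
  | succ k ih =>
    refine ⟨L.continuous.continuousOn, L.comp (ContinuousLinearMap.snd ℝ E E), fun x _ h => ?_,
      ih _ _⟩
    refine tendsto_const_nhds.congr' ?_
    filter_upwards [self_mem_nhdsWithin] with t ht
    simp [smul_smul, inv_mul_cancel₀ (show t ≠ 0 from ht)]

end Ck

section Comp

theorem CkOn.prodMk {f : E → W} {g : E → W'} {U : Set E} {k : ℕ} (hf : CkOn k f U) (hg : CkOn k g U) :
    CkOn k (fun x => (f x, g x)) U := by
  induction k generalizing E with
  | zero => exact ContinuousOn.prodMk hf hg
  | succ k ih =>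
    obtain ⟨hc, df, hd, hk⟩ := hf
    obtain ⟨hc', dg, hd', hk'⟩ := hg
    exact ⟨hc.prodMk hc', fun p => (df p, dg p), fun x hx h => (hd x hx h).prodMk (hd' x hx h),
      ih hk hk'⟩


theorem CkOn.fst_comp {f : E → W} {U : Set E} {k : ℕ} (hf : CkOn k f U) :
    CkOn k (fun p : E × E' => f p.1) (U ×ˢ univ) := by
  have := hf.comp_clm (ContinuousLinearMap.fst ℝ E E')
  have e : ((ContinuousLinearMap.fst ℝ E E') ⁻¹' U) = U ×ˢ (univ : Set E') := by
    ext p; simp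
  rwa [e] at this

theorem CkOn.comp [IsTopologicalAddGroup E'] [ContinuousSMul ℝ E']
    [IsTopologicalAddGroup W] [ContinuousSMul ℝ W] [LocallyConvexSpace ℝ W]
    {k : ℕ} {g : E → E'} {f : E' → W} {U : Set E} {V : Set E'}
    (hf : CkOn k f V) (hg : CkOn k g U) (hV : IsOpen V) (hUV : MapsTo g U V) :
    CkOn k (fun x => f (g x)) U := by
  induction k generalizing E E' with
  | zero => exact ContinuousOn.comp hf hg hUV
  | succ k ih =>
    have hg' := hg.of_succ.fst_comp (E' := E)
    obtain ⟨hc, df, hd, hk⟩ := hf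
    obtain ⟨hc', dg, hd', hk'⟩ := hg
    refine ⟨hc.comp hc' hUV, fun p => df (g p.1, dg p), fun x hx h =>
      HasDirDeriv.comp_of_c1 hV hd hk.continuousOn (hd' x hx h) (hUV hx), ?_⟩
    exact ih hk (hg'.prodMk hk') (hV.prod isOpen_univ) fun p hp => ⟨hUV hp.1, mem_univ _⟩

end Comp

end MichalBastiani

/-! ### Sequentially continuous products, closed subspaces, locality, symmetry of second
derivatives. -/

section BilinearAndLocal

variable {E A B C W W' : Type*}
  [AddCommGroup E] [Module ℝ E] [TopologicalSpace E]
  [IsTopologicalAddGroup E] [ContinuousSMul ℝ E]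
  [AddCommGroup A] [Module ℝ A] [TopologicalSpace A]
  [AddCommGroup B] [Module ℝ B] [TopologicalSpace B]
  [AddCommGroup C] [Module ℝ C] [TopologicalSpace C]
  [AddCommGroup W] [Module ℝ W] [TopologicalSpace W]
  [AddCommGroup W'] [Module ℝ W'] [TopologicalSpace W']

/-- A bilinear map is sequentially continuous. -/
def IsSeqContinuousBilin (b : A →ₗ[ℝ] B →ₗ[ℝ] C) : Prop :=
  ∀ (u : ℕ → A) (v : ℕ → B) (x : A) (y : B), Tendsto u atTop (𝓝 x) → Tendsto v atTop (𝓝 y) →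
    Tendsto (fun n => b (u n) (v n)) atTop (𝓝 (b x y))

/-- This covers the two kinds of filter that calculus needs: punctured neighbourhoods of `0` in `ℝ`,
and neighbourhoods within a set in a first countable space. -/
theorem IsSeqContinuousBilin.tendsto {b : A →ₗ[ℝ] B →ₗ[ℝ] C} (hb : IsSeqContinuousBilin b)
    {ι : Type*} {l : Filter ι} [l.IsCountablyGenerated] {u : ι → A} {v : ι → B} {x : A} {y : B}
    (hu : Tendsto u l (𝓝 x)) (hv : Tendsto v l (𝓝 y)) :
    Tendsto (fun i => b (u i) (v i)) l (𝓝 (b x y)) :=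
  tendsto_of_seq_tendsto fun _ hs => hb _ _ x y (hu.comp hs) (hv.comp hs)

theorem IsSeqContinuousBilin.hasDirDeriv [IsTopologicalAddGroup B] [ContinuousSMul ℝ B]
    [IsTopologicalAddGroup C]
    {b : A →ₗ[ℝ] B →ₗ[ℝ] C} (hb : IsSeqContinuousBilin b)
    {f : E → A} {g : E → B} {x h : E} {v : A} {w : B} (hf : HasDirDeriv f x h v)
    (hg : HasDirDeriv g x h w) :
    HasDirDeriv (fun y => b (f y) (g y)) x h (b v (g x) + b (f x) w) := by
  refine ((hb.tendsto hf hg.tendsto).add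
    (hb.tendsto (tendsto_const_nhds (x := f x)) hg)).congr fun t => ?_
  simp only [map_sub, map_smul, LinearMap.sub_apply, LinearMap.smul_apply]
  module

theorem CkOn.bilin [FirstCountableTopology E] [IsTopologicalAddGroup B] [ContinuousSMul ℝ B]
    [IsTopologicalAddGroup C] {b : A →ₗ[ℝ] B →ₗ[ℝ] C} (hb : IsSeqContinuousBilin b) {k : ℕ}
    {f : E → A} {g : E → B} {U : Set E} (hf : CkOn k f U) (hg : CkOn k g U) :
    CkOn k (fun x => b (f x) (g x)) U := by
  have cont : ∀ {f : E → A} {g : E → B}, ContinuousOn f U → ContinuousOn g U →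
      ContinuousOn (fun x => b (f x) (g x)) U := fun hf hg x hx => hb.tendsto (hf x hx) (hg x hx)
  induction k generalizing E with
  | zero => exact cont hf hg
  | succ k ih =>
    have hf1 := hf.of_succ.fst_comp (E' := E)
    have hg1 := hg.of_succ.fst_comp (E' := E)
    obtain ⟨hc, df, hd, hk⟩ := hf
    obtain ⟨hc', dg, hd', hk'⟩ := hg
    refine ⟨cont hc hc', fun p => b (df p) (g p.1) + b (f p.1) (dg p),
      fun x hx h => hb.hasDirDeriv (hd x hx h) (hd' x hx h), (ih hk hg1 ?_).add (ih hf1 hk' ?_)⟩ <;>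
    exact fun hf hg x hx => hb.tendsto (hf x hx) (hg x hx)

/-- The difference quotients of `L ∘ f` lie in the range of `L`. The range is closed, so it contains
their limits and the derivative lifts to `W`. -/
theorem CkOn.of_isClosedEmbedding {L : W →L[ℝ] W'} (hL : IsClosedEmbedding L) {k : ℕ} {f : E → W}
    {U : Set E} (hU : IsOpen U) (hf : CkOn k (fun x => L (f x)) U) : CkOn k f U := by
  induction k generalizing E with
  | zero => exact (hL.isInducing.continuousOn_iff).2 hf
  | succ k ih =>
    obtain ⟨hc, df, hd, hk⟩ := hf
    have hr : ∀ p : E × E, ∃ w, p ∈ U ×ˢ (univ : Set E) → L w = df p := by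
      intro p
      by_cases hp : p ∈ U ×ˢ (univ : Set E)
      · have : df p ∈ range L := by
          refine hL.isClosed_range.mem_of_tendsto (hd p.1 hp.1 p.2) (Eventually.of_forall fun t => ?_)
          exact ⟨t⁻¹ • (f (p.1 + t • p.2) - f p.1), by simp⟩
        obtain ⟨w, hw⟩ := this
        exact ⟨w, fun _ => hw⟩
      · exact ⟨0, fun h => (hp h).elim⟩
    choose df' hdf' using hr
    refine ⟨(hL.isInducing.continuousOn_iff).2 hc, df', fun x hx h => ?_,
      ih (hU.prod isOpen_univ) (hk.congr (hU.prod isOpen_univ) hdf')⟩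
    refine hL.isInducing.tendsto_nhds_iff.2 ?_
    rw [hdf' (x, h) ⟨hx, mem_univ _⟩]
    refine Tendsto.congr (fun t => ?_) (hd x hx h)
    simp

variable [IsTopologicalAddGroup W] [ContinuousSMul ℝ W] [LocallyConvexSpace ℝ W] [T2Space W]

theorem CkOn.const {W : Type*} [AddCommGroup W] [Module ℝ W] [TopologicalSpace W]
    (k : ℕ) (w : W) (U : Set E) : CkOn k (fun _ => w) U := by
  cases k with
  | zero => exact continuousOn_const
  | succ k =>
    exact ⟨continuousOn_const, fun _ => 0, fun x _ h => by simp [HasDirDeriv, tendsto_const_nhds],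
      CkOn.zero _ _⟩

/-- The local derivatives glue because all of them are given by the single map `mbDeriv f`. -/
theorem CkOn.of_local {k : ℕ} {f : E → W} {U : Set E} (hU : IsOpen U)
    (h : ∀ x ∈ U, ∃ V, IsOpen V ∧ x ∈ V ∧ CkOn k f V) : CkOn k f U := by
  induction k generalizing E with
  | zero =>
    intro x hx
    obtain ⟨V, hV, hxV, hf⟩ := h x hx
    exact (ContinuousOn.continuousAt hf (hV.mem_nhds hxV)).continuousWithinAt
  | succ k ih =>
    refine ⟨fun x hx => ?_, fun p => mbDeriv f p.1 p.2, fun x hx v => ?_,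
      ih (hU.prod isOpen_univ) fun p hp => ?_⟩
    · obtain ⟨V, hV, hxV, hf⟩ := h x hx
      exact (hf.continuousOn.continuousAt (hV.mem_nhds hxV)).continuousWithinAt
    · obtain ⟨V, hV, hxV, hf⟩ := h x hx
      exact hf.hasDirDeriv hV hxV v
    · obtain ⟨V, hV, hxV, hf⟩ := h p.1 hp.1
      exact ⟨V ×ˢ univ, hV.prod isOpen_univ, ⟨hxV, mem_univ _⟩, hf.ckOn_mbDeriv hV⟩

/-- Both sides are limits of the second difference `t⁻² (f(x + th + tk) - f(x + tk) - f(x + th) +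
f(x))`, which is symmetric in `h` and `k`. -/
theorem mbDeriv_symmetric {f : E → W} {U : Set E} (hU : IsOpen U) (hf : CkOn (1 + 1) f U) {x : E}
    (hx : x ∈ U) (h k : E) :
    mbDeriv (fun y => mbDeriv f y k) x h = mbDeriv (fun y => mbDeriv f y h) x k := by
  have main : ∀ h k : E, Tendsto (fun t : ℝ => t⁻¹ • t⁻¹ •
      (f (x + t • h + t • k) - f (x + t • k) - (f (x + t • h) - f x))) (𝓝[≠] 0)
      (𝓝 (mbDeriv (fun y => mbDeriv f y k) x h)) := by
    intro h k V hV
    obtain ⟨S, hS, hSc, hSv, hSV⟩ := exists_closed_convex_nhds hV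
    have hg : CkOn 1 (fun y => mbDeriv f y k) U := by
      have h1 : CkOn 1 (fun y : E => (y, k)) U :=
        CkOn.prodMk ((ContinuousLinearMap.id ℝ E).ckOn U)
          (CkOn.const _ _ _)
      have h2 := CkOn.comp (hf.ckOn_mbDeriv hU) h1 (hU.prod isOpen_univ)
        fun y hy => ⟨hy, mem_univ _⟩
      exact h2
    have hsl := tendsto_slope hU (df := fun p => mbDeriv (fun y => mbDeriv f y k) p.1 p.2)
      (fun y hy v => hg.hasDirDeriv hU hy v) (hg.ckOn_mbDeriv hU).continuousOn hx h
    have h2 := hsl.eventually hS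
    rw [nhds_prod_eq] at h2
    -- The direction `h` is frozen while the base point still varies: quotients of `Df(·)(k)` are
    -- controlled at all points near `x`.
    have h3 : ∀ᶠ p : ℝ × E in 𝓝[≠] (0 : ℝ) ×ˢ 𝓝 x,
        p.1⁻¹ • (mbDeriv f (p.2 + p.1 • h) k - mbDeriv f p.2 k) ∈ S := by
      have : Tendsto (fun p : ℝ × E => (p.1, p.2, h)) (𝓝[≠] (0 : ℝ) ×ˢ 𝓝 x)
          (𝓝[≠] (0 : ℝ) ×ˢ (𝓝 x ×ˢ 𝓝 h)) :=
        tendsto_fst.prodMk (tendsto_snd.prodMk tendsto_const_nhds)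
      exact this.eventually h2
    obtain ⟨T, hT, N, hN, hTN⟩ := Filter.mem_prod_iff.1 h3
    have h4 : ∀ᶠ t in 𝓝 (0 : ℝ), ∀ s ∈ Icc (0 : ℝ) 1,
        x + s • t • k ∈ N ∩ U ∧ x + t • h + s • t • k ∈ U := by
      refine isCompact_Icc.eventually_forall_of_forall_eventually fun s _ => ?_
      have c1 : Tendsto (fun z : ℝ × ℝ => x + z.2 • z.1 • k) (𝓝 (0, s)) (𝓝 x) := by
        have : Continuous (fun z : ℝ × ℝ => x + z.2 • z.1 • k) := by fun_prop
        simpa using this.tendsto (0, s)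
      have c2 : Tendsto (fun z : ℝ × ℝ => x + z.1 • h + z.2 • z.1 • k) (𝓝 (0, s)) (𝓝 x) := by
        have : Continuous (fun z : ℝ × ℝ => x + z.1 • h + z.2 • z.1 • k) := by fun_prop
        simpa using this.tendsto (0, s)
      filter_upwards [c1.eventually (inter_mem hN (hU.mem_nhds hx)),
        c2.eventually (hU.mem_nhds hx)] with z hz hz' using ⟨hz, hz'⟩
    change ∀ᶠ t : ℝ in 𝓝[≠] 0, _ ∈ V
    filter_upwards [nhdsWithin_le_nhds h4, hT, self_mem_nhdsWithin] with t ht htT ht0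
    apply hSV
    have ht0 : t ≠ 0 := ht0
    -- Mean value theorem in the direction `k`: the increment of this curve is the second
    -- difference, and its velocity at `s` is the quotient of `Df(·)(k)` in the direction `h` at `x
    -- + stk`.
    have hder : ∀ s ∈ Icc (0 : ℝ) 1, HasDirDeriv (fun s : ℝ => t⁻¹ • t⁻¹ •
        (f (x + t • h + s • t • k) - f (x + s • t • k))) s 1
        (t⁻¹ • (mbDeriv f (x + s • t • k + t • h) k - mbDeriv f (x + s • t • k) k)) := by
      intro s hs
      have e1 := ((hf.hasDirDeriv hU (ht s hs).2 k).smul_dir t).along_line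
      have e2 := ((hf.hasDirDeriv hU (ht s hs).1.2 k).smul_dir t).along_line
      have e3 := (e1.sub e2).clm_comp ((t⁻¹ * t⁻¹) • ContinuousLinearMap.id ℝ W)
      convert e3 using 1
      · simp [smul_smul]
      · rw [add_right_comm]
        simp only [smul_apply, ContinuousLinearMap.id_apply, ← smul_sub,
          smul_smul]
        congr 1
        field_simp
    have := hSv.sub_mem_of_hasDirDeriv hSc hder fun s hs =>
      hTN (mk_mem_prod htT (ht s hs).1.1)
    simpa [← smul_sub] using this
  refine tendsto_nhds_unique (main h k) ((main k h).congr fun t => ?_)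
  rw [add_right_comm]
  congr 2
  abel

end BilinearAndLocal

/-! ### The exponential law for maps that are linear in one variable. -/

section Curry

variable {E E' W Z : Type*}
  [AddCommGroup E] [Module ℝ E] [TopologicalSpace E]
  [IsTopologicalAddGroup E] [ContinuousSMul ℝ E]
  [AddCommGroup E'] [Module ℝ E'] [TopologicalSpace E']
  [IsTopologicalAddGroup E'] [ContinuousSMul ℝ E']
  [AddCommGroup W] [Module ℝ W] [TopologicalSpace W]
  [IsTopologicalAddGroup W] [ContinuousSMul ℝ W] [LocallyConvexSpace ℝ W] [T2Space W]
  [AddCommGroup Z] [Module ℝ Z] [TopologicalSpace Z] [IsTopologicalAddGroup Z]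

/-- A `C^1` map that is homogeneous in its second argument is continuous in the first one,
uniformly on bounded sets. -/
theorem CkOn.eventually_sub_mem {f : E × E' → W} {U : Set E} (hU : IsOpen U)
    (hf : CkOn 1 f (U ×ˢ univ)) (hlin : ∀ x ∈ U, ∀ (c : ℝ) v, f (x, c • v) = c • f (x, v))
    {B : Set E'} (hB : Bornology.IsVonNBounded ℝ B) {V : Set W} (hV : V ∈ 𝓝 0) {x₀ : E}
    (hx₀ : x₀ ∈ U) : ∀ᶠ x in 𝓝 x₀, ∀ v ∈ B, f (x, v) - f (x₀, v) ∈ V := by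
  have hUo : IsOpen (U ×ˢ (univ : Set E')) := hU.prod isOpen_univ
  -- At `(x₀, 0)` in the zero direction the derivative vanishes. Hence `t⁻¹ (f(x₀ + tw, v) - f(x₀,
  -- v))` is small for small `t ≠ 0`, `v` and `w`.
  have hsl := tendsto_slope hUo (df := fun p => mbDeriv f p.1 p.2)
    (fun y hy v => hf.hasDirDeriv hUo hy v) (hf.ckOn_mbDeriv hUo).continuousOn
    (x := (x₀, 0)) ⟨hx₀, mem_univ _⟩ 0
  simp only [map_zero] at hsl
  have h2 := hsl.eventually hV
  rw [nhds_prod_eq] at h2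
  have h3 : ∀ᶠ p : ℝ × E' × E in 𝓝[≠] (0 : ℝ) ×ˢ (𝓝 0 ×ˢ 𝓝 0),
      p.1⁻¹ • (f (x₀ + p.1 • p.2.2, p.2.1) - f (x₀, p.2.1)) ∈ V := by
    have : Tendsto (fun p : ℝ × E' × E => (p.1, (x₀, p.2.1), (p.2.2, (0 : E'))))
        (𝓝[≠] (0 : ℝ) ×ˢ (𝓝 (0 : E') ×ˢ 𝓝 (0 : E)))
        (𝓝[≠] (0 : ℝ) ×ˢ (𝓝 (x₀, (0 : E')) ×ˢ 𝓝 (0 : E × E'))) := by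
      rw [← nhds_prod_eq (x := (0 : E')) (y := (0 : E))]
      refine tendsto_fst.prodMk (Tendsto.prodMk ?_ ?_)
      · have h1 : Tendsto (fun p : ℝ × E' × E => p.2.1)
          (𝓝[≠] (0 : ℝ) ×ˢ 𝓝 ((0 : E'), (0 : E))) (𝓝 0) :=
          (continuous_fst.tendsto ((0 : E'), (0 : E))).comp tendsto_snd
        exact Tendsto.prodMk_nhds tendsto_const_nhds h1
      · have h1 : Tendsto (fun p : ℝ × E' × E => p.2.2)
          (𝓝[≠] (0 : ℝ) ×ˢ 𝓝 ((0 : E'), (0 : E))) (𝓝 0) :=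
          (continuous_snd.tendsto ((0 : E'), (0 : E))).comp tendsto_snd
        exact h1.prodMk_nhds tendsto_const_nhds
    filter_upwards [this.eventually h2] with p hp
    have hp' : p.1⁻¹ • (f ((x₀, p.2.1) + p.1 • (p.2.2, (0 : E'))) - f (x₀, p.2.1)) ∈ V := hp
    simpa using hp'
  obtain ⟨T, hT, N, hN, hTN⟩ := Filter.mem_prod_iff.1 h3
  obtain ⟨N', hN', N'', hN'', hNN⟩ := Filter.mem_prod_iff.1 hN
  -- Some `t ≠ 0` satisfies `B ⊆ t⁻¹ N'`. By homogeneity, the increment of `f` at a point of `B` is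
  -- `t⁻¹` times the increment at its rescaling in `N'`.
  have h4 : ∀ᶠ t : ℝ in 𝓝[≠] 0, B ⊆ (fun v => t⁻¹ • v) '' N' := tendsto_inv₀_nhdsNE_zero.eventually (hB hN')
  obtain ⟨t, ⟨htB, htT⟩, ht0⟩ := ((h4.and hT).and self_mem_nhdsWithin).exists
  have ht0 : t ≠ 0 := ht0
  have h5 : Tendsto (fun x : E => t⁻¹ • (x - x₀)) (𝓝 x₀) (𝓝 0) := by
    have : Continuous fun x : E => t⁻¹ • (x - x₀) := by fun_prop
    simpa using this.tendsto x₀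
  filter_upwards [h5.eventually hN'', hU.mem_nhds hx₀] with x hx hxU v hv
  obtain ⟨v', hv', rfl⟩ := htB hv
  have := hTN (mk_mem_prod htT (hNN (mk_mem_prod hv' hx)))
  simp only [smul_smul, mul_inv_cancel₀ ht0, one_smul, add_sub_cancel, mem_ofPred_eq] at this
  simpa [hlin x hxU, hlin x₀ hx₀, smul_sub] using this

variable [ContinuousSMul ℝ Z]

/-- A smooth map that is linear in its second argument is smooth as a map to a space `Z` of
continuous linear maps that carries a topology of uniform convergence on bounded sets. -/
theorem CkOn.curry (ev : Z →ₗ[ℝ] E' → W) (mk : (E' →L[ℝ] W) → Z) (hmk : ∀ L v, ev (mk L) v = L v)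
    (hev : ∀ N ∈ 𝓝 (0 : Z), ∃ B : Set E', Bornology.IsVonNBounded ℝ B ∧ ∃ V ∈ 𝓝 (0 : W),
      ∀ z, (∀ v ∈ B, ev z v ∈ V) → z ∈ N)
    {f : E × E' → W} {g : E → Z} {U : Set E} (hU : IsOpen U) (hf : SmoothOn f (U ×ˢ univ))
    (hadd : ∀ x ∈ U, ∀ v w, f (x, v + w) = f (x, v) + f (x, w))
    (hsmul : ∀ x ∈ U, ∀ (c : ℝ) v, f (x, c • v) = c • f (x, v))
    (hg : ∀ x ∈ U, ∀ v, ev (g x) v = f (x, v)) (k : ℕ) : CkOn k g U := by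
  -- The base space is quantified over here because the induction on `k` passes from `E` to `E × E`.
  have cont : ∀ {E : Type _} [AddCommGroup E] [Module ℝ E] [TopologicalSpace E]
      [IsTopologicalAddGroup E] [ContinuousSMul ℝ E] {f : E × E' → W} {g : E → Z} {U : Set E},
      IsOpen U → SmoothOn f (U ×ˢ univ) →
      (∀ x ∈ U, ∀ (c : ℝ) v, f (x, c • v) = c • f (x, v)) →
      (∀ x ∈ U, ∀ v, ev (g x) v = f (x, v)) → ContinuousOn g U := by
    intro E _ _ _ _ _ f g U hU hf hsmul hg x hx
    refine ContinuousAt.continuousWithinAt ?_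
    rw [ContinuousAt, ← tendsto_sub_nhds_zero_iff]
    intro N hN
    obtain ⟨B, hB, V, hV, h⟩ := hev N hN
    change ∀ᶠ y in 𝓝 x, g y - g x ∈ N
    filter_upwards [(hf 1).eventually_sub_mem hU hsmul hB hV hx, hU.mem_nhds hx] with y hy hyU
    refine h _ fun v hv => ?_
    rw [map_sub, Pi.sub_apply, hg y hyU, hg x hx]
    exact hy v hv
  induction k generalizing E with
  | zero => exact cont hU hf hsmul hg
  | succ k ih =>
    have hUo : IsOpen (U ×ˢ (univ : Set E')) := hU.prod isOpen_univ
    have hd : ∀ x ∈ U, ∀ v h, HasDirDeriv (fun y => f (y, v)) x h (mbDeriv f (x, v) (h, 0)) := by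
      intro x hx v h
      have := (hf 1).hasDirDeriv hUo (x := (x, v)) ⟨hx, mem_univ _⟩ (h, 0)
      simpa [HasDirDeriv] using this
    have hev' : ∀ x ∈ U, ∀ h, ∀ᶠ t : ℝ in 𝓝[≠] 0, x + t • h ∈ U := fun x hx h =>
      (tendsto_add_smul x h).eventually (hU.mem_nhds hx)
    have hadd' : ∀ x ∈ U, ∀ h v w, mbDeriv f (x, v + w) (h, 0) =
        mbDeriv f (x, v) (h, 0) + mbDeriv f (x, w) (h, 0) := by
      intro x hx h v w
      refine tendsto_nhds_unique (hd x hx (v + w) h)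
        (((hd x hx v h).add (hd x hx w h)).congr' ?_)
      filter_upwards [hev' x hx h] with t ht
      rw [hadd _ ht, hadd _ hx]
    have hsmul' : ∀ x ∈ U, ∀ h (c : ℝ) v, mbDeriv f (x, c • v) (h, 0) =
        c • mbDeriv f (x, v) (h, 0) := by
      intro x hx h c v
      refine tendsto_nhds_unique (hd x hx (c • v) h) (((hd x hx v h).const_smul c).congr' ?_)
      filter_upwards [hev' x hx h] with t ht
      rw [hsmul _ ht, hsmul _ hx, smul_comm c, smul_sub]
    -- The partial derivative in the first variable, regarded as a function of `((x, h), v)`, is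
    -- again smooth and linear in `v`, so the induction hypothesis applies to it over `E × E`.
    have hf' : SmoothOn (fun q : (E × E) × E' => mbDeriv f (q.1.1, q.2) (q.1.2, 0))
        ((U ×ˢ univ) ×ˢ univ) := by
      intro k
      let L : (E × E) × E' →L[ℝ] (E × E') × (E × E') :=
        ContinuousLinearMap.prod
          ((ContinuousLinearMap.fst ℝ E E).prodMap (ContinuousLinearMap.id ℝ E'))
          (((ContinuousLinearMap.snd ℝ E E).comp (ContinuousLinearMap.fst ℝ (E × E) E')).prod 0)
      have e : (fun q : (E × E) × E' => mbDeriv f (q.1.1, q.2) (q.1.2, 0)) =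
          (fun p : (E × E') × (E × E') => mbDeriv f p.1 p.2) ∘ L := by
        funext q
        simp [L, Prod.map]
      rw [e]
      have := ((hf (k + 1)).ckOn_mbDeriv hUo).comp_clm L
      exact this.mono fun q hq => ⟨⟨hq.1.1, mem_univ _⟩, mem_univ _⟩
    have hc : ∀ q : (E × E), q ∈ U ×ˢ (univ : Set E) →
        Continuous fun v => mbDeriv f (q.1, v) (q.2, 0) := by
      intro q hq
      have : Continuous fun v : E' => (q, v) := by fun_prop
      have h0 := CkOn.continuousOn (hf' 0)
      have h1 := h0.comp (s := univ) this.continuousOn fun v _ => ⟨hq, mem_univ _⟩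
      exact continuousOn_univ.1 h1
    -- On `U` the linear map `v ↦ D₁f(x, v)(h)` is continuous and is turned into an element of `Z`
    -- by `mk`; elsewhere the value is irrelevant.
    have hex : ∀ q : (E × E), ∃ z : Z, q ∈ U ×ˢ (univ : Set E) →
        ∀ v, ev z v = mbDeriv f (q.1, v) (q.2, 0) := by
      intro q
      by_cases hq : q ∈ U ×ˢ (univ : Set E)
      · exact ⟨mk ⟨⟨⟨fun v => mbDeriv f (q.1, v) (q.2, 0), hadd' q.1 hq.1 q.2⟩,
          hsmul' q.1 hq.1 q.2⟩, hc q hq⟩, fun _ v => hmk _ v⟩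
      · exact ⟨0, fun h => (hq h).elim⟩
    choose g' hg' using hex
    refine ⟨cont hU hf hsmul hg, g', fun x hx h => ?_, ih (hU.prod isOpen_univ) hf'
      (fun q hq => hadd' q.1 hq.1 q.2) (fun q hq => hsmul' q.1 hq.1 q.2) hg'⟩
    have hxh : (x, h) ∈ U ×ˢ (univ : Set E) := ⟨hx, mem_univ _⟩
    rw [HasDirDeriv, ← tendsto_sub_nhds_zero_iff]
    intro N hN
    obtain ⟨B, hB, V, hV, hBV⟩ := hev N hN
    obtain ⟨S, hS, hSc, hSv, hSV⟩ := exists_closed_convex_nhds hV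
    have h1 := (hf' 1).eventually_sub_mem (hU.prod isOpen_univ)
      (fun q hq => hsmul' q.1 hq.1 q.2) hB hS hxh
    have h4 : ∀ᶠ t in 𝓝 (0 : ℝ), ∀ s ∈ Icc (0 : ℝ) 1, x + s • t • h ∈ U ∧
        ∀ v ∈ B, mbDeriv f (x + s • t • h, v) (h, 0) - mbDeriv f (x, v) (h, 0) ∈ S := by
      refine isCompact_Icc.eventually_forall_of_forall_eventually fun s _ => ?_
      have c1 : Tendsto (fun z : ℝ × ℝ => (x + z.2 • z.1 • h, h)) (𝓝 (0, s)) (𝓝 (x, h)) := by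
        have : Continuous (fun z : ℝ × ℝ => (x + z.2 • z.1 • h, h)) := by fun_prop
        simpa using this.tendsto (0, s)
      filter_upwards [c1.eventually h1, c1.eventually ((hU.prod isOpen_univ).mem_nhds hxh)]
        with z hz hz' using ⟨hz'.1, hz⟩
    change ∀ᶠ t : ℝ in 𝓝[≠] 0, _ ∈ N
    filter_upwards [nhdsWithin_le_nhds h4, hev' x hx h, self_mem_nhdsWithin] with t ht htU ht0
    have ht0 : t ≠ 0 := ht0
    refine hBV _ fun v hv => hSV ?_
    -- With the linear term subtracted, the increment is the error of the difference quotient, and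
    -- the velocities are small uniformly in `v ∈ B`.
    have hder : ∀ s ∈ Icc (0 : ℝ) 1, HasDirDeriv (fun s : ℝ => t⁻¹ • f (x + s • t • h, v) -
        s • mbDeriv f (x, v) (h, 0)) s 1
        (mbDeriv f (x + s • t • h, v) (h, 0) - mbDeriv f (x, v) (h, 0)) := by
      intro s hs
      have e1 := (((hd _ (ht s hs).1 v h).smul_dir t).along_line).clm_comp
        (t⁻¹ • ContinuousLinearMap.id ℝ W)
      have e2 : HasDirDeriv (fun s : ℝ => s • mbDeriv f (x, v) (h, 0)) s 1
          (mbDeriv f (x, v) (h, 0)) := by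
        refine tendsto_const_nhds.congr' ?_
        filter_upwards [self_mem_nhdsWithin] with r hr
        simp [add_smul, smul_smul, inv_mul_cancel₀ (show r ≠ 0 from hr)]
      simpa [smul_smul, mul_inv_cancel₀ ht0, inv_mul_cancel₀ ht0] using e1.sub e2
    have := hSv.sub_mem_of_hasDirDeriv hSc hder fun s hs => (ht s hs).2 v hv
    have e : ev (t⁻¹ • (g (x + t • h) - g x) - g' (x, h)) v =
        t⁻¹ • (f (x + t • h, v) - f (x, v)) - mbDeriv f (x, v) (h, 0) := by
      simp only [map_sub, map_smul, Pi.sub_apply, Pi.smul_apply, hg _ htU, hg _ hx, hg' _ hxh]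
    rw [e]
    convert this using 1
    simp only [one_smul, zero_smul, add_zero]
    module

end Curry

/-! ### Rules of calculus for smooth maps. -/

section SmoothOnAPI

variable {E E' W W' A B : Type*}
  [AddCommGroup E] [Module ℝ E] [TopologicalSpace E]
  [IsTopologicalAddGroup E] [ContinuousSMul ℝ E]
  [AddCommGroup E'] [Module ℝ E'] [TopologicalSpace E']
  [IsTopologicalAddGroup E'] [ContinuousSMul ℝ E']
  [AddCommGroup W] [Module ℝ W] [TopologicalSpace W]
  [AddCommGroup W'] [Module ℝ W'] [TopologicalSpace W']
  [AddCommGroup A] [Module ℝ A] [TopologicalSpace A]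
  [AddCommGroup B] [Module ℝ B] [TopologicalSpace B]
  {f g : E → W} {U V : Set E}

theorem SmoothOn.continuousOn (hf : SmoothOn f U) : ContinuousOn f U := hf 0

theorem SmoothOn.mono (hf : SmoothOn f U) (h : V ⊆ U) : SmoothOn f V := fun k => (hf k).mono h

theorem SmoothOn.congr (hf : SmoothOn f U) (hU : IsOpen U) (h : EqOn g f U) : SmoothOn g U :=
  fun k => (hf k).congr hU h

theorem SmoothOn.const (w : W) : SmoothOn (fun _ : E => w) U := fun k => CkOn.const k w U

theorem ContinuousLinearMap.smoothOn (L : E →L[ℝ] W) : SmoothOn L U := fun _ => L.ckOn U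

theorem SmoothOn.clm_comp (hf : SmoothOn f U) (L : W →L[ℝ] W') :
    SmoothOn (fun x => L (f x)) U := fun k => (hf k).clm_comp L

theorem SmoothOn.prodMk {g : E → W'} (hf : SmoothOn f U) (hg : SmoothOn g U) :
    SmoothOn (fun x => (f x, g x)) U := fun k => (hf k).prodMk (hg k)

theorem SmoothOn.fst_comp (hf : SmoothOn f U) :
    SmoothOn (fun p : E × E' => f p.1) (U ×ˢ univ) := fun k => (hf k).fst_comp

theorem SmoothOn.fst {f : E → W × W'} (hf : SmoothOn f U) : SmoothOn (fun x => (f x).1) U :=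
  hf.clm_comp (ContinuousLinearMap.fst ℝ W W')

theorem SmoothOn.snd {f : E → W × W'} (hf : SmoothOn f U) : SmoothOn (fun x => (f x).2) U :=
  hf.clm_comp (ContinuousLinearMap.snd ℝ W W')

theorem SmoothOn.bilin [FirstCountableTopology E] [IsTopologicalAddGroup B] [ContinuousSMul ℝ B]
    [IsTopologicalAddGroup W] {b : A →ₗ[ℝ] B →ₗ[ℝ] W} (hb : IsSeqContinuousBilin b)
    {f : E → A} {g : E → B} (hf : SmoothOn f U) (hg : SmoothOn g U) :
    SmoothOn (fun x => b (f x) (g x)) U := fun k => (hf k).bilin hb (hg k)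

theorem SmoothOn.of_isClosedEmbedding {L : W →L[ℝ] W'} (hL : IsClosedEmbedding L) (hU : IsOpen U)
    (hf : SmoothOn (fun x => L (f x)) U) : SmoothOn f U :=
  fun k => (hf k).of_isClosedEmbedding hL hU

variable [IsTopologicalAddGroup W] [ContinuousSMul ℝ W]

theorem SmoothOn.add (hf : SmoothOn f U) (hg : SmoothOn g U) : SmoothOn (fun x => f x + g x) U :=
  fun k => (hf k).add (hg k)

theorem SmoothOn.neg (hf : SmoothOn f U) : SmoothOn (fun x => - f x) U :=
  hf.clm_comp (-ContinuousLinearMap.id ℝ W)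

theorem SmoothOn.sub (hf : SmoothOn f U) (hg : SmoothOn g U) : SmoothOn (fun x => f x - g x) U := by
  simpa only [sub_eq_add_neg] using hf.add hg.neg

theorem SmoothOn.smul {f : E → ℝ} (hf : SmoothOn f U) (hg : SmoothOn g U) :
    SmoothOn (fun x => f x • g x) U :=
  fun k => (hf k).smul (hg k)

variable [LocallyConvexSpace ℝ W]

theorem SmoothOn.comp {g : E → E'} {f : E' → W} {V : Set E'} (hf : SmoothOn f V)
    (hg : SmoothOn g U) (hV : IsOpen V) (hUV : MapsTo g U V) : SmoothOn (fun x => f (g x)) U :=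
  fun k => (hf k).comp (hg k) hV hUV

variable [T2Space W]

theorem SmoothOn.of_local (hU : IsOpen U) (h : ∀ x ∈ U, ∃ V, IsOpen V ∧ x ∈ V ∧ SmoothOn f V) :
    SmoothOn f U := fun k => CkOn.of_local hU fun x hx =>
  let ⟨V, hV, hxV, hf⟩ := h x hx
  ⟨V, hV, hxV, hf k⟩

theorem SmoothOn.hasDirDeriv (hf : SmoothOn f U) (hU : IsOpen U) {x : E} (hx : x ∈ U) (h : E) :
    HasDirDeriv f x h (mbDeriv f x h) := (hf 1).hasDirDeriv hU hx h

theorem HasDirDeriv.mbDeriv_eq_of_smoothOn {x h : E} {v : W} (h1 : HasDirDeriv f x h v)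
    (hf : SmoothOn f U) (hU : IsOpen U) (hx : x ∈ U) : mbDeriv f x h = v :=
  h1.mbDeriv_eq (hf 1) hU hx

theorem SmoothOn.smoothOn_mbDeriv (hf : SmoothOn f U) (hU : IsOpen U) :
    SmoothOn (fun p : E × E => mbDeriv f p.1 p.2) (U ×ˢ univ) :=
  fun k => (hf (k + 1)).ckOn_mbDeriv hU

theorem SmoothOn.mbDeriv_apply (hf : SmoothOn f U) (hU : IsOpen U) {g : E → E}
    (hg : SmoothOn g U) : SmoothOn (fun y => mbDeriv f y (g y)) U := by
  have := (hf.smoothOn_mbDeriv hU).comp (g := fun y => (y, g y))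
    ((ContinuousLinearMap.id ℝ E).smoothOn.prodMk hg) (hU.prod isOpen_univ)
    fun y hy => ⟨hy, mem_univ _⟩
  exact this

theorem HasDirDeriv.comp_smoothOn {g : E' → E} {y k : E'} {v : E}
    (hg : HasDirDeriv g y k v) (hf : SmoothOn f U) (hU : IsOpen U) (hy : g y ∈ U) :
    HasDirDeriv (fun z => f (g z)) y k (mbDeriv f (g y) v) :=
  HasDirDeriv.comp_of_c1 (df := fun p => mbDeriv f p.1 p.2) hU
    (fun _ hx h => hf.hasDirDeriv hU hx h) (hf.smoothOn_mbDeriv hU).continuousOn hg hy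

theorem SmoothOn.mbDeriv_symmetric (hf : SmoothOn f U) (hU : IsOpen U) {x : E} (hx : x ∈ U)
    (h k : E) :
    mbDeriv (fun y => mbDeriv f y k) x h = mbDeriv (fun y => mbDeriv f y h) x k :=
  _root_.mbDeriv_symmetric hU (hf (1 + 1)) hx h k

/-- The derivative of `y ↦ Df(y)(g(y))`. -/
theorem HasDirDeriv.mbDeriv_apply (hf : SmoothOn f U) (hU : IsOpen U) {g : E → E} {x h w : E}
    (hx : x ∈ U) (hg : HasDirDeriv g x h w) :
    HasDirDeriv (fun y => mbDeriv f y (g y)) x h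
      (mbDeriv (fun y => mbDeriv f y (g x)) x h + mbDeriv f x w) := by
  have h1 : SmoothOn (fun y => mbDeriv f y (g x)) U := hf.mbDeriv_apply hU (SmoothOn.const _)
  -- By linearity the quotient splits into that of `Df(·)(g(x))` and `Df(x + th)` applied to the
  -- quotient of `g`. Joint continuity of `(y, v) ↦ Df(y)(v)` gives the limit of the latter.
  have h2 : Tendsto (fun t : ℝ => (x + t • h, t⁻¹ • (g (x + t • h) - g x))) (𝓝[≠] 0)
      (𝓝 (x, w)) := (tendsto_add_smul x h).prodMk_nhds hg
  have h3 := ((hf.smoothOn_mbDeriv hU).continuousOn.continuousAt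
    ((hU.prod isOpen_univ).mem_nhds ⟨hx, mem_univ _⟩)).tendsto.comp h2
  refine (Tendsto.add (h1.hasDirDeriv hU hx h) h3).congr fun t => ?_
  simp only [Function.comp_apply, map_smul, map_sub]
  module

theorem mbDeriv_id (x : E) [T2Space E] [LocallyConvexSpace ℝ E] :
    mbDeriv (fun y : E => y) x = ContinuousLinearMap.id ℝ E := by
  ext h
  have hs : SmoothOn (fun y : E => y) univ := (ContinuousLinearMap.id ℝ E).smoothOn
  refine HasDirDeriv.mbDeriv_eq_of_smoothOn ?_ hs isOpen_univ (mem_univ x)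
  refine tendsto_const_nhds.congr' ?_
  filter_upwards [self_mem_nhdsWithin] with t ht
  simp [smul_smul, inv_mul_cancel₀ (show t ≠ 0 from ht)]

theorem SmoothOn.mbDeriv_comp {g : E' → E} {V : Set E'} (hf : SmoothOn f U) (hU : IsOpen U)
    [LocallyConvexSpace ℝ E] [T2Space E]
    (hg : SmoothOn g V) (hV : IsOpen V) {y : E'} (hy : y ∈ V) (hgy : g y ∈ U) (k : E') :
    mbDeriv (fun z => f (g z)) y k = mbDeriv f (g y) (mbDeriv g y k) := by
  have ho : IsOpen (V ∩ g ⁻¹' U) := hg.continuousOn.isOpen_inter_preimage hV hU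
  have hs : SmoothOn (fun z => f (g z)) (V ∩ g ⁻¹' U) :=
    hf.comp (hg.mono inter_subset_left) hU fun z hz => hz.2
  exact ((hg.hasDirDeriv hV hy k).comp_smoothOn hf hU hgy).mbDeriv_eq_of_smoothOn hs ho ⟨hy, hgy⟩

end SmoothOnAPI

/-! ### Evaluation and currying for `L(E', W)`. -/

section LinearMapSpaces

variable {E E' W : Type*}
  [AddCommGroup E] [Module ℝ E] [TopologicalSpace E]
  [IsTopologicalAddGroup E] [ContinuousSMul ℝ E]
  [AddCommGroup E'] [Module ℝ E'] [TopologicalSpace E']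
  [IsTopologicalAddGroup E'] [ContinuousSMul ℝ E']
  [AddCommGroup W] [Module ℝ W] [TopologicalSpace W]
  [IsTopologicalAddGroup W] [ContinuousSMul ℝ W]

variable (E' W) in
/-- Evaluation of continuous linear maps, as a bilinear map. -/
def clmEval : (E' →L[ℝ] W) →ₗ[ℝ] E' →ₗ[ℝ] W := ContinuousLinearMap.coeLM ℝ

/-- The range of a convergent sequence is bounded, so convergence in `L(E', W)` is uniform on it. -/
theorem clmEval_isSeqContinuous : IsSeqContinuousBilin (clmEval E' W) := by
  intro u v G x hu hv
  have h1 : Tendsto (fun n => (u n - G) (v n)) atTop (𝓝 0) := by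
    intro V hV
    have hB := hv.isVonNBounded_range ℝ
    have := (tendsto_sub_nhds_zero_iff.2 hu).eventually
      (ContinuousLinearMap.eventually_nhds_zero_mapsTo (σ := RingHom.id ℝ) hB hV)
    exact this.mono fun n hn => hn (mem_range_self n)
  have h2 := h1.add ((G.continuous.tendsto x).comp hv)
  rw [zero_add] at h2
  refine h2.congr fun n => ?_
  simp [clmEval]

theorem SmoothOn.clm_apply [FirstCountableTopology E] {U : Set E} {G : E → E' →L[ℝ] W} {f : E → E'}
    (hG : SmoothOn G U) (hf : SmoothOn f U) : SmoothOn (fun x => G x (f x)) U :=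
  hG.bilin clmEval_isSeqContinuous hf

/-- A smooth map that is linear in its second argument is smooth as a map to `L(E', W)`. -/
theorem SmoothOn.curry_clm [LocallyConvexSpace ℝ W] [T2Space W] {G : E → E' →L[ℝ] W} {U : Set E}
    (hU : IsOpen U) (hG : SmoothOn (fun p : E × E' => G p.1 p.2) (U ×ˢ univ)) : SmoothOn G U := by
  refine CkOn.curry (Z := E' →L[ℝ] W) ⟨⟨fun L v => L v, fun _ _ => rfl⟩, fun _ _ => rfl⟩ id
    (fun _ _ => rfl) ?_ hU hG (fun x _ => map_add (G x)) (fun x _ => map_smul (G x))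
    (fun _ _ _ => rfl)
  intro N hN
  obtain ⟨⟨B, V⟩, ⟨hB, hV⟩, h⟩ := ContinuousLinearMap.hasBasis_nhds_zero.mem_iff.1 hN
  exact ⟨B, hB, V, hV, fun z hz => h hz⟩

end LinearMapSpaces

/-! ### Evaluation, currying and transposes for the dual `F'_𝓑`. -/

section BDualAnalysis

variable {F : Type*} [AddCommGroup F] [Module ℝ F] [TopologicalSpace F] (𝓑 : FrechetBornology F)

/-- The duality pairing of `F'_𝓑` with `F`. -/
def bdualPairing : BDual 𝓑 →ₗ[ℝ] F →ₗ[ℝ] ℝ where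
  toFun α := (ofBDual 𝓑 α).toLinearMap
  map_add' _ _ := rfl
  map_smul' _ _ := rfl

@[simp] theorem bdualPairing_apply (α : BDual 𝓑) (v : F) : bdualPairing 𝓑 α v = α v := rfl

@[simp] theorem toBDual_apply (α : F →L[ℝ] ℝ) (v : F) : toBDual 𝓑 α v = α v := rfl

@[simp] theorem ofBDual_apply (α : BDual 𝓑) (v : F) : ofBDual 𝓑 α v = α v := rfl

@[simp] theorem evalBDual_apply (v : F) (α : BDual 𝓑) : evalBDual 𝓑 v α = α v := rfl

/-- A convergent sequence together with its limit is compact, hence a member of `𝓑`, and convergence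
in `F'_𝓑` is uniform on it. -/
theorem bdualPairing_isSeqContinuous : IsSeqContinuousBilin (bdualPairing 𝓑) := by
  intro u v α x hu hv
  have h1 : Tendsto (fun n => (u n - α) (v n)) atTop (𝓝 0) := by
    intro V hV
    have hB := 𝓑.compact_mem _ hv.isCompact_insert_range
    have := (tendsto_sub_nhds_zero_iff.2 hu).eventually
      (UniformConvergenceCLM.eventually_nhds_zero_mapsTo (RingHom.id ℝ) hB hV)
    exact this.mono fun n hn => hn (mem_insert_of_mem _ (mem_range_self n))
  have h2 := h1.add (((ofBDual 𝓑 α).continuous.tendsto x).comp hv)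
  rw [zero_add] at h2
  refine h2.congr fun n => ?_
  simp

variable {𝓑} {E : Type*} [AddCommGroup E] [Module ℝ E] [TopologicalSpace E]
  [IsTopologicalAddGroup E] [ContinuousSMul ℝ E] [IsTopologicalAddGroup F] [ContinuousSMul ℝ F]

theorem SmoothOn.bdual_apply [FirstCountableTopology E] {U : Set E} {α : E → BDual 𝓑} {f : E → F}
    (hα : SmoothOn α U) (hf : SmoothOn f U) : SmoothOn (fun x => α x (f x)) U :=
  hα.bilin (bdualPairing_isSeqContinuous 𝓑) hf

theorem HasDirDeriv.bdual_apply {α : E → BDual 𝓑} {f : E → F} {x h : E} {β : BDual 𝓑} {v : F}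
    (hα : HasDirDeriv α x h β) (hf : HasDirDeriv f x h v) :
    HasDirDeriv (fun y => α y (f y)) x h (β (f x) + α x v) :=
  (bdualPairing_isSeqContinuous 𝓑).hasDirDeriv hα hf

/-- The members of `𝓑` are bounded, so the exponential law reaches the topology of `F'_𝓑`.
Smoothness of a 1-form is thereby tested on real valued functions of `(x, v)`. -/
theorem SmoothOn.curry_bdual {α : E → BDual 𝓑} {U : Set E}
    (hU : IsOpen U) (hα : SmoothOn (fun p : E × F => α p.1 p.2) (U ×ˢ univ)) : SmoothOn α U := by
  refine CkOn.curry (Z := BDual 𝓑) ⟨⟨fun L v => L v, fun _ _ => rfl⟩, fun _ _ => rfl⟩ (toBDual 𝓑)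
    (fun _ _ => rfl) ?_ hU hα (fun x _ => map_add (α x)) (fun x _ => map_smul (α x))
    (fun _ _ _ => rfl)
  intro N hN
  obtain ⟨⟨B, V⟩, ⟨hB, hV⟩, h⟩ := (UniformConvergenceCLM.hasBasis_nhds_zero (RingHom.id ℝ) ℝ 𝓑.sets
    ⟨∅, 𝓑.compact_mem _ isCompact_empty⟩ 𝓑.directed).mem_iff.1 hN
  exact ⟨B, 𝓑.bounded B hB, V, hV, fun z hz => h hz⟩

theorem SmoothOn.uncurry_bdual [FirstCountableTopology E] [FirstCountableTopology F]
    {α : E → BDual 𝓑} {U : Set E} (hα : SmoothOn α U) :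
    SmoothOn (fun p : E × F => α p.1 p.2) (U ×ˢ univ) :=
  hα.fst_comp.bdual_apply (ContinuousLinearMap.snd ℝ E F).smoothOn

variable (𝓑) in
/-- The transpose of a continuous linear map, as a continuous linear map. -/
def transposeCLM (L : F →L[ℝ] F) : BDual 𝓑 →L[ℝ] BDual 𝓑 where
  toLinearMap := transposeBDual 𝓑 L
  cont := by
    have hb := UniformConvergenceCLM.hasBasis_nhds_zero (RingHom.id ℝ) ℝ 𝓑.sets
      ⟨∅, 𝓑.compact_mem _ isCompact_empty⟩ 𝓑.directed
    refine continuous_of_continuousAt_zero (transposeBDual 𝓑 L) ?_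
    rw [ContinuousAt, map_zero]
    refine (hb.tendsto_iff hb).2 ?_
    rintro ⟨B, V⟩ ⟨hB, hV⟩
    -- Stability of `𝓑` under endomorphisms is what makes the transpose continuous.
    exact ⟨(L '' B, V), ⟨𝓑.image_mem L B hB, hV⟩, fun α hα v hv => hα (L v) (mem_image_of_mem _ hv)⟩

end BDualAnalysis

/-! ### Banach–Steinhaus and the continuity of transposition. -/

section Barrelled

variable {F : Type*} [AddCommGroup F] [Module ℝ F] [TopologicalSpace F] [FrechetSpace F]

/-- The Baire property supplies the barrelledness that Banach–Steinhaus requires. -/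
instance FrechetSpace.baireSpace : BaireSpace F := by
  let _ : UniformSpace F := IsTopologicalAddGroup.rightUniformSpace F
  have : IsUniformAddGroup F := isUniformAddGroup_of_addCommGroup
  have : CompleteSpace F := FrechetSpace.complete
  have : (uniformity F).IsCountablyGenerated := IsUniformAddGroup.uniformity_countably_generated
  infer_instance

/-- Bounded subsets of the dual of a Fréchet space are equicontinuous. -/
theorem exists_nhds_of_isVonNBounded {𝓑 : FrechetBornology F} {S : Set (BDual 𝓑)}
    (hS : Bornology.IsVonNBounded ℝ S) {V : Set ℝ} (hV : V ∈ 𝓝 0) :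
    ∃ N ∈ 𝓝 (0 : F), ∀ α ∈ S, ∀ v ∈ N, α v ∈ V := by
  let _ : UniformSpace F := IsTopologicalAddGroup.rightUniformSpace F
  have : IsUniformAddGroup F := isUniformAddGroup_of_addCommGroup
  -- Evaluations are continuous and linear on `F'_𝓑`, so a bounded set of functionals is pointwise
  -- bounded.
  have h := PolynormableSpace.banach_steinhaus (𝕜₁ := ℝ) (𝕜₂ := ℝ)
    (𝓕 := fun α : S => ofBDual 𝓑 α.1) (by
      intro x
      have := hS.image (evalBDual 𝓑 x)
      refine this.subset ?_
      rintro _ ⟨α, rfl⟩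
      exact ⟨α.1, α.2, rfl⟩)
  have h0 := h.equicontinuous 0
  have hU : {p : ℝ × ℝ | p.2 - p.1 ∈ V} ∈ uniformity ℝ := by
    rw [uniformity_eq_comap_nhds_zero ℝ]
    exact preimage_mem_comap hV
  refine ⟨_, h0 _ hU, fun α hα v hv => ?_⟩
  have h1 : α v - α 0 ∈ V := hv ⟨α, hα⟩
  rwa [map_zero, sub_zero] at h1

variable (𝓑 : FrechetBornology F)

/-- Transposition is continuous from `L(F, F)` to `L(F'_𝓑, F'_𝓑)`. -/
def transposeL : (F →L[ℝ] F) →L[ℝ] (BDual 𝓑 →L[ℝ] BDual 𝓑) where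
  toFun := transposeCLM 𝓑
  map_add' L L' := by
    ext α v
    exact map_add (ofBDual 𝓑 α) (L v) (L' v)
  map_smul' c L := by
    ext α v
    exact map_smul (ofBDual 𝓑 α) c (L v)
  cont := by
    have hb := UniformConvergenceCLM.hasBasis_nhds_zero (RingHom.id ℝ) ℝ 𝓑.sets
      ⟨∅, 𝓑.compact_mem _ isCompact_empty⟩ 𝓑.directed
    have hb' := ContinuousLinearMap.hasBasis_nhds_zero_of_basis (σ := RingHom.id ℝ)
      (E := BDual 𝓑) hb
    let T : (F →L[ℝ] F) →+ (BDual 𝓑 →L[ℝ] BDual 𝓑) :=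
      { toFun := transposeCLM 𝓑
        map_zero' := by
          ext α v
          exact map_zero (ofBDual 𝓑 α)
        map_add' := fun L L' => by
          ext α v
          exact map_add (ofBDual 𝓑 α) (L v) (L' v) }
    refine continuous_of_continuousAt_zero T ?_
    rw [ContinuousAt, map_zero]
    refine hb'.tendsto_right_iff.2 ?_
    rintro ⟨S, B, V⟩ ⟨hS, hB, hV⟩
    -- Equicontinuity gives one `N` that all of `S` maps into `V`; since `B` is bounded, `L(B) ⊆ N`
    -- holds for all `L` near `0`.
    obtain ⟨N, hN, h⟩ := exists_nhds_of_isVonNBounded hS hV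
    refine (ContinuousLinearMap.eventually_nhds_zero_mapsTo (σ := RingHom.id ℝ)
      (𝓑.bounded B hB) hN).mono fun L hL α hα v hv => h α hα _ (hL hv)

end Barrelled

/-! ### The bracket and the pairing on open subsets of `F`. -/

section LocalBracket

variable {F : Type*} [AddCommGroup F] [Module ℝ F] [TopologicalSpace F] [FrechetSpace F]
  {𝓑 : FrechetBornology F}

theorem HasDirDeriv.smul {E W : Type*} [AddCommGroup E] [Module ℝ E] [AddCommGroup W]
    [Module ℝ W] [TopologicalSpace W] [IsTopologicalAddGroup W] [ContinuousSMul ℝ W]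
    {f : E → ℝ} {g : E → W} {x h : E} {c : ℝ} {w : W} (hf : HasDirDeriv f x h c)
    (hg : HasDirDeriv g x h w) : HasDirDeriv (fun y => f y • g y) x h (c • g x + f x • w) := by
  refine ((Tendsto.smul hf hg.tendsto).add (Tendsto.const_smul hg (f x))).congr fun t => ?_
  module

/-- The local form of the bracket `([X, Y], L_X β - ι_Y dα)` on an open subset of `F`. -/
def locBracket (σ τ : F → F × BDual 𝓑) (y : F) : F × BDual 𝓑 :=
  (mbDeriv (fun z => (τ z).1) y (σ y).1 - mbDeriv (fun z => (σ z).1) y (τ y).1,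
    mbDeriv (fun z => (τ z).2) y (σ y).1 +
      toBDual 𝓑 ((ofBDual 𝓑 (τ y).2).comp (mbDeriv (fun z => (σ z).1) y)) -
      mbDeriv (fun z => (σ z).2) y (τ y).1 +
      toBDual 𝓑 ((evalBDual 𝓑 (τ y).1).comp (mbDeriv (fun z => (σ z).2) y)))

/-- The local form of the pairing. -/
def locPairing (σ τ : F → F × BDual 𝓑) (y : F) : ℝ := (σ y).2 (τ y).1 + (τ y).2 (σ y).1

theorem locBracket_fst (σ τ : F → F × BDual 𝓑) (y : F) : (locBracket σ τ y).1 =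
    mbDeriv (fun z => (τ z).1) y (σ y).1 - mbDeriv (fun z => (σ z).1) y (τ y).1 := rfl

theorem locBracket_snd_apply (σ τ : F → F × BDual 𝓑) (y w : F) : (locBracket σ τ y).2 w =
    mbDeriv (fun z => (τ z).2) y (σ y).1 w + (τ y).2 (mbDeriv (fun z => (σ z).1) y w) -
      mbDeriv (fun z => (σ z).2) y (τ y).1 w + mbDeriv (fun z => (σ z).2) y w (τ y).1 := rfl

theorem locBracket_congr {σ σ' τ τ' : F → F × BDual 𝓑} {y : F} (hσ : σ =ᶠ[𝓝 y] σ')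
    (hτ : τ =ᶠ[𝓝 y] τ') : locBracket σ τ y = locBracket σ' τ' y := by
  have h1 : (fun z => (σ z).1) =ᶠ[𝓝 y] fun z => (σ' z).1 := hσ.fun_comp Prod.fst
  have h2 : (fun z => (σ z).2) =ᶠ[𝓝 y] fun z => (σ' z).2 := hσ.fun_comp Prod.snd
  have h3 : (fun z => (τ z).1) =ᶠ[𝓝 y] fun z => (τ' z).1 := hτ.fun_comp Prod.fst
  have h4 : (fun z => (τ z).2) =ᶠ[𝓝 y] fun z => (τ' z).2 := hτ.fun_comp Prod.snd
  simp only [locBracket, mbDeriv_congr h1, mbDeriv_congr h2, mbDeriv_congr h3, mbDeriv_congr h4,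
    hσ.eq_of_nhds, hτ.eq_of_nhds]

variable {U : Set F} {σ τ ρ σ' τ' : F → F × BDual 𝓑} {y : F}

/-- For the covector component, each term evaluated at `w` is smooth in `(y, w)`; currying returns
to `F'_𝓑`. This avoids treating the compositions as operations on dual spaces. -/
theorem SmoothOn.locBracket (hU : IsOpen U) (hσ : SmoothOn σ U) (hτ : SmoothOn τ U) :
    SmoothOn (locBracket σ τ) U := by
  refine ((hτ.fst.mbDeriv_apply hU hσ.fst).sub (hσ.fst.mbDeriv_apply hU hτ.fst)).prodMk ?_
  refine SmoothOn.curry_bdual hU ?_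
  exact (((hτ.snd.mbDeriv_apply hU hσ.fst).uncurry_bdual.add
    (hτ.snd.fst_comp.bdual_apply (hσ.fst.smoothOn_mbDeriv hU))).sub
    (hσ.snd.mbDeriv_apply hU hτ.fst).uncurry_bdual).add
    ((hσ.snd.smoothOn_mbDeriv hU).bdual_apply hτ.fst.fst_comp)

theorem SmoothOn.locPairing (hσ : SmoothOn σ U) (hτ : SmoothOn τ U) :
    SmoothOn (locPairing σ τ) U :=
  (hσ.snd.bdual_apply hτ.fst).add (hτ.snd.bdual_apply hσ.fst)

section MbDerivRules

variable {W : Type*} [AddCommGroup W] [Module ℝ W] [TopologicalSpace W] [IsTopologicalAddGroup W]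
  [ContinuousSMul ℝ W] [LocallyConvexSpace ℝ W] [T2Space W] {f g : F → W}

theorem SmoothOn.mbDeriv_add (hU : IsOpen U) (hf : SmoothOn f U) (hg : SmoothOn g U)
    (hy : y ∈ U) : mbDeriv (fun z => f z + g z) y = mbDeriv f y + mbDeriv g y := by
  ext h
  exact ((hf.hasDirDeriv hU hy h).add (hg.hasDirDeriv hU hy h)).mbDeriv_eq_of_smoothOn
    (hf.add hg) hU hy

theorem SmoothOn.mbDeriv_smul (hU : IsOpen U) {f : F → ℝ} (hf : SmoothOn f U) (hg : SmoothOn g U)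
    (hy : y ∈ U) (h : F) : mbDeriv (fun z => f z • g z) y h =
      mbDeriv f y h • g y + f y • mbDeriv g y h :=
  ((hf.hasDirDeriv hU hy h).smul (hg.hasDirDeriv hU hy h)).mbDeriv_eq_of_smoothOn
    (hf.smul hg) hU hy

theorem SmoothOn.mbDeriv_const_smul (hU : IsOpen U) (c : ℝ) (hg : SmoothOn g U)
    (hy : y ∈ U) : mbDeriv (fun z => c • g z) y = c • mbDeriv g y := by
  ext h
  exact ((hg.hasDirDeriv hU hy h).clm_comp
    (c • ContinuousLinearMap.id ℝ W)).mbDeriv_eq_of_smoothOn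
    (hg.clm_comp (c • ContinuousLinearMap.id ℝ W)) hU hy

theorem SmoothOn.mbDeriv_clm_comp (hU : IsOpen U) (hg : SmoothOn g U) (L : W →L[ℝ] ℝ)
    (hy : y ∈ U) (h : F) : mbDeriv (fun z => L (g z)) y h = L (mbDeriv g y h) :=
  ((hg.hasDirDeriv hU hy h).clm_comp L).mbDeriv_eq_of_smoothOn (hg.clm_comp L) hU hy

theorem SmoothOn.mbDeriv_bdual_apply (hU : IsOpen U) {α : F → BDual 𝓑} {X : F → F}
    (hα : SmoothOn α U) (hX : SmoothOn X U) (hy : y ∈ U) (h : F) :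
    mbDeriv (fun z => α z (X z)) y h = mbDeriv α y h (X y) + α y (mbDeriv X y h) :=
  ((hα.hasDirDeriv hU hy h).bdual_apply (hX.hasDirDeriv hU hy h)).mbDeriv_eq_of_smoothOn
    (hα.bdual_apply hX) hU hy

end MbDerivRules

theorem locBracket_add_left (hU : IsOpen U) (hσ : SmoothOn σ U) (hσ' : SmoothOn σ' U)
    (hy : y ∈ U) :
    locBracket (fun z => σ z + σ' z) τ y = locBracket σ τ y + locBracket σ' τ y := by
  refine Prod.ext ?_ (DFunLike.ext _ _ fun w => ?_)
  · simp only [Prod.fst_add, locBracket_fst, hσ.fst.mbDeriv_add hU hσ'.fst hy, map_add, add_apply]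
    abel
  · rw [Prod.snd_add, add_apply]
    simp only [locBracket_snd_apply, Prod.fst_add, Prod.snd_add,
      hσ.fst.mbDeriv_add hU hσ'.fst hy, hσ.snd.mbDeriv_add hU hσ'.snd hy, map_add, add_apply]
    ring

theorem locBracket_add_right (hU : IsOpen U) (hτ : SmoothOn τ U) (hτ' : SmoothOn τ' U)
    (hy : y ∈ U) :
    locBracket σ (fun z => τ z + τ' z) y = locBracket σ τ y + locBracket σ τ' y := by
  refine Prod.ext ?_ (DFunLike.ext _ _ fun w => ?_)
  · simp only [Prod.fst_add, locBracket_fst, hτ.fst.mbDeriv_add hU hτ'.fst hy, map_add, add_apply]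
    abel
  · rw [Prod.snd_add, add_apply]
    simp only [locBracket_snd_apply, Prod.fst_add, Prod.snd_add,
      hτ.snd.mbDeriv_add hU hτ'.snd hy, map_add, add_apply]
    ring

theorem locBracket_smul_left (hU : IsOpen U) (c : ℝ) (hσ : SmoothOn σ U)
    (hy : y ∈ U) : locBracket (fun z => c • σ z) τ y = c • locBracket σ τ y := by
  refine Prod.ext ?_ (DFunLike.ext _ _ fun w => ?_)
  · simp only [Prod.smul_fst, locBracket_fst, hσ.fst.mbDeriv_const_smul hU c hy, map_smul,
      smul_apply, smul_sub]
  · rw [Prod.smul_snd, smul_apply]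
    simp only [locBracket_snd_apply, Prod.smul_fst, Prod.smul_snd,
      hσ.fst.mbDeriv_const_smul hU c hy, hσ.snd.mbDeriv_const_smul hU c hy, map_smul, smul_apply,
      smul_eq_mul]
    ring

/-- The Leibniz rule for the local bracket. -/
theorem locBracket_fun_smul (hU : IsOpen U) {f : F → ℝ} (hf : SmoothOn f U) (hτ : SmoothOn τ U)
    (hy : y ∈ U) : locBracket σ (fun z => f z • τ z) y =
      f y • locBracket σ τ y + mbDeriv f y (σ y).1 • τ y := by
  refine Prod.ext ?_ (DFunLike.ext _ _ fun w => ?_)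
  · simp only [Prod.fst_add, Prod.smul_fst, locBracket_fst, hf.mbDeriv_smul hU hτ.fst hy, map_smul]
    module
  · rw [Prod.snd_add, Prod.smul_snd, Prod.smul_snd, add_apply, smul_apply, smul_apply]
    simp only [locBracket_snd_apply, Prod.smul_fst, Prod.smul_snd,
      hf.mbDeriv_smul hU hτ.snd hy, map_smul, smul_apply, add_apply, smul_eq_mul]
    ring

theorem mbDeriv_const (c : ℝ) (y : F) : mbDeriv (fun _ : F => c) y = 0 := by
  ext h
  refine HasDirDeriv.mbDeriv_eq_of_smoothOn (U := univ) ?_ (SmoothOn.const c) isOpen_univ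
    (mem_univ y)
  simp [HasDirDeriv]

theorem locBracket_smul_right (hU : IsOpen U) (c : ℝ) (hτ : SmoothOn τ U)
    (hy : y ∈ U) : locBracket σ (fun z => c • τ z) y = c • locBracket σ τ y := by
  have := locBracket_fun_smul (σ := σ) hU (SmoothOn.const c) hτ hy
  rw [this, mbDeriv_const]
  simp

theorem mbDeriv_locPairing (hU : IsOpen U) (hσ : SmoothOn σ U) (hτ : SmoothOn τ U)
    (hy : y ∈ U) (h : F) : mbDeriv (locPairing σ τ) y h =
      (mbDeriv (fun z => (σ z).2) y h (τ y).1 + (σ y).2 (mbDeriv (fun z => (τ z).1) y h)) +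
      (mbDeriv (fun z => (τ z).2) y h (σ y).1 + (τ y).2 (mbDeriv (fun z => (σ z).1) y h)) := by
  rw [← hσ.snd.mbDeriv_bdual_apply hU hτ.fst hy, ← hτ.snd.mbDeriv_bdual_apply hU hσ.fst hy,
    ← add_apply, ← SmoothOn.mbDeriv_add hU (hσ.snd.bdual_apply hτ.fst)
      (hτ.snd.bdual_apply hσ.fst) hy]
  rfl

theorem locBracket_add_swap (hU : IsOpen U) (hσ : SmoothOn σ U) (hτ : SmoothOn τ U)
    (hy : y ∈ U) : locBracket σ τ y + locBracket τ σ y =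
      (0, toBDual 𝓑 (mbDeriv (locPairing σ τ) y)) := by
  refine Prod.ext ?_ (DFunLike.ext _ _ fun w => ?_)
  · simp only [Prod.fst_add, locBracket_fst]
    abel
  · rw [Prod.snd_add, add_apply]
    simp only [locBracket_snd_apply, toBDual_apply, mbDeriv_locPairing hU hσ hτ hy]
    ring

theorem mbDeriv_locPairing_eq (hU : IsOpen U) (hτ : SmoothOn τ U)
    (hρ : SmoothOn ρ U) (hy : y ∈ U) : mbDeriv (locPairing τ ρ) y (σ y).1 =
      locPairing (locBracket σ τ) ρ y + locPairing τ (locBracket σ ρ) y := by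
  rw [mbDeriv_locPairing hU hτ hρ hy]
  simp only [locPairing, locBracket_snd_apply, locBracket_fst, map_sub]
  ring

theorem mbDeriv_locBracket_fst (hU : IsOpen U) (hσ : SmoothOn σ U) (hτ : SmoothOn τ U)
    (hy : y ∈ U) (h : F) : mbDeriv (fun z => (locBracket σ τ z).1) y h =
      (mbDeriv (fun z => mbDeriv (fun z => (τ z).1) z (σ y).1) y h +
        mbDeriv (fun z => (τ z).1) y (mbDeriv (fun z => (σ z).1) y h)) -
      (mbDeriv (fun z => mbDeriv (fun z => (σ z).1) z (τ y).1) y h +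
        mbDeriv (fun z => (σ z).1) y (mbDeriv (fun z => (τ z).1) y h)) :=
  ((HasDirDeriv.mbDeriv_apply hτ.fst hU hy (hσ.fst.hasDirDeriv hU hy h)).sub
    (HasDirDeriv.mbDeriv_apply hσ.fst hU hy
      (hτ.fst.hasDirDeriv hU hy h))).mbDeriv_eq_of_smoothOn (SmoothOn.locBracket hU hσ hτ).fst hU hy

/-- Evaluation at a fixed `w` is continuous and linear, so it commutes with the derivative. It
reduces the claim to product rules for real valued functions. -/
theorem mbDeriv_locBracket_snd (hU : IsOpen U) (hσ : SmoothOn σ U) (hτ : SmoothOn τ U)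
    (hy : y ∈ U) (h w : F) : mbDeriv (fun z => (locBracket σ τ z).2) y h w =
      (mbDeriv (fun z => mbDeriv (fun z => (τ z).2) z (σ y).1) y h w +
        mbDeriv (fun z => (τ z).2) y (mbDeriv (fun z => (σ z).1) y h) w) +
      (mbDeriv (fun z => (τ z).2) y h (mbDeriv (fun z => (σ z).1) y w) +
        (τ y).2 (mbDeriv (fun z => mbDeriv (fun z => (σ z).1) z w) y h)) -
      (mbDeriv (fun z => mbDeriv (fun z => (σ z).2) z (τ y).1) y h w +
        mbDeriv (fun z => (σ z).2) y (mbDeriv (fun z => (τ z).1) y h) w) +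
      (mbDeriv (fun z => mbDeriv (fun z => (σ z).2) z w) y h (τ y).1 +
        mbDeriv (fun z => (σ z).2) y w (mbDeriv (fun z => (τ z).1) y h)) := by
  have hs := (SmoothOn.locBracket hU hσ hτ).snd
  have e := hs.mbDeriv_clm_comp hU (evalBDual 𝓑 w) hy h
  rw [evalBDual_apply] at e
  rw [← e]
  have t1 := (HasDirDeriv.mbDeriv_apply hτ.snd hU hy (hσ.fst.hasDirDeriv hU hy h)).clm_comp
    (evalBDual 𝓑 w)
  have t3 := (HasDirDeriv.mbDeriv_apply hσ.snd hU hy (hτ.fst.hasDirDeriv hU hy h)).clm_comp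
    (evalBDual 𝓑 w)
  have t2 := (hτ.snd.hasDirDeriv hU hy h).bdual_apply
    ((hσ.fst.mbDeriv_apply hU (SmoothOn.const w)).hasDirDeriv hU hy h)
  have t4 := ((hσ.snd.mbDeriv_apply hU (SmoothOn.const w)).hasDirDeriv hU hy h).bdual_apply
    (hτ.fst.hasDirDeriv hU hy h)
  have hs1 := hs.clm_comp (evalBDual 𝓑 w)
  exact HasDirDeriv.mbDeriv_eq_of_smoothOn (((t1.add t2).sub t3).add t4) hs1 hU hy

/-- The Leibniz identity for the local bracket. -/
theorem locBracket_leibniz (hU : IsOpen U) (hσ : SmoothOn σ U) (hτ : SmoothOn τ U)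
    (hρ : SmoothOn ρ U) (hy : y ∈ U) :
    locBracket σ (locBracket τ ρ) y =
      locBracket (locBracket σ τ) ρ y + locBracket τ (locBracket σ ρ) y := by
  refine Prod.ext ?_ (DFunLike.ext _ _ fun w => ?_)
  · rw [Prod.fst_add]
    rw [locBracket_fst σ (locBracket τ ρ), locBracket_fst (locBracket σ τ) ρ,
      locBracket_fst τ (locBracket σ ρ)]
    simp only [mbDeriv_locBracket_fst hU hσ hτ hy,
      mbDeriv_locBracket_fst hU hτ hρ hy, mbDeriv_locBracket_fst hU hσ hρ hy]
    simp only [locBracket_fst, map_sub]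
    -- First derivative terms match by themselves; second derivatives are brought to a common order
    -- of arguments so that they cancel.
    rw [hσ.fst.mbDeriv_symmetric hU hy (ρ y).1 (τ y).1,
      hτ.fst.mbDeriv_symmetric hU hy (σ y).1 (ρ y).1,
      hρ.fst.mbDeriv_symmetric hU hy (τ y).1 (σ y).1]
    abel
  · rw [Prod.snd_add, add_apply]
    rw [locBracket_snd_apply σ (locBracket τ ρ), locBracket_snd_apply (locBracket σ τ) ρ,
      locBracket_snd_apply τ (locBracket σ ρ)]
    simp only [mbDeriv_locBracket_fst hU hσ hτ hy, mbDeriv_locBracket_snd hU hσ hτ hy,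
      mbDeriv_locBracket_snd hU hτ hρ hy, mbDeriv_locBracket_snd hU hσ hρ hy]
    simp only [locBracket_snd_apply, locBracket_fst, map_sub, map_add, sub_apply]
    -- Second derivatives of the fields and of the forms occur here, some with `w` as a direction;
    -- symmetry normalizes all of them.
    rw [hσ.fst.mbDeriv_symmetric hU hy w (τ y).1, hσ.fst.mbDeriv_symmetric hU hy w (ρ y).1, hτ.fst.mbDeriv_symmetric hU hy w (σ y).1,
      hρ.snd.mbDeriv_symmetric hU hy (σ y).1 (τ y).1,
      hτ.snd.mbDeriv_symmetric hU hy (σ y).1 (ρ y).1,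
      hτ.snd.mbDeriv_symmetric hU hy (σ y).1 w,
      hσ.snd.mbDeriv_symmetric hU hy (ρ y).1 (τ y).1,
      hσ.snd.mbDeriv_symmetric hU hy (ρ y).1 w,
      hσ.snd.mbDeriv_symmetric hU hy (τ y).1 w]
    ring

end LocalBracket

/-! ### Invariance of the local bracket under changes of coordinates. -/

section ChangeOfCoordinates

variable {F : Type*} [AddCommGroup F] [Module ℝ F] [TopologicalSpace F] [FrechetSpace F]
  {𝓑 : FrechetBornology F} {U U' : Set F} {φ : F → F} {σ τ σ' τ' : F → F × BDual 𝓑} {y : F}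

/-- The local section `σ'` is the push-forward of `σ` along the change of coordinates `φ`. -/
def IsPushforwardOn (φ : F → F) (U : Set F) (σ σ' : F → F × BDual 𝓑) : Prop :=
  ∀ y ∈ U, (σ' (φ y)).1 = mbDeriv φ y (σ y).1 ∧
    ∀ w, (σ y).2 w = (σ' (φ y)).2 (mbDeriv φ y w)

/-- Differentiate the relation `X'(φ(y)) = Dφ(y)(X(y))`. -/
theorem IsPushforwardOn.mbDeriv_fst (h : IsPushforwardOn φ U σ σ') (hU : IsOpen U)
    (hU' : IsOpen U') (hφ : SmoothOn φ U) (hm : MapsTo φ U U') (hσ : SmoothOn σ U)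
    (hσ' : SmoothOn σ' U') (hy : y ∈ U) (v : F) :
    mbDeriv (fun z => (σ' z).1) (φ y) (mbDeriv φ y v) =
      mbDeriv (fun z => mbDeriv φ z (σ y).1) y v +
        mbDeriv φ y (mbDeriv (fun z => (σ z).1) y v) := by
  rw [← hσ'.fst.mbDeriv_comp hU' hφ hU hy (hm hy)]
  refine HasDirDeriv.mbDeriv_eq_of_smoothOn ?_ (hσ'.fst.comp hφ hU' hm) hU hy
  refine (HasDirDeriv.mbDeriv_apply hφ hU hy
    (hσ.fst.hasDirDeriv hU hy v)).congr_of_eventuallyEq ?_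
  filter_upwards [hU.mem_nhds hy] with z hz using (h z hz).1.symm

/-- Differentiate `α(y)(w) = α'(φ(y))(Dφ(y)(w))` for fixed `w`. -/
theorem IsPushforwardOn.mbDeriv_snd (h : IsPushforwardOn φ U σ σ') (hU : IsOpen U)
    (hU' : IsOpen U') (hφ : SmoothOn φ U) (hm : MapsTo φ U U') (hσ : SmoothOn σ U)
    (hσ' : SmoothOn σ' U') (hy : y ∈ U) (v w : F) :
    mbDeriv (fun z => (σ z).2) y v w =
      mbDeriv (fun z => (σ' z).2) (φ y) (mbDeriv φ y v) (mbDeriv φ y w) +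
        (σ' (φ y)).2 (mbDeriv (fun z => mbDeriv φ z w) y v) := by
  have e := hσ.snd.mbDeriv_clm_comp hU (evalBDual 𝓑 w) hy v
  rw [evalBDual_apply] at e
  rw [← e]
  refine HasDirDeriv.mbDeriv_eq_of_smoothOn ?_ (hσ.snd.clm_comp (evalBDual 𝓑 w)) hU hy
  have h1 := (hφ.hasDirDeriv hU hy v).comp_smoothOn hσ'.snd hU' (hm hy)
  have h2 := (hφ.mbDeriv_apply hU (SmoothOn.const w)).hasDirDeriv hU hy v
  refine (h1.bdual_apply h2).congr_of_eventuallyEq ?_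
  filter_upwards [hU.mem_nhds hy] with z hz using ((h z hz).2 w).symm

/-- The local bracket is invariant under changes of coordinates. -/
theorem IsPushforwardOn.locBracket (h : IsPushforwardOn φ U σ σ')
    (h' : IsPushforwardOn φ U τ τ') (hU : IsOpen U)
    (hU' : IsOpen U') (hφ : SmoothOn φ U) (hm : MapsTo φ U U') (hσ : SmoothOn σ U)
    (hσ' : SmoothOn σ' U') (hτ : SmoothOn τ U) (hτ' : SmoothOn τ' U') :
    IsPushforwardOn φ U (locBracket σ τ) (locBracket σ' τ') := by
  intro y hy
  have e1 := h.mbDeriv_fst hU hU' hφ hm hσ hσ' hy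
  have e1' := h'.mbDeriv_fst hU hU' hφ hm hτ hτ' hy
  have e2 := h.mbDeriv_snd hU hU' hφ hm hσ hσ' hy
  have e2' := h'.mbDeriv_snd hU hU' hφ hm hτ hτ' hy
  refine ⟨?_, fun w => ?_⟩
  · rw [locBracket_fst, locBracket_fst, (h y hy).1, (h' y hy).1, e1, e1', map_sub,
      hφ.mbDeriv_symmetric hU hy (σ y).1 (τ y).1]
    abel
  -- The terms with a second derivative of `φ` occur in pairs of opposite sign, up to the order of
  -- the two directions.
  · rw [locBracket_snd_apply, locBracket_snd_apply, e2, e2, e2', (h' y hy).2, (h y hy).1,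
      (h' y hy).1, e1, map_add, hφ.mbDeriv_symmetric hU hy w (τ y).1,
      hφ.mbDeriv_symmetric hU hy w (σ y).1]
    ring

end ChangeOfCoordinates

/-! ### Charts, transition functions and the vector bundle `TM ⊕ TM'_𝓑`. -/

section Charts

variable {F M : Type*} [AddCommGroup F] [Module ℝ F] [TopologicalSpace F] [FrechetSpace F]
  [TopologicalSpace M] [ChartedSpace F M]

/-- The derivative of the change of charts from `e` to `e'`. -/
def transDeriv (e e' : OpenPartialHomeomorph M F) (x : M) : F →L[ℝ] F :=
  mbDeriv (e' ∘ e.symm) (e x)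

theorem isOpen_overlap {U : Set M} (e : OpenPartialHomeomorph M F) (hU : IsOpen U) :
    IsOpen (e.target ∩ e.symm ⁻¹' U) := e.isOpen_inter_preimage_symm hU

theorem msmoothOn_of_chart [FrechetManifold F M] {W : Type*} [AddCommGroup W] [Module ℝ W]
    [TopologicalSpace W] [IsTopologicalAddGroup W] [ContinuousSMul ℝ W] [LocallyConvexSpace ℝ W]
    {f : M → W} {U : Set M} (hU : IsOpen U) {e : OpenPartialHomeomorph M F} (he : e ∈ atlas F M)
    (hUe : U ⊆ e.source) (hf : SmoothOn (f ∘ e.symm) (e.target ∩ e.symm ⁻¹' U)) :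
    MSmoothOn F f U := by
  intro c hc
  have h1 := (FrechetManifold.smooth_transition c hc e he).mono
    (inter_subset_inter_right c.target (preimage_mono hUe))
  have hm : MapsTo (e ∘ c.symm) (c.target ∩ c.symm ⁻¹' U) (e.target ∩ e.symm ⁻¹' U) := by
    intro y hy
    refine ⟨e.map_source (hUe hy.2), ?_⟩
    change e.symm (e (c.symm y)) ∈ U
    rw [e.left_inv (hUe hy.2)]
    exact hy.2
  refine (hf.comp h1 (isOpen_overlap e hU) hm).congr (isOpen_overlap c hU) fun y hy => ?_
  simp only [Function.comp_apply, e.left_inv (hUe hy.2)]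

theorem MSmoothOn.of_local {W : Type*} [AddCommGroup W] [Module ℝ W]
    [TopologicalSpace W] [IsTopologicalAddGroup W] [ContinuousSMul ℝ W] [LocallyConvexSpace ℝ W]
    [T2Space W] {f : M → W} {U : Set M} (hU : IsOpen U)
    (h : ∀ x ∈ U, ∃ V, IsOpen V ∧ x ∈ V ∧ MSmoothOn F f V) : MSmoothOn F f U := by
  intro c hc
  refine SmoothOn.of_local (isOpen_overlap c hU) fun y hy => ?_
  obtain ⟨V, hV, hxV, hf⟩ := h (c.symm y) hy.2
  exact ⟨_, isOpen_overlap c hV, ⟨hy.1, hxV⟩, hf c hc⟩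

theorem MSmoothOn.mono {W : Type*} [AddCommGroup W] [Module ℝ W]
    [TopologicalSpace W] {f : M → W} {U V : Set M} (hf : MSmoothOn F f U) (h : V ⊆ U) :
    MSmoothOn F f V :=
  fun c hc => (hf c hc).mono (inter_subset_inter_right _ (preimage_mono h))

theorem MSmoothOn.congr {W : Type*} [AddCommGroup W] [Module ℝ W]
    [TopologicalSpace W] {f g : M → W} {U : Set M} (hf : MSmoothOn F f U) (hU : IsOpen U)
    (h : EqOn g f U) : MSmoothOn F g U :=
  fun c hc => (hf c hc).congr (isOpen_overlap c hU) fun _ hy => h hy.2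

theorem MSmoothOn.clm_comp {W W' : Type*} [AddCommGroup W] [Module ℝ W]
    [TopologicalSpace W] [AddCommGroup W'] [Module ℝ W']
    [TopologicalSpace W'] {f : M → W} {U : Set M} (hf : MSmoothOn F f U) (L : W →L[ℝ] W') :
    MSmoothOn F (fun x => L (f x)) U :=
  fun c hc => (hf c hc).clm_comp L

variable {e e' e'' : OpenPartialHomeomorph M F} {x : M} (𝓑 : FrechetBornology F)

/-- The transition function of the generalized tangent bundle. -/
def genChange (e e' : OpenPartialHomeomorph M F) (x : M) : F × BDual 𝓑 →L[ℝ] F × BDual 𝓑 :=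
  (transDeriv e e' x).prodMap (transposeL 𝓑 (transDeriv e' e x))

@[simp] theorem genChange_fst (p : F × BDual 𝓑) :
    (genChange 𝓑 e e' x p).1 = transDeriv e e' x p.1 := rfl

@[simp] theorem genChange_snd_apply (p : F × BDual 𝓑) (w : F) :
    (genChange 𝓑 e e' x p).2 w = p.2 (transDeriv e' e x w) := rfl

/-- Fibres are identified with the model through the preferred chart, so a trivialization is itself
a transition function and the cocycle rule covers both. -/
theorem genTriv_toLin (e : OpenPartialHomeomorph M F) (x : M) (p : GenTangentAt 𝓑 x) :
    (genTriv 𝓑 e).toLin x p = genChange 𝓑 (chartAt F x) e x p := rfl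

variable [FrechetManifold F M]

theorem transDeriv_self (hx : x ∈ e.source) : transDeriv e e x = ContinuousLinearMap.id ℝ F := by
  rw [transDeriv, ← mbDeriv_id (e x)]
  refine mbDeriv_congr ?_
  filter_upwards [e.open_target.mem_nhds (e.map_source hx)] with y hy
  exact e.right_inv hy

theorem transDeriv_trans (he : e ∈ atlas F M) (he' : e' ∈ atlas F M) (he'' : e'' ∈ atlas F M)
    (hx : x ∈ e.source) (hx' : x ∈ e'.source) (hx'' : x ∈ e''.source) (v : F) :
    transDeriv e' e'' x (transDeriv e e' x v) = transDeriv e e'' x v := by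
  have h1 := FrechetManifold.smooth_transition e he e' he'
  have h2 := FrechetManifold.smooth_transition e' he' e'' he''
  have m1 : e x ∈ e.target ∩ e.symm ⁻¹' e'.source :=
    ⟨e.map_source hx, by simpa [e.left_inv hx] using hx'⟩
  have m2 : (e' ∘ e.symm) (e x) ∈ e'.target ∩ e'.symm ⁻¹' e''.source := by
    simp [e.left_inv hx, e'.left_inv hx', hx', hx'']
  have := h2.mbDeriv_comp (isOpen_overlap e' e''.open_source) h1
    (isOpen_overlap e e'.open_source) m1 m2 v
  have e3 : e' x = (e' ∘ e.symm) (e x) := by simp [e.left_inv hx]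
  rw [transDeriv, transDeriv, transDeriv, e3, ← this]
  congr 1
  refine mbDeriv_congr ?_
  filter_upwards [(isOpen_overlap e e'.open_source).mem_nhds m1] with y hy
  simp [e'.left_inv hy.2]

/-- Joint smoothness of `(y, v) ↦ Dφ(y)(v)` becomes smoothness into `L(F, F)` by currying. -/
theorem msmoothOn_transDeriv (he : e ∈ atlas F M) (he' : e' ∈ atlas F M) :
    MSmoothOn F (transDeriv e e') (e.source ∩ e'.source) := by
  refine msmoothOn_of_chart (e.open_source.inter e'.open_source) he inter_subset_left ?_
  have h1 := FrechetManifold.smooth_transition e he e' he'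
  have ho := isOpen_overlap e e'.open_source
  have h2 : SmoothOn (fun y => mbDeriv (e' ∘ e.symm) y) (e.target ∩ e.symm ⁻¹' e'.source) :=
    SmoothOn.curry_clm ho (h1.smoothOn_mbDeriv ho)
  refine (h2.mono fun y hy => ⟨hy.1, hy.2.2⟩).congr
    (isOpen_overlap e (e.open_source.inter e'.open_source)) fun y hy => ?_
  simp [transDeriv, e.right_inv hy.1]

theorem genChange_self (hx : x ∈ e.source) (p : F × BDual 𝓑) : genChange 𝓑 e e x p = p := by
  refine Prod.ext ?_ (DFunLike.ext _ _ fun w => ?_)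
  · simp [transDeriv_self hx]
  · simp [transDeriv_self hx]

theorem genChange_trans (he : e ∈ atlas F M) (he' : e' ∈ atlas F M) (he'' : e'' ∈ atlas F M)
    (hx : x ∈ e.source) (hx' : x ∈ e'.source) (hx'' : x ∈ e''.source) (p : F × BDual 𝓑) :
    genChange 𝓑 e' e'' x (genChange 𝓑 e e' x p) = genChange 𝓑 e e'' x p := by
  refine Prod.ext ?_ (DFunLike.ext _ _ fun w => ?_)
  · simp [transDeriv_trans he he' he'' hx hx' hx'']
  · simp [transDeriv_trans he'' he' he hx'' hx' hx]

theorem genChange_genTriv (he : e ∈ atlas F M) (he' : e' ∈ atlas F M)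
    (hx : x ∈ e.source) (hx' : x ∈ e'.source) (p : GenTangentAt 𝓑 x) :
    genChange 𝓑 e e' x ((genTriv 𝓑 e).toLin x p) = (genTriv 𝓑 e').toLin x p :=
  genChange_trans 𝓑 (chart_mem_atlas F x) he he' (mem_chart_source F x) hx hx' p

theorem genTriv_chartAt (x : M) (p : GenTangentAt 𝓑 x) :
    (genTriv 𝓑 (chartAt F x)).toLin x p = p :=
  genChange_self 𝓑 (mem_chart_source F x) p

theorem msmoothOn_genChange (he : e ∈ atlas F M) (he' : e' ∈ atlas F M) :
    MSmoothOn F (genChange 𝓑 e e') (e.source ∩ e'.source) := by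
  intro c hc
  have h1 := msmoothOn_transDeriv he he' c hc
  have h2 := ((msmoothOn_transDeriv he' he).clm_comp (transposeL 𝓑)) c hc
  rw [inter_comm e'.source] at h2
  -- The transition function is block diagonal: a sum of two terms, each depending on its block
  -- through continuous linear operations.
  have h3 := (h1.clm_comp (ContinuousLinearMap.precomp F
    (ContinuousLinearMap.fst ℝ F (BDual 𝓑)))).clm_comp
    (ContinuousLinearMap.postcomp (F × BDual 𝓑) (ContinuousLinearMap.inl ℝ F (BDual 𝓑)))
  have h4 := (h2.clm_comp (ContinuousLinearMap.precomp (BDual 𝓑)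
    (ContinuousLinearMap.snd ℝ F (BDual 𝓑)))).clm_comp
    (ContinuousLinearMap.postcomp (F × BDual 𝓑) (ContinuousLinearMap.inr ℝ F (BDual 𝓑)))
  refine (h3.add h4).congr (isOpen_overlap c (e.open_source.inter e'.open_source)) fun y _ => ?_
  refine ContinuousLinearMap.ext fun p => ?_
  refine Prod.ext ?_ ?_
  · simp [genChange]
  · simp [genChange]

variable (M) in
theorem isVectorBundle_genAtlas : IsVectorBundle F (genAtlas 𝓑 M) where
  locallyConvex := inferInstance
  hausdorff := inferInstance
  isOpen_base := by
    rintro _ ⟨e, _, rfl⟩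
    exact e.open_source
  cover x := ⟨_, mem_image_of_mem _ (chart_mem_atlas F x), mem_chart_source F x⟩
  equiv := by
    rintro _ ⟨e, he, rfl⟩ x hx
    have hx' : x ∈ e.source := hx
    refine ⟨ContinuousLinearEquiv.equivOfInverse (genChange 𝓑 (chartAt F x) e x)
      (genChange 𝓑 e (chartAt F x) x) (fun p => ?_) (fun p => ?_), fun v => rfl⟩
    · rw [genChange_trans 𝓑 (chart_mem_atlas F x) he (chart_mem_atlas F x) (mem_chart_source F x)
        hx' (mem_chart_source F x), genChange_self 𝓑 (mem_chart_source F x)]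
    · rw [genChange_trans 𝓑 he (chart_mem_atlas F x) he hx' (mem_chart_source F x) hx',
        genChange_self 𝓑 hx']
  transition := by
    rintro _ ⟨e, he, rfl⟩ _ ⟨e', he', rfl⟩
    exact ⟨genChange 𝓑 e e', msmoothOn_genChange 𝓑 he he',
      fun x hx v => (genChange_genTriv 𝓑 he he' hx.1 hx.2 v).symm⟩

end Charts

/-! ### The brackets on smooth sections, read in charts. -/

section BracketInCharts

variable {F M : Type*} [AddCommGroup F] [Module ℝ F] [TopologicalSpace F] [FrechetSpace F]
  [TopologicalSpace M] [ChartedSpace F M] (𝓑 : FrechetBornology F)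

/-- The local representative of a section of the generalized tangent bundle. -/
def locSection (e : OpenPartialHomeomorph M F) (s : ∀ x : M, GenTangentAt 𝓑 x) (y : F) :
    F × BDual 𝓑 :=
  (genTriv 𝓑 e).toLin (e.symm y) (s (e.symm y))

variable [FrechetManifold F M] {e e' : OpenPartialHomeomorph M F} {x : M} {y : F}
  {s s' : ∀ x : M, GenTangentAt 𝓑 x}

theorem mem_sections_genAtlas : s ∈ Sections F (genAtlas 𝓑 M) ↔
    ∀ e ∈ atlas F M, SmoothOn (locSection 𝓑 e s) e.target := by
  have hset : ∀ e : OpenPartialHomeomorph M F, e.target ∩ e.symm ⁻¹' e.source = e.target :=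
    fun e => inter_eq_left.2 fun y hy => e.map_target hy
  constructor
  · intro h e he
    have := h _ (mem_image_of_mem _ he) e he
    have h2 : SmoothOn (locSection 𝓑 e s) (e.target ∩ e.symm ⁻¹' e.source) := this
    rwa [hset] at h2
  · rintro h _ ⟨e, he, rfl⟩
    refine msmoothOn_of_chart (U := e.source) e.open_source he subset_rfl ?_
    rw [hset]
    exact h e he

theorem locSection_apply (hx : x ∈ e.source) :
    locSection 𝓑 e s (e x) = (genTriv 𝓑 e).toLin x (s x) := by
  rw [locSection, e.left_inv hx]

theorem locSection_chartAt : locSection 𝓑 (chartAt F x) s (chartAt F x x) = s x := by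
  rw [locSection_apply 𝓑 (mem_chart_source F x), genTriv_chartAt]

theorem genPairing_apply (x : M) (p q : GenTangentAt 𝓑 x) :
    genPairing 𝓑 x p q = p.2 q.1 + q.2 p.1 := rfl

/-- The contraction of a form with a field is read off in every trivialization. -/
theorem genTriv_contract (he : e ∈ atlas F M) (hx : x ∈ e.source) (p q : GenTangentAt 𝓑 x) :
    ((genTriv 𝓑 e).toLin x p).2 ((genTriv 𝓑 e).toLin x q).1 = p.2 q.1 := by
  rw [genTriv_toLin, genTriv_toLin, genChange_snd_apply, genChange_fst,
    transDeriv_trans (chart_mem_atlas F x) he (chart_mem_atlas F x) (mem_chart_source F x)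
      hx (mem_chart_source F x), transDeriv_self (mem_chart_source F x)]
  rfl

theorem contract_comp_symm_eqOn (he : e ∈ atlas F M) :
    EqOn ((fun x => (s x).2 (s' x).1) ∘ e.symm)
      (fun y => (locSection 𝓑 e s y).2 (locSection 𝓑 e s' y).1) e.target :=
  fun _ hy => (genTriv_contract 𝓑 he (e.map_target hy) _ _).symm

theorem pairing_comp_symm_eqOn (he : e ∈ atlas F M) :
    EqOn ((fun x => genPairing 𝓑 x (s x) (s' x)) ∘ e.symm)
      (locPairing (locSection 𝓑 e s) (locSection 𝓑 e s')) e.target := fun _ hy =>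
  congrArg₂ (· + ·) (contract_comp_symm_eqOn 𝓑 he hy) (contract_comp_symm_eqOn 𝓑 he hy)

theorem mbDeriv_comp_symm_congr {f : M → ℝ} {g : F → ℝ} (h : EqOn (f ∘ e.symm) g e.target)
    (hy : y ∈ e.target) : mbDeriv (f ∘ e.symm) y = mbDeriv g y :=
  mbDeriv_congr (h.eventuallyEq_of_mem (e.open_target.mem_nhds hy))

theorem isPushforwardOn_locSection (he : e ∈ atlas F M) (he' : e' ∈ atlas F M) :
    IsPushforwardOn (e' ∘ e.symm) (e.target ∩ e.symm ⁻¹' e'.source) (locSection 𝓑 e s)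
      (locSection 𝓑 e' s) := by
  intro y hy
  have hx : e.symm y ∈ e.source := e.map_target hy.1
  have h1 : locSection 𝓑 e' s ((e' ∘ e.symm) y) =
      genChange 𝓑 e e' (e.symm y) (locSection 𝓑 e s y) := by
    rw [Function.comp_apply, locSection_apply 𝓑 hy.2, locSection,
      genChange_genTriv 𝓑 he he' hx hy.2]
  have h2 : mbDeriv (e' ∘ e.symm) y = transDeriv e e' (e.symm y) := by
    rw [transDeriv, e.right_inv hy.1]
  rw [h1, h2]
  refine ⟨rfl, fun w => ?_⟩
  rw [genChange_snd_apply, transDeriv_trans he he' he hx hy.2 hx, transDeriv_self hx]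
  rfl

theorem SmoothOn.of_msmoothOn_univ {f : M → ℝ} (hf : MSmoothOn F f univ) (he : e ∈ atlas F M) :
    SmoothOn (f ∘ e.symm) e.target := by
  have := hf e he
  rwa [preimage_univ, inter_univ] at this

theorem msmoothOn_univ_iff {f : M → ℝ} :
    MSmoothOn F f univ ↔ ∀ e ∈ atlas F M, SmoothOn (f ∘ e.symm) e.target := by
  simp only [MSmoothOn, preimage_univ, inter_univ]

theorem dForm_apply (f : M → ℝ) (x : M) (w : F) : dForm 𝓑 f x w = dFun F f x w := rfl

/-- The differential of a function, read in a chart. -/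
theorem dFun_eq {f : M → ℝ} (hf : MSmoothOn F f univ) (he : e ∈ atlas F M) (hx : x ∈ e.source)
    (v : F) : dFun F f x (transDeriv e (chartAt F x) x v) = mbDeriv (f ∘ e.symm) (e x) v := by
  set c := chartAt F x with hc
  have hcx := mem_chart_source F x
  have hca : c ∈ atlas F M := chart_mem_atlas F x
  have m1 : e x ∈ e.target ∩ e.symm ⁻¹' c.source :=
    ⟨e.map_source hx, by rwa [mem_preimage, e.left_inv hx]⟩
  have e3 : (c ∘ e.symm) (e x) = c x := by simp [e.left_inv hx]
  have m2 : (c ∘ e.symm) (e x) ∈ c.target := by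
    rw [e3]
    exact c.map_source hcx
  have := (SmoothOn.of_msmoothOn_univ hf hca).mbDeriv_comp c.open_target
    (FrechetManifold.smooth_transition e he c hca) (isOpen_overlap e c.open_source) m1 m2 v
  rw [e3] at this
  rw [dFun, transDeriv, ← hc, ← this]
  congr 1
  refine mbDeriv_congr ?_
  filter_upwards [(isOpen_overlap e c.open_source).mem_nhds m1] with y hy
  simp [c.left_inv hy.2]

theorem locSection_dForm {f : M → ℝ} (hf : MSmoothOn F f univ) (he : e ∈ atlas F M)
    (hy : y ∈ e.target) : locSection 𝓑 e (fun x => ((0 : F), dForm 𝓑 f x)) y =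
      (0, toBDual 𝓑 (mbDeriv (f ∘ e.symm) y)) := by
  refine Prod.ext (map_zero (transDeriv _ e (e.symm y))) (DFunLike.ext _ _ fun w => ?_)
  rw [locSection, genTriv_toLin, genChange_snd_apply, toBDual_apply, dForm_apply,
    dFun_eq hf he (e.map_target hy), e.right_inv hy]

theorem dForm_mem_sections {f : M → ℝ} (hf : MSmoothOn F f univ) :
    (fun x => ((0 : F), dForm 𝓑 f x)) ∈ Sections F (genAtlas 𝓑 M) := by
  refine (mem_sections_genAtlas 𝓑).2 fun e he => ?_
  refine SmoothOn.congr ?_ e.open_target fun y hy => locSection_dForm 𝓑 hf he hy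
  refine (SmoothOn.const 0).prodMk (SmoothOn.curry_bdual e.open_target ?_)
  exact (SmoothOn.of_msmoothOn_univ hf he).smoothOn_mbDeriv e.open_target

section Smooth

theorem msmoothOn_contract (hs : s ∈ Sections F (genAtlas 𝓑 M))
    (hs' : s' ∈ Sections F (genAtlas 𝓑 M)) : MSmoothOn F (fun x => (s x).2 (s' x).1) univ := by
  refine msmoothOn_univ_iff.2 fun e he => ?_
  exact (((mem_sections_genAtlas 𝓑).1 hs e he).snd.bdual_apply
    ((mem_sections_genAtlas 𝓑).1 hs' e he).fst).congr e.open_target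
    (contract_comp_symm_eqOn 𝓑 he)

theorem msmoothOn_pairing (hs : s ∈ Sections F (genAtlas 𝓑 M))
    (hs' : s' ∈ Sections F (genAtlas 𝓑 M)) :
    MSmoothOn F (fun x => genPairing 𝓑 x (s x) (s' x)) univ := by
  refine msmoothOn_univ_iff.2 fun e he => ?_
  exact (SmoothOn.locPairing ((mem_sections_genAtlas 𝓑).1 hs e he)
    ((mem_sections_genAtlas 𝓑).1 hs' e he)).congr e.open_target (pairing_comp_symm_eqOn 𝓑 he)

/-- By the product rule `d(β(X))(w) = Dβ(w)(X) + β(DX(w))`, and the first term cancels against the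
one in `ι_X dβ`. -/
theorem dorfmanBracket_eq_locBracket (hs : s ∈ Sections F (genAtlas 𝓑 M))
    (hs' : s' ∈ Sections F (genAtlas 𝓑 M)) (x : M) :
    dorfmanBracket 𝓑 s s' x = locBracket (locSection 𝓑 (chartAt F x) s)
      (locSection 𝓑 (chartAt F x) s') (chartAt F x x) := by
  have hca := chart_mem_atlas F x
  have hy := mem_chart_target F x
  refine Prod.ext ?_ (DFunLike.ext _ _ fun w => ?_)
  · rw [locBracket_fst, locSection_chartAt, locSection_chartAt]
    rfl
  · rw [locBracket_snd_apply, locSection_chartAt, locSection_chartAt]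
    have h1 : (dorfmanBracket 𝓑 s s' x).2 w =
        (mbDeriv ((fun x => (s' x).2 (s x).1) ∘ (chartAt F x).symm) (chartAt F x x) w +
        (mbDeriv (fun z => (locSection 𝓑 (chartAt F x) s' z).2) (chartAt F x x) (s x).1 w -
          mbDeriv (fun z => (locSection 𝓑 (chartAt F x) s' z).2) (chartAt F x x) w (s x).1)) -
        (mbDeriv (fun z => (locSection 𝓑 (chartAt F x) s z).2) (chartAt F x x) (s' x).1 w -
          mbDeriv (fun z => (locSection 𝓑 (chartAt F x) s z).2) (chartAt F x x) w (s' x).1) := rfl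
    rw [h1, mbDeriv_comp_symm_congr (contract_comp_symm_eqOn 𝓑 hca) hy,
      ((mem_sections_genAtlas 𝓑).1 hs' _ hca).snd.mbDeriv_bdual_apply (chartAt F x).open_target
      ((mem_sections_genAtlas 𝓑).1 hs _ hca).fst hy, locSection_chartAt, locSection_chartAt]
    ring

/-- The bracket is given by the local formula in every chart. -/
theorem locSection_dorfmanBracket (hs : s ∈ Sections F (genAtlas 𝓑 M))
    (hs' : s' ∈ Sections F (genAtlas 𝓑 M)) (he : e ∈ atlas F M) (hy : y ∈ e.target) :
    locSection 𝓑 e (dorfmanBracket 𝓑 s s') y =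
      locBracket (locSection 𝓑 e s) (locSection 𝓑 e s') y := by
  have hx : e.symm y ∈ e.source := e.map_target hy
  have hcx := mem_chart_source F (e.symm y)
  have hca := chart_mem_atlas F (e.symm y)
  rw [locSection, dorfmanBracket_eq_locBracket 𝓑 hs hs', genTriv_toLin]
  -- The bracket at a point is defined in the preferred chart `c` of that point; invariance of the
  -- local bracket carries the formula over to `e`.
  set c := chartAt F (e.symm y) with hc
  have h1 := (mem_sections_genAtlas 𝓑).1 hs
  have h2 := (mem_sections_genAtlas 𝓑).1 hs'
  have hm : MapsTo (c ∘ e.symm) (e.target ∩ e.symm ⁻¹' c.source) c.target :=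
    fun z hz => c.map_source hz.2
  have key := (isPushforwardOn_locSection 𝓑 (s := s) he hca).locBracket
    (isPushforwardOn_locSection 𝓑 (s := s') he hca) (isOpen_overlap e c.open_source)
    c.open_target (FrechetManifold.smooth_transition e he c hca) hm
    ((h1 e he).mono inter_subset_left) (h1 c hca) ((h2 e he).mono inter_subset_left) (h2 c hca)
    y ⟨hy, hcx⟩
  have h3 : mbDeriv (c ∘ e.symm) y = transDeriv e c (e.symm y) := by
    rw [transDeriv, e.right_inv hy]
  rw [h3] at key
  refine Prod.ext ?_ (DFunLike.ext _ _ fun w => ?_)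
  · rw [genChange_fst]
    have k1 := key.1
    rw [Function.comp_apply] at k1
    rw [k1, transDeriv_trans he hca he hx hcx hx, transDeriv_self hx]
    rfl
  · rw [genChange_snd_apply, key.2]
    rfl

theorem dorfmanBracket_mem (hs : s ∈ Sections F (genAtlas 𝓑 M))
    (hs' : s' ∈ Sections F (genAtlas 𝓑 M)) :
    dorfmanBracket 𝓑 s s' ∈ Sections F (genAtlas 𝓑 M) :=
  (mem_sections_genAtlas 𝓑).2 fun e he =>
    (SmoothOn.locBracket e.open_target ((mem_sections_genAtlas 𝓑).1 hs e he)
      ((mem_sections_genAtlas 𝓑).1 hs' e he)).congr e.open_target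
      fun _ hy => locSection_dorfmanBracket 𝓑 hs hs' he hy

theorem dFun_add {f g : M → ℝ} (hf : MSmoothOn F f univ) (hg : MSmoothOn F g univ) (x : M) :
    dFun F (fun y => f y + g y) x = dFun F f x + dFun F g x :=
  SmoothOn.mbDeriv_add (chartAt F x).open_target
    (SmoothOn.of_msmoothOn_univ hf (chart_mem_atlas F x))
    (SmoothOn.of_msmoothOn_univ hg (chart_mem_atlas F x)) (mem_chart_target F x)

theorem dFun_neg {f : M → ℝ} (hf : MSmoothOn F f univ) (x : M) :
    dFun F (fun y => - f y) x = - dFun F f x := by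
  have := SmoothOn.mbDeriv_const_smul (chartAt F x).open_target (-1)
    (SmoothOn.of_msmoothOn_univ hf (chart_mem_atlas F x)) (mem_chart_target F x)
  have e : (fun y => - f y) ∘ (chartAt F x).symm =
      fun z => (-1 : ℝ) • (f ∘ (chartAt F x).symm) z := by
    funext z
    simp
  rw [dFun, e, this]
  ext v
  simp [dFun]

/-- The two brackets differ by half the differential of the pairing. -/
theorem courantBracket_eq (hs : s ∈ Sections F (genAtlas 𝓑 M))
    (hs' : s' ∈ Sections F (genAtlas 𝓑 M)) (x : M) :
    courantBracket 𝓑 s s' x = dorfmanBracket 𝓑 s s' x -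
      (1 / 2 : ℝ) • ((0 : F), dForm 𝓑 (fun y => genPairing 𝓑 y (s y) (s' y)) x) := by
  have h1 := msmoothOn_contract 𝓑 hs hs'
  have h2 := msmoothOn_contract 𝓑 hs' hs
  have h2' : MSmoothOn F (fun x => - (s' x).2 (s x).1) univ := by
    have := h2.clm_comp (-ContinuousLinearMap.id ℝ ℝ)
    simpa using this
  refine Prod.ext ?_ (DFunLike.ext _ _ fun w => ?_)
  · rw [Prod.fst_sub, Prod.smul_fst, smul_zero, sub_zero]
    rfl
  · have e1 : (courantBracket 𝓑 s s' x).2 w =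
        lieDerivForm 𝓑 (fun y => (s y).1) (fun y => (s' y).2) x w -
        (dFun F (fun y => (s y).2 (s' y).1) x w +
          contractExtDeriv 𝓑 (fun y => (s y).2) x (s' x).1 w) +
        (1 / 2 : ℝ) * dFun F (fun y => (s y).2 (s' y).1 - (s' y).2 (s y).1) x w := rfl
    have e2 : (dorfmanBracket 𝓑 s s' x - (1 / 2 : ℝ) • ((0 : F),
        dForm 𝓑 (fun y => genPairing 𝓑 y (s y) (s' y)) x)).2 w =
        lieDerivForm 𝓑 (fun y => (s y).1) (fun y => (s' y).2) x w -
          contractExtDeriv 𝓑 (fun y => (s y).2) x (s' x).1 w -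
        (1 / 2 : ℝ) * dFun F (fun y => (s y).2 (s' y).1 + (s' y).2 (s y).1) x w := rfl
    -- As `L_Y α = d(α(Y)) + ι_Y dα`, the claim reduces to `-d(α(Y)) + ½ d(α(Y) - β(X)) = -½ d(α(Y)
    -- + β(X))`.
    rw [e1, e2]
    simp only [sub_eq_add_neg ((s _).2 _)]
    rw [dFun_add h1 h2', dFun_neg h2, dFun_add h1 h2, add_apply, add_apply, neg_apply]
    ring

theorem courantBracket_mem (hs : s ∈ Sections F (genAtlas 𝓑 M))
    (hs' : s' ∈ Sections F (genAtlas 𝓑 M)) :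
    courantBracket 𝓑 s s' ∈ Sections F (genAtlas 𝓑 M) := by
  have e : courantBracket 𝓑 s s' = dorfmanBracket 𝓑 s s' -
      (1 / 2 : ℝ) • (fun x => ((0 : F), dForm 𝓑 (fun y => genPairing 𝓑 y (s y) (s' y)) x)) :=
    funext fun x => courantBracket_eq 𝓑 hs hs' x
  rw [e]
  exact Submodule.sub_mem _ (dorfmanBracket_mem 𝓑 hs hs')
    (Submodule.smul_mem _ _ (dForm_mem_sections 𝓑 (msmoothOn_pairing 𝓑 hs hs')))

end Smooth

end BracketInCharts

/-! ### The Courant algebroid structure on the generalized tangent bundle. -/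

section Courant

variable {F M : Type*} [AddCommGroup F] [Module ℝ F] [TopologicalSpace F] [FrechetSpace F]
  [TopologicalSpace M] [ChartedSpace F M] [FrechetManifold F M] (𝓑 : FrechetBornology F)

theorem dorfmanBracket_add_left {s s' t : ∀ x : M, GenTangentAt 𝓑 x}
    (hs : s ∈ Sections F (genAtlas 𝓑 M)) (hs' : s' ∈ Sections F (genAtlas 𝓑 M))
    (ht : t ∈ Sections F (genAtlas 𝓑 M)) (x : M) :
    dorfmanBracket 𝓑 (s + s') t x = dorfmanBracket 𝓑 s t x + dorfmanBracket 𝓑 s' t x := by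
  have hca := chart_mem_atlas F x
  rw [dorfmanBracket_eq_locBracket 𝓑 (Submodule.add_mem _ hs hs') ht,
    dorfmanBracket_eq_locBracket 𝓑 hs ht, dorfmanBracket_eq_locBracket 𝓑 hs' ht,
    ← locBracket_add_left (chartAt F x).open_target ((mem_sections_genAtlas 𝓑).1 hs _ hca)
      ((mem_sections_genAtlas 𝓑).1 hs' _ hca) (mem_chart_target F x)]
  exact congrArg (locBracket · _ _) (funext fun z => map_add _ _ _)

theorem dorfmanBracket_add_right {s s' t : ∀ x : M, GenTangentAt 𝓑 x}
    (hs : s ∈ Sections F (genAtlas 𝓑 M)) (hs' : s' ∈ Sections F (genAtlas 𝓑 M))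
    (ht : t ∈ Sections F (genAtlas 𝓑 M)) (x : M) :
    dorfmanBracket 𝓑 t (s + s') x = dorfmanBracket 𝓑 t s x + dorfmanBracket 𝓑 t s' x := by
  have hca := chart_mem_atlas F x
  rw [dorfmanBracket_eq_locBracket 𝓑 ht (Submodule.add_mem _ hs hs'),
    dorfmanBracket_eq_locBracket 𝓑 ht hs, dorfmanBracket_eq_locBracket 𝓑 ht hs',
    ← locBracket_add_right (chartAt F x).open_target ((mem_sections_genAtlas 𝓑).1 hs _ hca)
      ((mem_sections_genAtlas 𝓑).1 hs' _ hca) (mem_chart_target F x)]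
  exact congrArg (locBracket _ · _) (funext fun z => map_add _ _ _)

theorem dorfmanBracket_smul_left {s t : ∀ x : M, GenTangentAt 𝓑 x} (c : ℝ)
    (hs : s ∈ Sections F (genAtlas 𝓑 M))
    (ht : t ∈ Sections F (genAtlas 𝓑 M)) (x : M) :
    dorfmanBracket 𝓑 (c • s) t x = c • dorfmanBracket 𝓑 s t x := by
  have hca := chart_mem_atlas F x
  rw [dorfmanBracket_eq_locBracket 𝓑 (Submodule.smul_mem _ c hs) ht,
    dorfmanBracket_eq_locBracket 𝓑 hs ht,
    ← locBracket_smul_left (chartAt F x).open_target c ((mem_sections_genAtlas 𝓑).1 hs _ hca)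
      (mem_chart_target F x)]
  exact congrArg (locBracket · _ _) (funext fun z =>
    ((genTriv 𝓑 (chartAt F x)).toLin ((chartAt F x).symm z)).map_smul c _)

/-- The Leibniz rule for multiplication by functions. -/
theorem dorfmanBracket_fun_smul {s t : ∀ x : M, GenTangentAt 𝓑 x} {f : M → ℝ}
    (hf : MSmoothOn F f univ) (hs : s ∈ Sections F (genAtlas 𝓑 M))
    (ht : t ∈ Sections F (genAtlas 𝓑 M))
    (hft : (fun x => f x • t x) ∈ Sections F (genAtlas 𝓑 M)) (x : M) :
    dorfmanBracket 𝓑 s (fun x => f x • t x) x =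
      f x • dorfmanBracket 𝓑 s t x + dFun F f x (s x).1 • t x := by
  have hca := chart_mem_atlas F x
  have key := locBracket_fun_smul (σ := locSection 𝓑 (chartAt F x) s) (chartAt F x).open_target
    (SmoothOn.of_msmoothOn_univ hf hca) ((mem_sections_genAtlas 𝓑).1 ht _ hca)
    (mem_chart_target F x)
  rw [locSection_chartAt, locSection_chartAt, Function.comp_apply,
    (chartAt F x).left_inv (mem_chart_source F x)] at key
  rw [dorfmanBracket_eq_locBracket 𝓑 hs hft, dorfmanBracket_eq_locBracket 𝓑 hs ht]
  refine Eq.trans ?_ key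
  exact congrArg (locBracket _ · _) (funext fun z => map_smul _ _ _)

theorem dorfmanBracket_smul_right {s t : ∀ x : M, GenTangentAt 𝓑 x} (c : ℝ)
    (hs : s ∈ Sections F (genAtlas 𝓑 M))
    (ht : t ∈ Sections F (genAtlas 𝓑 M)) (x : M) :
    dorfmanBracket 𝓑 t (c • s) x = c • dorfmanBracket 𝓑 t s x := by
  have hca := chart_mem_atlas F x
  rw [dorfmanBracket_eq_locBracket 𝓑 ht (Submodule.smul_mem _ c hs),
    dorfmanBracket_eq_locBracket 𝓑 ht hs,
    ← locBracket_smul_right (chartAt F x).open_target c ((mem_sections_genAtlas 𝓑).1 hs _ hca)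
      (mem_chart_target F x)]
  exact congrArg (locBracket _ · _) (funext fun z =>
    ((genTriv 𝓑 (chartAt F x)).toLin ((chartAt F x).symm z)).map_smul c _)

/-- The bracket `([X, Y], L_X β - ι_Y dα)` on smooth sections. -/
def dorfmanLinear : Sections F (genAtlas 𝓑 M) →ₗ[ℝ] Sections F (genAtlas 𝓑 M) →ₗ[ℝ]
    Sections F (genAtlas 𝓑 M) :=
  LinearMap.mk₂ ℝ (fun s s' => ⟨dorfmanBracket 𝓑 s.1 s'.1, dorfmanBracket_mem 𝓑 s.2 s'.2⟩)
    (fun s s' t => Subtype.ext (funext fun x => dorfmanBracket_add_left 𝓑 s.2 s'.2 t.2 x))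
    (fun c s t => Subtype.ext (funext fun x => dorfmanBracket_smul_left 𝓑 c s.2 t.2 x))
    (fun t s s' => Subtype.ext (funext fun x => dorfmanBracket_add_right 𝓑 s.2 s'.2 t.2 x))
    (fun c t s => Subtype.ext (funext fun x => dorfmanBracket_smul_right 𝓑 c s.2 t.2 x))

/-- An outer bracket differentiates the inner one, so the local formula is needed near the point and
not only at it. -/
theorem locSection_dorfmanBracket_eventuallyEq {s s' : ∀ x : M, GenTangentAt 𝓑 x}
    (hs : s ∈ Sections F (genAtlas 𝓑 M)) (hs' : s' ∈ Sections F (genAtlas 𝓑 M)) (x : M) :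
    locSection 𝓑 (chartAt F x) (dorfmanBracket 𝓑 s s') =ᶠ[𝓝 (chartAt F x x)]
      locBracket (locSection 𝓑 (chartAt F x) s) (locSection 𝓑 (chartAt F x) s') := by
  filter_upwards [(chartAt F x).open_target.mem_nhds (mem_chart_target F x)] with y hy
  exact locSection_dorfmanBracket 𝓑 hs hs' (chart_mem_atlas F x) hy

theorem dorfmanBracket_leibniz_identity {s₁ s₂ s₃ : ∀ x : M, GenTangentAt 𝓑 x}
    (h₁ : s₁ ∈ Sections F (genAtlas 𝓑 M)) (h₂ : s₂ ∈ Sections F (genAtlas 𝓑 M))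
    (h₃ : s₃ ∈ Sections F (genAtlas 𝓑 M)) (x : M) :
    dorfmanBracket 𝓑 s₁ (dorfmanBracket 𝓑 s₂ s₃) x =
      dorfmanBracket 𝓑 (dorfmanBracket 𝓑 s₁ s₂) s₃ x +
        dorfmanBracket 𝓑 s₂ (dorfmanBracket 𝓑 s₁ s₃) x := by
  have hca := chart_mem_atlas F x
  rw [dorfmanBracket_eq_locBracket 𝓑 h₁ (dorfmanBracket_mem 𝓑 h₂ h₃),
    dorfmanBracket_eq_locBracket 𝓑 (dorfmanBracket_mem 𝓑 h₁ h₂) h₃,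
    dorfmanBracket_eq_locBracket 𝓑 h₂ (dorfmanBracket_mem 𝓑 h₁ h₃),
    locBracket_congr (EventuallyEq.refl _ _) (locSection_dorfmanBracket_eventuallyEq 𝓑 h₂ h₃ x),
    locBracket_congr (locSection_dorfmanBracket_eventuallyEq 𝓑 h₁ h₂ x) (EventuallyEq.refl _ _),
    locBracket_congr (EventuallyEq.refl _ _) (locSection_dorfmanBracket_eventuallyEq 𝓑 h₁ h₃ x)]
  exact locBracket_leibniz (chartAt F x).open_target ((mem_sections_genAtlas 𝓑).1 h₁ _ hca)
    ((mem_sections_genAtlas 𝓑).1 h₂ _ hca) ((mem_sections_genAtlas 𝓑).1 h₃ _ hca)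
    (mem_chart_target F x)

theorem dFun_pairing {s t : ∀ x : M, GenTangentAt 𝓑 x} (x : M) :
    dFun F (fun y => genPairing 𝓑 y (s y) (t y)) x =
      mbDeriv (locPairing (locSection 𝓑 (chartAt F x) s) (locSection 𝓑 (chartAt F x) t))
        (chartAt F x x) :=
  mbDeriv_comp_symm_congr (pairing_comp_symm_eqOn 𝓑 (chart_mem_atlas F x)) (mem_chart_target F x)

theorem dorfmanBracket_add_swap {s t : ∀ x : M, GenTangentAt 𝓑 x}
    (hs : s ∈ Sections F (genAtlas 𝓑 M)) (ht : t ∈ Sections F (genAtlas 𝓑 M)) (x : M) :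
    dorfmanBracket 𝓑 s t x + dorfmanBracket 𝓑 t s x =
      ((0 : F), dForm 𝓑 (fun y => genPairing 𝓑 y (s y) (t y)) x) := by
  have hca := chart_mem_atlas F x
  rw [dorfmanBracket_eq_locBracket 𝓑 hs ht, dorfmanBracket_eq_locBracket 𝓑 ht hs,
    locBracket_add_swap (chartAt F x).open_target ((mem_sections_genAtlas 𝓑).1 hs _ hca)
    ((mem_sections_genAtlas 𝓑).1 ht _ hca) (mem_chart_target F x), dForm, dFun_pairing]

theorem dorfmanBracket_invariance {s t r : ∀ x : M, GenTangentAt 𝓑 x}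
    (hs : s ∈ Sections F (genAtlas 𝓑 M)) (ht : t ∈ Sections F (genAtlas 𝓑 M))
    (hr : r ∈ Sections F (genAtlas 𝓑 M)) (x : M) :
    dFun F (fun y => genPairing 𝓑 y (t y) (r y)) x (s x).1 =
      genPairing 𝓑 x (dorfmanBracket 𝓑 s t x) (r x) +
        genPairing 𝓑 x (t x) (dorfmanBracket 𝓑 s r x) := by
  have hca := chart_mem_atlas F x
  have key := mbDeriv_locPairing_eq (σ := locSection 𝓑 (chartAt F x) s)
    (chartAt F x).open_target ((mem_sections_genAtlas 𝓑).1 ht _ hca)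
    ((mem_sections_genAtlas 𝓑).1 hr _ hca) (mem_chart_target F x)
  rw [locPairing, locPairing, ← dorfmanBracket_eq_locBracket 𝓑 hs ht,
    ← dorfmanBracket_eq_locBracket 𝓑 hs hr] at key
  simp only [locSection_chartAt] at key
  rw [dFun_pairing, key]
  rfl

variable (M) in
theorem isBundleMap_genAnchor :
    IsBundleMap F (genAtlas 𝓑 M) (tangentAtlas F M) (genAnchor 𝓑) := by
  rintro _ ⟨e, he, rfl⟩ _ ⟨e', he', rfl⟩
  refine ⟨_, (msmoothOn_genChange 𝓑 he he').clm_comp (ContinuousLinearMap.postcomp (F × BDual 𝓑)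
    (ContinuousLinearMap.fst ℝ F (BDual 𝓑))), fun x hx v => ?_⟩
  exact congrArg Prod.fst (genChange_genTriv 𝓑 he he' hx.1 hx.2 v).symm

variable (M) in
theorem isCourantAlgebroid_genAtlas :
    IsCourantAlgebroid F (genAtlas 𝓑 M) (genAnchor 𝓑) (genPairing 𝓑) (dorfmanLinear 𝓑) where
  isVectorBundle := isVectorBundle_genAtlas M 𝓑
  anchor_smooth := isBundleMap_genAnchor M 𝓑
  symmetric x v w := add_comm _ _
  nondegenerate x v h := by
    refine Prod.ext ?_ (DFunLike.ext _ _ fun w => ?_)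
    -- Continuous functionals separate the points of `F`, so pairing with `(0, α)` detects the
    -- vector part; pairing with `(w, 0)` detects the covector.
    · by_contra hne
      obtain ⟨α, hα⟩ := SeparatingDual.exists_ne_zero (R := ℝ) hne
      refine hα ?_
      have := h (0, toBDual 𝓑 α)
      rw [genPairing_apply] at this
      have h0 : v.2 (0 : F) = 0 := map_zero (ofBDual 𝓑 v.2)
      rwa [h0, zero_add, toBDual_apply] at this
    · have := h (w, 0)
      rw [genPairing_apply] at this
      have h0 : (0 : BDual 𝓑) v.1 = 0 := rfl
      rwa [h0, add_zero] at this
  form_smooth s₁ s₂ := msmoothOn_pairing 𝓑 s₁.2 s₂.2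
  leibniz_identity s₁ s₂ s₃ := Subtype.ext (funext fun x =>
    dorfmanBracket_leibniz_identity 𝓑 s₁.2 s₂.2 s₃.2 x)
  invariance s₁ s₂ s₃ x := dorfmanBracket_invariance 𝓑 s₁.2 s₂.2 s₃.2 x
  symmetric_part := by
    refine ⟨fun f => ⟨fun x => ((0 : F), dForm 𝓑 f.1 x), dForm_mem_sections 𝓑 f.2⟩,
      fun f x v => ?_, fun s₁ s₂ => Subtype.ext (funext fun x =>
        dorfmanBracket_add_swap 𝓑 s₁.2 s₂.2 x)⟩
    rw [genPairing_apply]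
    have h0 : v.2 (0 : F) = 0 := map_zero (ofBDual 𝓑 v.2)
    rw [h0, add_zero]
    rfl

end Courant

/-! ### Subbundles as vector bundles, and their smooth sections. -/

section SubbundleTheory

variable {F M : Type*} [AddCommGroup F] [Module ℝ F] [TopologicalSpace F] [FrechetSpace F]
  [TopologicalSpace M] [ChartedSpace F M] {V V' : M → Type*} {E E' : Type*}
  [∀ x, AddCommGroup (V x)] [∀ x, Module ℝ (V x)] [∀ x, TopologicalSpace (V x)]
  [∀ x, AddCommGroup (V' x)] [∀ x, Module ℝ (V' x)]
  [AddCommGroup E] [Module ℝ E] [TopologicalSpace E] [IsTopologicalAddGroup E] [ContinuousSMul ℝ E]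
  [AddCommGroup E'] [Module ℝ E'] [TopologicalSpace E'] [IsTopologicalAddGroup E']
  [ContinuousSMul ℝ E']

theorem MSmoothOn.clm_apply {G : M → E →L[ℝ] E'} {f : M → E} {U : Set M} (hG : MSmoothOn F G U)
    (hf : MSmoothOn F f U) : MSmoothOn F (fun x => G x (f x)) U :=
  fun c hc => (hG c hc).clm_apply (hf c hc)

theorem MSmoothOn.of_isClosedEmbedding {W W' : Type*} [AddCommGroup W] [Module ℝ W]
    [TopologicalSpace W] [AddCommGroup W'] [Module ℝ W'] [TopologicalSpace W']
    {L : W →L[ℝ] W'} (hL : IsClosedEmbedding L) {f : M → W} {U : Set M} (hU : IsOpen U)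
    (hf : MSmoothOn F (fun x => L (f x)) U) : MSmoothOn F f U :=
  fun c hc => SmoothOn.of_isClosedEmbedding hL (isOpen_overlap c hU) (hf c hc)

/-- A representation by a smooth map to `L(E, E')` is jointly smooth if `E` is first countable. -/
theorem IsSmoothRep.isJointlySmoothRep [FirstCountableTopology E] {t : LocTriv V E}
    {t' : LocTriv V' E'} {ψ : ∀ x, V x →ₗ[ℝ] V' x} (h : IsSmoothRep F t t' ψ) :
    IsJointlySmoothRep F t t' ψ := by
  obtain ⟨G, hG, hr⟩ := h
  intro e he
  have h1 := (hG e he).fst_comp (E' := E)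
  exact ⟨fun p => G (e.symm p.1) p.2, h1.clm_apply (ContinuousLinearMap.snd ℝ F E).smoothOn,
    fun y hy v => hr _ hy.2 v⟩

/-- Smoothness of a section may be tested in any covering subfamily of a bundle atlas. -/
theorem IsVectorBundle.sections_of_cover {A B : Set (LocTriv V E)} (hB : IsVectorBundle F B)
    (hA : A ⊆ B) (hc : ∀ x, ∃ t ∈ A, x ∈ t.base) {s : ∀ x, V x} (hs : s ∈ Sections F A) :
    s ∈ Sections F B := by
  have := hB.locallyConvex
  have := hB.hausdorff
  intro t' ht'
  refine MSmoothOn.of_local (hB.isOpen_base t' ht') fun x hx => ?_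
  obtain ⟨t, ht, hxt⟩ := hc x
  have ho := (hB.isOpen_base t (hA ht)).inter (hB.isOpen_base t' ht')
  refine ⟨t.base ∩ t'.base, ho, ⟨hxt, hx⟩, ?_⟩
  obtain ⟨G, hG, hr⟩ := hB.transition t (hA ht) t' ht'
  exact (hG.clm_apply (MSmoothOn.mono (hs t ht) inter_subset_left)).congr ho
    fun x hx => hr x hx (s x)

theorem IsVectorBundle.sections_iff {A B : Set (LocTriv V E)} (h : IsVectorBundle F (A ∪ B))
    (hA : ∀ x, ∃ t ∈ A, x ∈ t.base) (hB : ∀ x, ∃ t ∈ B, x ∈ t.base) {s : ∀ x, V x} :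
    s ∈ Sections F A ↔ s ∈ Sections F B :=
  ⟨fun hs t ht => h.sections_of_cover subset_union_left hA hs t (Or.inr ht),
    fun hs t ht => h.sections_of_cover subset_union_right hB hs t (Or.inl ht)⟩

variable {A : Set (LocTriv V E)} (D : Subbundle F A)

theorem Subbundle.isClosedEmbedding_subtypeL : IsClosedEmbedding D.model.subtypeL :=
  D.isClosed_model.isClosedEmbedding_subtypeVal

theorem Subbundle.coe_restrictTriv {t : LocTriv V E} (ht : t ∈ D.trivs) {x : M} (hx : x ∈ t.base)
    (v : D.fibre x) : ((D.restrictTriv t).toLin x v : E) = t.toLin x v := by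
  have h : ∀ v : D.fibre x, ((t.toLin x).comp (D.fibre x).subtype) v ∈ D.model :=
    fun v => (D.adapted t ht x hx v).1 v.2
  simp only [Subbundle.restrictTriv]
  rw [dif_pos h]
  rfl

/-- Compatibility moves the test to the adapted trivializations; there, closedness of the model
makes smoothness into it the same as smoothness into `E`. -/
theorem Subbundle.mem_sections_atlas (hA : ∀ x, ∃ t ∈ A, x ∈ t.base) (s : ∀ x, D.fibre x) :
    s ∈ Sections F D.atlas ↔ D.incl s ∈ Sections F A := by
  rw [D.compatible.sections_iff hA D.cover]
  constructor
  · intro h t ht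
    have ho := D.compatible.isOpen_base t (Or.inr ht)
    have h1 : MSmoothOn F (fun x => (D.restrictTriv t).toLin x (s x)) t.base :=
      h _ (mem_image_of_mem _ ht)
    exact (h1.clm_comp D.model.subtypeL).congr ho fun x hx =>
      (D.coe_restrictTriv ht hx (s x)).symm
  · rintro h _ ⟨t, ht, rfl⟩
    have ho := D.compatible.isOpen_base t (Or.inr ht)
    refine MSmoothOn.of_isClosedEmbedding D.isClosedEmbedding_subtypeL (U := t.base) ho ?_
    exact MSmoothOn.congr (h t ht) ho fun x hx => D.coe_restrictTriv ht hx (s x)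

/-- Having values in `S` is the intersection of the conditions `L v ∈ S`, each closed because
evaluation at `v` is continuous. -/
theorem isClosedEmbedding_postcomp_subtypeL {S : Submodule ℝ E} (hS : IsClosed (S : Set E)) :
    IsClosedEmbedding (ContinuousLinearMap.postcomp (σ := RingHom.id ℝ) E' S.subtypeL :
      (E' →L[ℝ] S) →L[ℝ] E' →L[ℝ] E) := by
  refine ⟨ContinuousLinearMap.isEmbedding_postcomp _ IsEmbedding.subtypeVal, ?_⟩
  have : range (ContinuousLinearMap.postcomp (σ := RingHom.id ℝ) E' S.subtypeL :
      (E' →L[ℝ] S) →L[ℝ] E' →L[ℝ] E) = ⋂ v : E', {L | L v ∈ (S : Set E)} := by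
    ext L
    simp only [mem_range, mem_iInter]
    constructor
    · rintro ⟨L, rfl⟩ v
      exact (L v).2
    · intro h
      exact ⟨L.codRestrict S h, rfl⟩
  rw [this]
  exact isClosed_iInter fun v => hS.preimage (continuous_eval_const v)

theorem Subbundle.isVectorBundle : IsVectorBundle F D.atlas where
  locallyConvex := by
    have := D.compatible.locallyConvex
    infer_instance
  hausdorff := by
    have := D.compatible.hausdorff
    infer_instance
  isOpen_base := by
    rintro _ ⟨t, ht, rfl⟩
    exact D.compatible.isOpen_base t (Or.inr ht)
  cover x := by
    obtain ⟨t, ht, hx⟩ := D.cover x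
    exact ⟨_, mem_image_of_mem _ ht, hx⟩
  equiv := by
    rintro _ ⟨t, ht, rfl⟩ x hx
    obtain ⟨L, hL⟩ := D.compatible.equiv t (Or.inr ht) x hx
    have h1 : ∀ v : D.fibre x, L v ∈ D.model := fun v => by
      rw [hL]
      exact (D.adapted t ht x hx v).1 v.2
    have h2 : ∀ v : D.model, L.symm v ∈ D.fibre x := fun v => by
      rw [D.adapted t ht x hx, ← hL, L.apply_symm_apply]
      exact v.2
    refine ⟨ContinuousLinearEquiv.equivOfInverse
      (((L : V x →L[ℝ] E).comp (D.fibre x).subtypeL).codRestrict D.model h1)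
      (((L.symm : E →L[ℝ] V x).comp D.model.subtypeL).codRestrict (D.fibre x) h2)
      (fun v => Subtype.ext (L.symm_apply_apply _)) (fun v => Subtype.ext (L.apply_symm_apply _)),
      fun v => Subtype.ext ?_⟩
    rw [D.coe_restrictTriv ht hx]
    exact hL v
  transition := by
    rintro _ ⟨t, ht, rfl⟩ _ ⟨t', ht', rfl⟩
    obtain ⟨G, hG, hr⟩ := D.compatible.transition t (Or.inr ht) t' (Or.inr ht')
    have ho : IsOpen (t.base ∩ t'.base) := (D.compatible.isOpen_base t (Or.inr ht)).inter
      (D.compatible.isOpen_base t' (Or.inr ht'))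
    -- Each `m` in the model is the coordinate of a vector in the fibre of `D`, whose coordinate in
    -- `t'` lies in the model again.
    have hm : ∀ x ∈ t.base ∩ t'.base, ∀ m : D.model, G x m ∈ D.model := by
      intro x hx m
      obtain ⟨L, hL⟩ := D.compatible.equiv t (Or.inr ht) x hx.1
      have e : t.toLin x (L.symm m) = m := by rw [← hL, L.apply_symm_apply]
      have hv : L.symm m ∈ D.fibre x := by
        rw [D.adapted t ht x hx.1, e]
        exact m.2
      rw [← e, ← hr x hx]
      exact (D.adapted t' ht' x hx.2 _).1 hv
    have hex : ∀ x, ∃ H : D.model →L[ℝ] D.model, x ∈ t.base ∩ t'.base →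
        ∀ m : D.model, (H m : E) = G x m := by
      intro x
      by_cases hx : x ∈ t.base ∩ t'.base
      · exact ⟨((G x).comp D.model.subtypeL).codRestrict D.model (hm x hx), fun _ _ => rfl⟩
      · exact ⟨0, fun h => (hx h).elim⟩
    choose H hH using hex
    refine ⟨H, ?_, fun x hx v => Subtype.ext ?_⟩
    · have h1 : MSmoothOn F (fun x => (G x).comp D.model.subtypeL) (t.base ∩ t'.base) :=
        -- Restricting the source is continuous and linear; restricting the target uses that
        -- `L(D.model, D.model)` is closed in `L(D.model, E)`.
        hG.clm_comp (ContinuousLinearMap.precomp E D.model.subtypeL)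
      have h2 : MSmoothOn F (fun x => D.model.subtypeL.comp (H x)) (t.base ∩ t'.base) :=
        h1.congr ho fun x hx => ContinuousLinearMap.ext fun m => hH x hx m
      exact MSmoothOn.of_isClosedEmbedding (f := H)
        (L := ContinuousLinearMap.postcomp D.model D.model.subtypeL)
        (isClosedEmbedding_postcomp_subtypeL (E' := D.model) D.isClosed_model) ho h2
    · rw [hH x hx, D.coe_restrictTriv ht hx.1]
      rw [LinearMap.id_apply, D.coe_restrictTriv ht' hx.2, ← hr x hx]
      rfl

/-- The restriction of a smooth bundle map to a subbundle is smooth. -/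
theorem Subbundle.isSmoothRep_restrict {t : LocTriv V E} (ht : t ∈ D.trivs) {t' : LocTriv V' E'}
    {ψ : ∀ x, V x →ₗ[ℝ] V' x} (h : IsSmoothRep F t t' ψ) :
    IsSmoothRep F (D.restrictTriv t) t' (fun x => (ψ x).comp (D.fibre x).subtype) := by
  obtain ⟨G, hG, hr⟩ := h
  refine ⟨_, hG.clm_comp (ContinuousLinearMap.precomp E' D.model.subtypeL), fun x hx v => ?_⟩
  refine (hr x hx v).trans ?_
  rw [← D.coe_restrictTriv ht hx.1]
  rfl

end SubbundleTheory

/-- A skew-symmetric bracket which is a derivation of itself satisfies the Jacobi identity. -/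
theorem jacobi_of_leibniz {G : Type*} [AddCommGroup G] [Module ℝ G] (b : G →ₗ[ℝ] G →ₗ[ℝ] G)
    (h : ∀ s t, b s t + b t s = 0)
    (hb : ∀ s₁ s₂ s₃, b s₁ (b s₂ s₃) = b (b s₁ s₂) s₃ + b s₂ (b s₁ s₃)) (s₁ s₂ s₃ : G) :
    b s₁ (b s₂ s₃) + b s₂ (b s₃ s₁) + b s₃ (b s₁ s₂) = 0 := by
  have h3 : b s₂ (b s₁ s₃) + b s₂ (b s₃ s₁) = 0 := by rw [← map_add, h, map_zero]
  rw [hb s₁ s₂ s₃, add_assoc (b (b s₁ s₂) s₃), h3, add_zero, h]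

/-! ### Dirac structures as Lie algebroids. -/

section Dirac

variable {F M : Type*} [AddCommGroup F] [Module ℝ F] [TopologicalSpace F] [FrechetSpace F]
  [TopologicalSpace M] [ChartedSpace F M] [FrechetManifold F M] {𝓑 : FrechetBornology F}
  (D : Subbundle F (genAtlas 𝓑 M))

/-- Adapted and chart trivializations belong to one compatible atlas, so the anchor is the first
component of a transition function. -/
theorem Subbundle.isBundleMap_proj : IsBundleMap F D.atlas (tangentAtlas F M) (D.proj 𝓑) := by
  rintro _ ⟨t, ht, rfl⟩ _ ⟨e, he, rfl⟩
  refine D.isSmoothRep_restrict ht ?_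
  obtain ⟨G, hG, hr⟩ := D.compatible.transition t (Or.inr ht) (genTriv 𝓑 e)
    (Or.inl (mem_image_of_mem _ he))
  exact ⟨_, hG.clm_comp (ContinuousLinearMap.postcomp (F × BDual 𝓑)
    (ContinuousLinearMap.fst ℝ F (BDual 𝓑))), fun x hx v => congrArg Prod.fst (hr x hx v)⟩

theorem Subbundle.mem_sections_iff (s : ∀ x, D.fibre x) :
    s ∈ Sections F D.atlas ↔ D.incl s ∈ Sections F (genAtlas 𝓑 M) :=
  D.mem_sections_atlas (isVectorBundle_genAtlas M 𝓑).cover s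

/-- The inclusion of the sections of a subbundle into those of the generalized tangent bundle. -/
def Subbundle.inclSections (s : Sections F D.atlas) : Sections F (genAtlas 𝓑 M) :=
  ⟨D.incl s.1, (D.mem_sections_iff s.1).1 s.2⟩

theorem Subbundle.inclSections_injective : Function.Injective D.inclSections := by
  intro s t h
  refine Subtype.ext (funext fun x => Subtype.ext ?_)
  exact congrFun (congrArg Subtype.val h) x

theorem Subbundle.inclSections_add (s t : Sections F D.atlas) :
    D.inclSections (s + t) = D.inclSections s + D.inclSections t := rfl

theorem Subbundle.inclSections_smul (c : ℝ) (s : Sections F D.atlas) :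
    D.inclSections (c • s) = c • D.inclSections s := rfl

variable {D} (hD : IsDiracStructure 𝓑 D)

/-- The bracket on the sections of a Dirac structure, before bilinearity. -/
def IsDiracStructure.bracketFun (hD : IsDiracStructure 𝓑 D) (s t : Sections F D.atlas) :
    Sections F D.atlas :=
  ⟨fun x => ⟨dorfmanBracket 𝓑 (D.incl s.1) (D.incl t.1) x,
    hD.closed_bracket _ (D.inclSections s).2 _ (D.inclSections t).2 (fun x => (s.1 x).2)
      (fun x => (t.1 x).2) x⟩,
    (D.mem_sections_iff _).2 (dorfmanLinear 𝓑 (D.inclSections s) (D.inclSections t)).2⟩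

theorem IsDiracStructure.inclSections_bracketFun (s t : Sections F D.atlas) :
    D.inclSections (hD.bracketFun s t) =
      dorfmanLinear 𝓑 (D.inclSections s) (D.inclSections t) := rfl

/-- The Lie bracket on the sections of a Dirac structure. -/
def IsDiracStructure.bracket (hD : IsDiracStructure 𝓑 D) :
    Sections F D.atlas →ₗ[ℝ] Sections F D.atlas →ₗ[ℝ] Sections F D.atlas :=
  LinearMap.mk₂ ℝ hD.bracketFun
    (fun s s' t => D.inclSections_injective <| by
      simp only [D.inclSections_add, hD.inclSections_bracketFun, map_add, LinearMap.add_apply])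
    (fun c s t => D.inclSections_injective <| by
      simp only [D.inclSections_smul, hD.inclSections_bracketFun, map_smul, LinearMap.smul_apply])
    (fun t s s' => D.inclSections_injective <| by
      simp only [D.inclSections_add, hD.inclSections_bracketFun, map_add])
    (fun c t s => D.inclSections_injective <| by
      simp only [D.inclSections_smul, hD.inclSections_bracketFun, map_smul])

theorem dForm_zero (x : M) : dForm 𝓑 (fun _ : M => (0 : ℝ)) x = 0 := by
  have : dFun F (fun _ : M => (0 : ℝ)) x = 0 := mbDeriv_const 0 _
  rw [dForm, this]
  rfl

theorem IsDiracStructure.dForm_pairing (hD : IsDiracStructure 𝓑 D)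
    (s t : Sections F D.atlas) (x : M) :
    dForm 𝓑 (fun y => genPairing 𝓑 y (D.incl s.1 y) (D.incl t.1 y)) x = 0 := by
  have : (fun y => genPairing 𝓑 y (D.incl s.1 y) (D.incl t.1 y)) = fun _ => (0 : ℝ) :=
    funext fun y => (hD.maximal_isotropic y _).1 (s.1 y).2 _ (t.1 y).2
  rw [this, dForm_zero]

/-- The bracket on `D` is built from `dorfmanBracket`, for which closedness is assumed and the
Leibniz identity holds. Isotropy removes the correction term that separates it from the Courant
bracket. -/
theorem IsDiracStructure.bracket_eq_courantBracket (s t : Sections F D.atlas) (x : M) :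
    ((hD.bracket s t).1 x : GenTangentAt 𝓑 x) =
      courantBracket 𝓑 (D.incl s.1) (D.incl t.1) x := by
  have e := courantBracket_eq 𝓑 (s := D.incl s.1) (s' := D.incl t.1)
    (D.inclSections s).2 (D.inclSections t).2 x
  rw [e, hD.dForm_pairing]
  have : ((0 : F), (0 : BDual 𝓑)) = 0 := rfl
  rw [this, smul_zero, sub_zero]
  rfl

/-- The symmetric part is the differential of a pairing that vanishes identically on `D`. -/
theorem IsDiracStructure.bracket_add_swap (hD : IsDiracStructure 𝓑 D)
    (s t : Sections F D.atlas) :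
    hD.bracket s t + hD.bracket t s = 0 := by
  refine D.inclSections_injective (Subtype.ext (funext fun x => ?_))
  have := dorfmanBracket_add_swap 𝓑 (D.inclSections s).2 (D.inclSections t).2 x
  exact this.trans (Prod.ext rfl (hD.dForm_pairing s t x))

theorem IsDiracStructure.bracket_leibniz_identity (hD : IsDiracStructure 𝓑 D)
    (s₁ s₂ s₃ : Sections F D.atlas) :
    hD.bracket s₁ (hD.bracket s₂ s₃) =
      hD.bracket (hD.bracket s₁ s₂) s₃ + hD.bracket s₂ (hD.bracket s₁ s₃) := by
  refine D.inclSections_injective (Subtype.ext (funext fun x => ?_))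
  exact dorfmanBracket_leibniz_identity 𝓑 (D.inclSections s₁).2 (D.inclSections s₂).2
    (D.inclSections s₃).2 x

theorem IsDiracStructure.anchor_bracket (hD : IsDiracStructure 𝓑 D) (s₁ s₂ : Sections F D.atlas)
    (x : M) : D.proj 𝓑 x ((hD.bracket s₁ s₂).1 x) =
      lieBracketField (fun y => D.proj 𝓑 y (s₁.1 y)) (fun y => D.proj 𝓑 y (s₂.1 y)) x :=
  rfl

theorem IsDiracStructure.bracket_fun_smul (hD : IsDiracStructure 𝓑 D) (s₁ s₂ : Sections F D.atlas)
    (f : SmoothFunction F M) (x : M) : (hD.bracket s₁ (smulSection F f s₂)).1 x =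
      f.1 x • (hD.bracket s₁ s₂).1 x + dFun F f.1 x (D.proj 𝓑 x (s₁.1 x)) • s₂.1 x := by
  have key := dorfmanBracket_fun_smul 𝓑 (s := D.incl s₁.1) (t := D.incl s₂.1) f.2
    (D.inclSections s₁).2 (D.inclSections s₂).2 (smulSection F f (D.inclSections s₂)).2 x
  refine Subtype.ext ?_
  rw [Submodule.coe_add, Submodule.coe_smul, Submodule.coe_smul]
  exact key

theorem IsDiracStructure.bracket_self (hD : IsDiracStructure 𝓑 D) (s : Sections F D.atlas) :
    hD.bracket s s = 0 := by
  have h := hD.bracket_add_swap s s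
  rw [← two_smul ℝ] at h
  exact (smul_eq_zero.1 h).resolve_left two_ne_zero

theorem IsDiracStructure.bracket_jacobi (hD : IsDiracStructure 𝓑 D)
    (s₁ s₂ s₃ : Sections F D.atlas) :
    hD.bracket s₁ (hD.bracket s₂ s₃) + hD.bracket s₂ (hD.bracket s₃ s₁) +
      hD.bracket s₃ (hD.bracket s₁ s₂) = 0 :=
  jacobi_of_leibniz hD.bracket hD.bracket_add_swap hD.bracket_leibniz_identity s₁ s₂ s₃

theorem IsDiracStructure.isLieAlgebroid (hD : IsDiracStructure 𝓑 D) :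
    IsLieAlgebroid F D.atlas (D.proj 𝓑) hD.bracket where
  isVectorBundle := D.isVectorBundle
  anchor_smooth := D.isBundleMap_proj
  alternating := hD.bracket_self
  jacobi := hD.bracket_jacobi
  anchor_bracket := hD.anchor_bracket
  leibniz := hD.bracket_fun_smul

theorem IsDiracStructure.isFrechetLieAlgebroid (hD : IsDiracStructure 𝓑 D)
    [h : FrechetSpace D.model] : IsFrechetLieAlgebroid F D.atlas (D.proj 𝓑) hD.bracket where
  toIsLieAlgebroid := hD.isLieAlgebroid
  frechet_fibre := h
  transition_smooth t ht t' ht' := (D.isVectorBundle.transition t ht t' ht').isJointlySmoothRep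
  anchor_jointly_smooth t ht t' ht' := (D.isBundleMap_proj t ht t' ht').isJointlySmoothRep

end Dirac

end

theorem mainTheorem2 {F M : Type*} [AddCommGroup F] [Module ℝ F] [TopologicalSpace F]
    [FrechetSpace F] [TopologicalSpace M] [ChartedSpace F M] [FrechetManifold F M]
    (𝓑 : FrechetBornology F) :
    -- the generalized tangent bundle is a Courant algebroid
    (∃ br : Sections F (genAtlas 𝓑 M) →ₗ[ℝ] Sections F (genAtlas 𝓑 M) →ₗ[ℝ]
        Sections F (genAtlas 𝓑 M),
      (∀ s s' x, (br s s').1 x = dorfmanBracket 𝓑 s.1 s'.1 x) ∧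
      IsCourantAlgebroid F (genAtlas 𝓑 M) (genAnchor 𝓑) (genPairing 𝓑) br ∧
      (∀ s s' x, genAnchor 𝓑 x ((br s s').1 x) =
        lieBracketField (fun y => genAnchor 𝓑 y (s.1 y)) (fun y => genAnchor 𝓑 y (s'.1 y)) x) ∧
      (∀ s s' (f : SmoothFunction F M) x, (br s (smulSection F f s')).1 x =
        f.1 x • (br s s').1 x + dFun F f.1 x (genAnchor 𝓑 x (s.1 x)) • s'.1 x)) ∧
    -- the Courant bracket is a bracket on smooth sections
    (∀ s ∈ Sections F (genAtlas 𝓑 M), ∀ s' ∈ Sections F (genAtlas 𝓑 M),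
      courantBracket 𝓑 s s' ∈ Sections F (genAtlas 𝓑 M)) ∧
    -- every Dirac structure is a Lie algebroid under the restricted Courant bracket
    ∀ D : Subbundle F (genAtlas 𝓑 M), IsDiracStructure 𝓑 D →
      (∀ s : ∀ x, D.fibre x,
        s ∈ Sections F D.atlas ↔ D.incl s ∈ Sections F (genAtlas 𝓑 M)) ∧
      ∃ br : Sections F D.atlas →ₗ[ℝ] Sections F D.atlas →ₗ[ℝ] Sections F D.atlas,
        (∀ s s' x, ((br s s').1 x : GenTangentAt 𝓑 x) =
          courantBracket 𝓑 (D.incl s.1) (D.incl s'.1) x) ∧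
        IsLieAlgebroid F D.atlas (D.proj 𝓑) br ∧
        (FrechetSpace D.model → IsFrechetLieAlgebroid F D.atlas (D.proj 𝓑) br) := by
  refine ⟨⟨dorfmanLinear 𝓑, fun _ _ _ => rfl, isCourantAlgebroid_genAtlas M 𝓑,
    fun _ _ _ => rfl, fun s s' f x =>
      dorfmanBracket_fun_smul 𝓑 f.2 s.2 s'.2 (smulSection F f s').2 x⟩,
    fun s hs s' hs' => courantBracket_mem 𝓑 hs hs', fun D hD => ⟨D.mem_sections_iff,
      hD.bracket, hD.bracket_eq_courantBracket, hD.isLieAlgebroid,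
      fun _ => hD.isFrechetLieAlgebroid⟩⟩
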